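/- Let $\Sigma$ be a compact smooth manifold of dimension $n$ (possibly with boundary), let $m\in\mathbb N\cup\{0\}$, and let $p,r\in[1,\infty]$ with $p>n$. Lebesgue and Sobolev spaces on $\Sigma$ are defined through weak derivatives in charts and normed with the help of a finite family of charts and compact subsets of their domains covering $\Sigma$ (all choices give equivalent norms). Let $$\mathrm{Imm}^{2,p}(\Sigma;\mathbb R^m)=\{f\in W^{2,p}(\Sigma;\mathbb R^m) : \mathrm df|_x \text{ is injective for all } x\in\Sigma\},$$ where $\mathrm df|_x$ is the differential of the $C^1$ representative of $f$. For $f\in \mathrm{Imm}^{2,p}(\Sigma;\mathbb R^m)$ let $\mathrm df^\dagger|_x\colon\mathbb R^m\to T_x\Sigma$ denote the Moore–Penrose pseudoinverse of $\mathrm df|_x$ (it does not depend on the choice of an inner product on $T_x\Sigma$, since $\mathrm df|_x$ is injective). Then $\mathrm{Imm}^{2,p}(\Sigma;\mathbb R^m)$ is open in $W^{2,p}(\Sigma;\mathbb R^m)$, and for all $f\in\mathrm{Imm}^{2,p}(\Sigma;\mathbb R^m)$ and $u\in W^{2,r}(\Sigma;\mathbb R^m)$ the function $\mathrm du\,\mathrm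 df^\dagger\colon\Sigma\to\mathrm{Hom}(\mathbb R^m;\mathbb R^m)$ has a weak differential, and the Hessian of $u$ with respect to the metric induced by $f$, $$\mathrm{Hess}_f(u)(X,Y)=\bigl(\mathrm d(\mathrm du\,\mathrm df^\dagger)\,X\bigr)\cdot(\mathrm df\,Y)\qquad\text{for vector fields } X,Y \text{ on }\Sigma,$$ is a well-defined (that is, unique up to null sets), symmetric element of $L^{\min(p,r)}(\Sigma;\mathrm{Sym}^2(T\Sigma;\mathbb R^m))$. Moreover, $\mathrm{Hess}_f\colon W^{2,r}(\Sigma;\mathbb R^m)\to L^{\min(p,r)}(\Sigma;\mathrm{Sym}^2(T\Sigma;\mathbb R^m))$ is a continuous linear operator for each $f \in \mathrm{Imm}^{2,p}(\Sigma;\mathbb R^m)$, and the map $f\mapsto\mathrm{Hess}_f$ from $\mathrm{Imm}^{2,p}(\Sigma;\mathbb R^m)$ into the space of continuous linear operators, with the operator norm, is smooth ($C^\infty$ in the sense of Fréchet). -/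

import Mathlib

open MeasureTheory Set Topology
open scoped ENNReal Manifold ContDiff

noncomputable section

/- Throughout, `E` is a finite-dimensional Euclidean space, the model of manifolds of dimension
`dim E` (with its Lebesgue measure `volume`), and `F` is a Euclidean space, the target `ℝᵐ`. -/

/-- `v` is the weak (Fréchet) derivative of `u` on the open set `Ω ⊆ E`: both are locally
integrable on `Ω` and `∫ (∂_w φ) u = - ∫ φ (v w)` for all directions `w` and all test functions
`φ ∈ C_c^∞(Ω)`. -/
def HasWeakFDerivOn {E : Type*} [NormedAddCommGroup E] [InnerProductSpace ℝ E]
    [FiniteDimensional ℝ E] [MeasurableSpace E] [BorelSpace E]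
    {G : Type*} [NormedAddCommGroup G] [NormedSpace ℝ G]
    (Ω : Set E) (u : E → G) (v : E → E →L[ℝ] G) : Prop :=
  LocallyIntegrableOn u Ω volume ∧ LocallyIntegrableOn v Ω volume ∧
    ∀ φ : E → ℝ, ContDiff ℝ ∞ φ → HasCompactSupport φ → tsupport φ ⊆ Ω →
      ∀ w : E, ∫ y, fderiv ℝ φ y w • u y = -∫ y, φ y • v y w

namespace HasWeakFDerivOn

variable {E : Type*} [NormedAddCommGroup E] [InnerProductSpace ℝ E]
    [FiniteDimensional ℝ E] [MeasurableSpace E] [BorelSpace E]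
    {G : Type*} [NormedAddCommGroup G] [NormedSpace ℝ G]
  {Ω : Set E} {u u' : E → G} {v v' : E → E →L[ℝ] G}

section Generic

variable {X : Type*} [NormedAddCommGroup X] [NormedSpace ℝ X] {g g' : E → X}

theorem locallyIntegrableOn_zero' : LocallyIntegrableOn (fun _ : E => (0 : X)) Ω volume :=
  locallyIntegrableOn_zero

theorem locallyIntegrableOn_add (h : LocallyIntegrableOn g Ω volume)
    (h' : LocallyIntegrableOn g' Ω volume) :
    LocallyIntegrableOn (fun y => g y + g' y) Ω volume := h.add h'

theorem locallyIntegrableOn_smul (h : LocallyIntegrableOn g Ω volume) (a : ℝ) :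
    LocallyIntegrableOn (fun y => a • g y) Ω volume := h.smul a

theorem integrable_smul (hg : LocallyIntegrableOn g Ω volume) {ψ : E → ℝ} (hψ : Continuous ψ)
    (hc : HasCompactSupport ψ) (hs : tsupport ψ ⊆ Ω) : Integrable (fun y => ψ y • g y) := by
  have h := (hg.integrableOn_compact_subset hs hc).continuousOn_smul hψ.continuousOn hc
  refine (integrableOn_iff_integrable_of_support_subset ?_).1 h
  intro y hy
  exact subset_tsupport ψ fun h0 => hy (by simp [h0])

end Generic

theorem integrable_left (h : HasWeakFDerivOn Ω u v) {φ : E → ℝ} (hφ : ContDiff ℝ ∞ φ)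
    (hc : HasCompactSupport φ) (hs : tsupport φ ⊆ Ω) (w : E) :
    Integrable (fun y => fderiv ℝ φ y w • u y) :=
  integrable_smul h.1 ((hφ.continuous_fderiv (by simp)).clm_apply continuous_const)
    (hc.fderiv_apply ℝ w)
    ((tsupport_fderiv_apply_subset ℝ w).trans hs)

theorem integrable_right (h : HasWeakFDerivOn Ω u v) {φ : E → ℝ} (hφ : ContDiff ℝ ∞ φ)
    (hc : HasCompactSupport φ) (hs : tsupport φ ⊆ Ω) (w : E) :
    Integrable (fun y => φ y • v y w) :=
  (ContinuousLinearMap.apply ℝ G w).integrable_comp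
    (integrable_smul h.2.1 hφ.continuous hc hs)

theorem add (h : HasWeakFDerivOn Ω u v) (h' : HasWeakFDerivOn Ω u' v') :
    HasWeakFDerivOn Ω (fun y => u y + u' y) (fun y => v y + v' y) := by
  refine ⟨locallyIntegrableOn_add h.1 h'.1, locallyIntegrableOn_add h.2.1 h'.2.1, fun φ hφ hc hs w => ?_⟩
  simp only [smul_add, add_apply]
  rw [integral_add (h.integrable_left hφ hc hs w) (h'.integrable_left hφ hc hs w),
    integral_add (h.integrable_right hφ hc hs w) (h'.integrable_right hφ hc hs w),
    h.2.2 φ hφ hc hs w, h'.2.2 φ hφ hc hs w, neg_add]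

theorem const_smul (h : HasWeakFDerivOn Ω u v) (a : ℝ) :
    HasWeakFDerivOn Ω (fun y => a • u y) (fun y => a • v y) := by
  refine ⟨locallyIntegrableOn_smul h.1 a, locallyIntegrableOn_smul h.2.1 a, fun φ hφ hc hs w => ?_⟩
  simp only [smul_apply, smul_comm _ a]
  rw [integral_smul, integral_smul, h.2.2 φ hφ hc hs w, smul_neg]

theorem zero : HasWeakFDerivOn Ω (fun _ => (0 : G)) (fun _ => 0) := by
  exact ⟨locallyIntegrableOn_zero', locallyIntegrableOn_zero', fun φ _ _ _ w => by simp⟩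

end HasWeakFDerivOn

/-- The four Penrose equations: `P` is the Moore–Penrose pseudoinverse of `L`. When `L` is
injective, `P` does not depend on the inner product of the source `V`. -/
def IsMoorePenroseInverse {V F : Type*} [NormedAddCommGroup V] [InnerProductSpace ℝ V]
    [NormedAddCommGroup F] [InnerProductSpace ℝ F] (L : V →L[ℝ] F) (P : F →L[ℝ] V) : Prop :=
  (∀ v, L (P (L v)) = L v) ∧ (∀ z, P (L (P z)) = P z) ∧
    (∀ z z', inner ℝ (L (P z)) z' = inner ℝ z (L (P z'))) ∧
    ∀ v v', inner ℝ (P (L v)) v' = inner ℝ v (P (L v'))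

section Manifold

variable {E : Type*} [NormedAddCommGroup E] [InnerProductSpace ℝ E]
    [FiniteDimensional ℝ E] [MeasurableSpace E] [BorelSpace E]
    {F : Type*} [NormedAddCommGroup F] [InnerProductSpace ℝ F]
    {H : Type*} [TopologicalSpace H] (I : ModelWithCorners ℝ (E) H)
  {M : Type*} [TopologicalSpace M] [ChartedSpace H M]

/-- A property holds at almost every point of the manifold: in every chart it holds Lebesgue
almost everywhere. -/
def ChartAE (Q : M → Prop) : Prop :=
  ∀ c : M, ∀ᵐ y ∂(volume.restrict (extChartAt I c).target), Q ((extChartAt I c).symm y)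

/-- The tangent map `E → T_xM`, `x = κ⁻¹ y`, of the inverse of the chart `κ` around `c`; its
columns are the coordinate vector fields of that chart. -/
def chartFrame (c : M) (y : E) :
    E →L[ℝ] TangentSpace I ((extChartAt I c).symm y) :=
  mfderivWithin 𝓘(ℝ, E) I (extChartAt I c).symm (range I) y

/-- The coordinate expression in the chart around `c` of a section `σ` of `Hom(TM; G)`. -/
def chartForm {G : Type*} [NormedAddCommGroup G] [NormedSpace ℝ G]
    (σ : ∀ x : M, TangentSpace I x →L[ℝ] G) (c : M) (y : E) : E →L[ℝ] G :=
  (σ ((extChartAt I c).symm y)).comp (chartFrame I c y)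

/-- The coordinate expression in the chart around `c` of a section `S` of the bundle of `F`-valued
bilinear forms on `TM`. -/
def chartBilin
    (S : ∀ x : M, TangentSpace I x →L[ℝ] TangentSpace I x →L[ℝ] F) (c : M) (y : E) :
    E →L[ℝ] E →L[ℝ] F :=
  ((chartFrame I c y).precomp F).comp ((S ((extChartAt I c).symm y)).comp (chartFrame I c y))

/-- The section `σ` of `Hom(TM; G)` is the weak differential of `u : M → G`: in the interior of
every chart it is the weak derivative. -/
def HasWeakDifferential {G : Type*} [NormedAddCommGroup G] [NormedSpace ℝ G]
    (u : M → G) (σ : ∀ x : M, TangentSpace I x →L[ℝ] G) : Prop :=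
  ∀ c : M, HasWeakFDerivOn (interior (extChartAt I c).target)
    (fun y => u ((extChartAt I c).symm y)) (chartForm I σ c)

variable (M) in
/-- Finitely many charts together with compact subsets of their (coordinate) domains which cover
the manifold. They serve to compute Lebesgue and Sobolev norms; on a compact manifold any two
choices give equivalent norms. -/
structure ChartCover where
  /-- number of charts -/
  size : ℕ
  /-- the points around which the charts are taken -/
  center : Fin size → M
  /-- the compact pieces, in coordinates -/
  piece : Fin size → Set E
  isCompact_piece : ∀ i, IsCompact (piece i)
  piece_subset : ∀ i, piece i ⊆ (extChartAt I (center i)).target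
  covers : ∀ x : M, ∃ i, x ∈ (extChartAt I (center i)).source ∧
    extChartAt I (center i) x ∈ piece i

/-- Chart covers exist on compact manifolds. -/
theorem ChartCover.nonempty [CompactSpace M] : Nonempty (ChartCover I M) := by
  have h : ∀ c : M, ∃ ε > 0, Metric.closedBall (extChartAt I c c) ε ∩ range I ⊆
      (extChartAt I c).target := by
    intro c
    have := extChartAt_target_mem_nhdsWithin (I := I) c
    obtain ⟨ε, hε, h⟩ := Metric.mem_nhdsWithin_iff.1 this
    exact ⟨ε / 2, half_pos hε, fun y hy =>
      h ⟨Metric.closedBall_subset_ball (half_lt_self hε) hy.1, hy.2⟩⟩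
  choose ε hε hsub using h
  have hU : ∀ c : M, (extChartAt I c).source ∩
      extChartAt I c ⁻¹' Metric.closedBall (extChartAt I c c) (ε c) ∈ 𝓝 c := fun c =>
    Filter.inter_mem (extChartAt_source_mem_nhds (I := I) c)
      ((continuousAt_extChartAt (I := I) c).preimage_mem_nhds
        (Metric.closedBall_mem_nhds _ (hε c)))
  obtain ⟨t, ht⟩ := CompactSpace.elim_nhds_subcover _ hU
  refine ⟨⟨t.card, fun i => (t.equivFin.symm i : M),
    fun i => Metric.closedBall (extChartAt I (t.equivFin.symm i : M) (t.equivFin.symm i : M))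
      (ε (t.equivFin.symm i : M)) ∩ range I,
    fun i => (isCompact_closedBall _ _).inter_right I.isClosed_range, fun i => hsub _, ?_⟩⟩
  intro x
  have hx : x ∈ (⊤ : Set M) := trivial
  rw [← ht] at hx
  obtain ⟨c, hc, hx⟩ := mem_iUnion₂.1 hx
  refine ⟨t.equivFin ⟨c, hc⟩, ?_⟩
  simp only [Equiv.symm_apply_apply]
  refine ⟨hx.1, hx.2, ?_⟩
  exact extChartAt_target_subset_range (I := I) c ((extChartAt I c).map_source hx.1)

variable {I}

/-- Families of `X`-valued functions of class `L^r` on the pieces of the cover, with the maximum of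
the `L^r` norms. -/
def PieceLp (𝒰 : ChartCover I M) (r : ℝ≥0∞) (X : Type*) [NormedAddCommGroup X] : Type _ :=
  ∀ i : Fin 𝒰.size, Lp X r (volume.restrict (𝒰.piece i))

instance PieceLp.instNormedAddCommGroup (𝒰 : ChartCover I M) (r : ℝ≥0∞) (X : Type*)
    [NormedAddCommGroup X] [Fact (1 ≤ r)] : NormedAddCommGroup (PieceLp 𝒰 r X) :=
  inferInstanceAs (NormedAddCommGroup (∀ i, Lp X r (volume.restrict (𝒰.piece i))))

instance PieceLp.instNormedSpace (𝒰 : ChartCover I M) (r : ℝ≥0∞) (X : Type*)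
    [NormedAddCommGroup X] [NormedSpace ℝ X] [Fact (1 ≤ r)] : NormedSpace ℝ (PieceLp 𝒰 r X) :=
  inferInstanceAs (NormedSpace ℝ (∀ i, Lp X r (volume.restrict (𝒰.piece i))))

section

variable {𝒰 : ChartCover I M} {r : ℝ≥0∞} {X : Type*} [NormedAddCommGroup X] [NormedSpace ℝ X]
  [Fact (1 ≤ r)]

theorem PieceLp.coeFn_zero (i : Fin 𝒰.size) :
    (0 : PieceLp 𝒰 r X) i =ᵐ[volume.restrict (𝒰.piece i)] fun _ => (0 : X) :=
  Lp.coeFn_zero _ _ _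

theorem PieceLp.coeFn_add (s t : PieceLp 𝒰 r X) (i : Fin 𝒰.size) :
    (s + t) i =ᵐ[volume.restrict (𝒰.piece i)] fun y => s i y + t i y :=
  Lp.coeFn_add (s i) (t i)

theorem PieceLp.coeFn_smul (a : ℝ) (t : PieceLp 𝒰 r X) (i : Fin 𝒰.size) :
    (a • t) i =ᵐ[volume.restrict (𝒰.piece i)] fun y => a • t i y :=
  Lp.coeFn_smul a (t i)

end

/-- Local `2`-jets: on each piece of the cover a function, a first and a second derivative, all of
class `L^r`. -/
abbrev LocalJets (𝒰 : ChartCover I M) (r : ℝ≥0∞) (F : Type*) [NormedAddCommGroup F]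
    [InnerProductSpace ℝ F] : Type _ :=
  PieceLp 𝒰 r F × PieceLp 𝒰 r (E →L[ℝ] F) × PieceLp 𝒰 r (E →L[ℝ] E →L[ℝ] F)

/-- `u : M → F` has weak derivatives up to order two in all charts, and `t` consists of `u` and
of its first and second weak derivatives in the charts of the cover. -/
def IsWeakJetOf {𝒰 : ChartCover I M} {r : ℝ≥0∞} (t : LocalJets 𝒰 r F)
    (u : M → F) : Prop :=
  ∃ (du : ∀ x : M, TangentSpace I x →L[ℝ] F)
    (ddu : M → E → E →L[ℝ] E →L[ℝ] F),
    HasWeakDifferential I u du ∧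
    (∀ c : M, HasWeakFDerivOn (interior (extChartAt I c).target) (chartForm I du c) (ddu c)) ∧
    ∀ i, t.1 i =ᵐ[volume.restrict (𝒰.piece i)]
        (fun y => u ((extChartAt I (𝒰.center i)).symm y)) ∧
      t.2.1 i =ᵐ[volume.restrict (𝒰.piece i)] chartForm I du (𝒰.center i) ∧
      t.2.2 i =ᵐ[volume.restrict (𝒰.piece i)] ddu (𝒰.center i)


/-- The local `2`-jets of functions of class `W^{2,r}` form a linear space. -/
def sobolevJets (𝒰 : ChartCover I M) (r : ℝ≥0∞) (F : Type*) [NormedAddCommGroup F]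
    [InnerProductSpace ℝ F] [Fact (1 ≤ r)] :
    Submodule ℝ (LocalJets 𝒰 r F) where
  carrier := {t | ∃ u : M → F, IsWeakJetOf t u}
  zero_mem' := by
    refine ⟨fun _ => 0, fun _ => 0, fun _ _ => 0, ?_, ?_, fun i => ⟨?_, ?_, ?_⟩⟩
    · intro c
      have : chartForm I (fun _ : M => (0 : _ →L[ℝ] F)) c = fun _ => 0 := by
        funext y; ext X; rfl
      rw [this]
      exact HasWeakFDerivOn.zero
    · intro c
      have : chartForm I (fun _ : M => (0 : _ →L[ℝ] F)) c = fun _ => 0 := by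
        funext y; ext X; rfl
      rw [this]
      exact HasWeakFDerivOn.zero
    · exact PieceLp.coeFn_zero i
    · refine (PieceLp.coeFn_zero i).trans (Filter.Eventually.of_forall fun y => ?_)
      ext X; rfl
    · exact PieceLp.coeFn_zero i
  add_mem' := by
    rintro s t ⟨u, du, ddu, h1, h2, h3⟩ ⟨u', du', ddu', h1', h2', h3'⟩
    have hf : ∀ c, chartForm I (fun x => du x + du' x) c =
        fun y => chartForm I du c y + chartForm I du' c y := fun c => by
      funext y; ext X; rfl
    refine ⟨fun x => u x + u' x, fun x => du x + du' x, fun c y => ddu c y + ddu' c y,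
      fun c => ?_, fun c => ?_, fun i => ⟨?_, ?_, ?_⟩⟩
    · rw [hf]; exact (h1 c).add (h1' c)
    · rw [hf]; exact (h2 c).add (h2' c)
    · filter_upwards [PieceLp.coeFn_add s.1 t.1 i, (h3 i).1, (h3' i).1] with y a b c
      refine a.trans ?_
      rw [b, c]
    · filter_upwards [PieceLp.coeFn_add s.2.1 t.2.1 i, (h3 i).2.1, (h3' i).2.1] with y a b c
      refine a.trans ?_
      rw [b, c]
      ext X; rfl
    · filter_upwards [PieceLp.coeFn_add s.2.2 t.2.2 i, (h3 i).2.2, (h3' i).2.2] with y a b c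
      refine a.trans ?_
      rw [b, c]
  smul_mem' := by
    rintro a t ⟨u, du, ddu, h1, h2, h3⟩
    have hf : ∀ c, chartForm I (fun x => a • du x) c = fun y => a • chartForm I du c y :=
      fun c => by funext y; ext X; rfl
    refine ⟨fun x => a • u x, fun x => a • du x, fun c y => a • ddu c y,
      fun c => ?_, fun c => ?_, fun i => ⟨?_, ?_, ?_⟩⟩
    · rw [hf]; exact (h1 c).const_smul a
    · rw [hf]; exact (h2 c).const_smul a
    · filter_upwards [PieceLp.coeFn_smul a t.1 i, (h3 i).1] with y b c
      refine b.trans ?_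
      rw [c]
    · filter_upwards [PieceLp.coeFn_smul a t.2.1 i, (h3 i).2.1] with y b c
      refine b.trans ?_
      rw [c]
      ext X; rfl
    · filter_upwards [PieceLp.coeFn_smul a t.2.2 i, (h3 i).2.2] with y b c
      refine b.trans ?_
      rw [c]

/-- The Sobolev space `W^{2,r}(M; F)` of a compact manifold `M`, for `r ∈ [1, ∞]`: a function class
is identified with the collection of its weak derivatives of order at most two in the charts of the
cover, and normed by the maximum of their `L^r` norms. -/
def SobolevTwo (𝒰 : ChartCover I M) (r : ℝ≥0∞) (F : Type*) [NormedAddCommGroup F]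
    [InnerProductSpace ℝ F] [Fact (1 ≤ r)] : Type _ :=
  sobolevJets 𝒰 r F

instance SobolevTwo.instNormedAddCommGroup (𝒰 : ChartCover I M) (r : ℝ≥0∞) (F : Type*)
    [NormedAddCommGroup F] [InnerProductSpace ℝ F] [Fact (1 ≤ r)] :
    NormedAddCommGroup (SobolevTwo 𝒰 r F) :=
  inferInstanceAs (NormedAddCommGroup (sobolevJets 𝒰 r F))

instance SobolevTwo.instNormedSpace (𝒰 : ChartCover I M) (r : ℝ≥0∞) (F : Type*)
    [NormedAddCommGroup F] [InnerProductSpace ℝ F] [Fact (1 ≤ r)] :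
    NormedSpace ℝ (SobolevTwo 𝒰 r F) :=
  inferInstanceAs (NormedSpace ℝ (sobolevJets 𝒰 r F))

/-- `t` consists of the coordinate expressions of the section `S` of `Sym²(TM; F)` in the charts
of the cover. -/
def IsSymFormOf {𝒰 : ChartCover I M} {q : ℝ≥0∞}
    (t : PieceLp 𝒰 q (E →L[ℝ] E →L[ℝ] F))
    (S : ∀ x : M, TangentSpace I x →L[ℝ] TangentSpace I x →L[ℝ] F) : Prop :=
  (∀ x X Y, S x X Y = S x Y X) ∧
    ∀ i, t i =ᵐ[volume.restrict (𝒰.piece i)] chartBilin I S (𝒰.center i)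

/-- The coordinate expressions of sections of `Sym²(TM; F)` of class `L^q` form a linear space. -/
def symForms (𝒰 : ChartCover I M) (q : ℝ≥0∞) (F : Type*) [NormedAddCommGroup F]
    [InnerProductSpace ℝ F] [Fact (1 ≤ q)] :
    Submodule ℝ (PieceLp 𝒰 q (E →L[ℝ] E →L[ℝ] F)) where
  carrier := {t | ∃ S : ∀ x : M, TangentSpace I x →L[ℝ] TangentSpace I x →L[ℝ] F,
    IsSymFormOf t S}
  zero_mem' := by
    refine ⟨fun _ => 0, fun _ _ _ => rfl, fun i => ?_⟩
    refine (PieceLp.coeFn_zero i).trans (Filter.Eventually.of_forall fun y => ?_)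
    ext X Y; rfl
  add_mem' := by
    rintro s t ⟨S, hS, h⟩ ⟨S', hS', h'⟩
    refine ⟨fun x => S x + S' x, fun x X Y => ?_, fun i => ?_⟩
    · simp [hS x X Y, hS' x X Y]
    · filter_upwards [PieceLp.coeFn_add s t i, h i, h' i] with y a b c
      refine a.trans ?_
      rw [b, c]
      ext X Y; rfl
  smul_mem' := by
    rintro a t ⟨S, hS, h⟩
    refine ⟨fun x => a • S x, fun x X Y => ?_, fun i => ?_⟩
    · simp [hS x X Y]
    · filter_upwards [PieceLp.coeFn_smul a t i, h i] with y b c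
      refine b.trans ?_
      rw [c]
      ext X Y; rfl

/-- The Lebesgue space `L^q(M; Sym²(TM; F))` of a compact manifold `M`, for `q ∈ [1, ∞]`: a section
is identified with the collection of its coordinate expressions in the charts of the cover, and
normed by the maximum of their `L^q` norms. -/
def LebesgueSym (𝒰 : ChartCover I M) (q : ℝ≥0∞) (F : Type*) [NormedAddCommGroup F]
    [InnerProductSpace ℝ F] [Fact (1 ≤ q)] : Type _ :=
  symForms 𝒰 q F

instance LebesgueSym.instNormedAddCommGroup (𝒰 : ChartCover I M) (q : ℝ≥0∞) (F : Type*)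
    [NormedAddCommGroup F] [InnerProductSpace ℝ F] [Fact (1 ≤ q)] :
    NormedAddCommGroup (LebesgueSym 𝒰 q F) :=
  inferInstanceAs (NormedAddCommGroup (symForms 𝒰 q F))

instance LebesgueSym.instNormedSpace (𝒰 : ChartCover I M) (q : ℝ≥0∞) (F : Type*)
    [NormedAddCommGroup F] [InnerProductSpace ℝ F] [Fact (1 ≤ q)] :
    NormedSpace ℝ (LebesgueSym 𝒰 q F) :=
  inferInstanceAs (NormedSpace ℝ (symForms 𝒰 q F))

/-- The set `Imm^{2,p}(M; F)` of those `f ∈ W^{2,p}(M; F)` whose continuously differentiable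
representative has an injective differential at every point of `M`. -/
def SobolevImm (𝒰 : ChartCover I M) (p : ℝ≥0∞) (F : Type*) [NormedAddCommGroup F]
    [InnerProductSpace ℝ F] [Fact (1 ≤ p)] :
    Set (SobolevTwo 𝒰 p F) :=
  {f | ∃ f₀ : M → F, IsWeakJetOf f.1 f₀ ∧ ContMDiff I 𝓘(ℝ, F) 1 f₀ ∧
    ∀ x : M, Function.Injective (mfderiv I 𝓘(ℝ, F) f₀ x)}

variable (I) in
/-- The section `S` is the Hessian of `u` with respect to the metric induced by `f`:
the function `A = du df† : M → Hom(F; F)` has a weak differential `dA`, and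
`S(X, Y) = (dA X) (df Y)` almost everywhere. -/
def IsHessian (f u : M → F)
    (S : ∀ x : M, TangentSpace I x →L[ℝ] TangentSpace I x →L[ℝ] F) : Prop :=
  ∃ (df du : ∀ x : M, TangentSpace I x →L[ℝ] F)
    (dfInv : ∀ x : M, F →L[ℝ] TangentSpace I x)
    (dA : ∀ x : M, TangentSpace I x →L[ℝ] (F →L[ℝ] F)),
    HasWeakDifferential I f df ∧ HasWeakDifferential I u du ∧
    ChartAE I (fun x : M => IsMoorePenroseInverse (V := E) (df x) (dfInv x)) ∧
    HasWeakDifferential I (fun x => (du x).comp (dfInv x)) dA ∧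
    ChartAE I (fun x : M => ∀ X Y : TangentSpace I x, S x X Y = dA x X (df x Y))

/-- `s ∈ L^q(M; Sym²(TM; F))` is the Hessian of `u ∈ W^{2,r}` with respect to the metric induced
by `f ∈ W^{2,p}`. -/
def IsHessianClass {𝒰 : ChartCover I M} {p r q : ℝ≥0∞} [Fact (1 ≤ p)] [Fact (1 ≤ r)]
    [Fact (1 ≤ q)] (f : SobolevTwo 𝒰 p F) (u : SobolevTwo 𝒰 r F) (s : LebesgueSym 𝒰 q F) : Prop :=
  ∃ (f₀ u₀ : M → F) (S : ∀ x : M, TangentSpace I x →L[ℝ] TangentSpace I x →L[ℝ] F),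
    IsWeakJetOf f.1 f₀ ∧ IsWeakJetOf u.1 u₀ ∧
    IsSymFormOf s.1 S ∧ IsHessian I f₀ u₀ S

end Manifold

instance factOneLeMin (p r : ℝ≥0∞) [hp : Fact (1 ≤ p)] [hr : Fact (1 ≤ r)] :
    Fact (1 ≤ min p r) := ⟨le_min hp.out hr.out⟩

end

set_option linter.unusedSectionVars false
set_option maxSynthPendingDepth 3

open Filter

/-! ### Weak derivatives on open sets: uniqueness, symmetry, locality, closedness. -/

namespace HasWeakFDerivOn

variable {E : Type*} [NormedAddCommGroup E] [InnerProductSpace ℝ E]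
    [FiniteDimensional ℝ E] [MeasurableSpace E] [BorelSpace E]
    {G : Type*} [NormedAddCommGroup G] [NormedSpace ℝ G]
    {Ω U : Set E} {u u' : E → G} {v v' : E → E →L[ℝ] G}

/-! The whole statement rests on one formula. Let `L = Df`, `P = L†`, and let `Du`, `D²u`, `D²f` be
the derivatives in a chart. Differentiating `P L = id` along `N` gives `(DP N) L = -P N`, so the
derivative of `Du P` in the direction `X`, applied to `L Y`, is `D²u(X, Y) - Du P D²f(X, Y)`. The
derivative of the pseudoinverse disappears, because it is only evaluated on the range of `L`.
Symmetry is then that of second weak derivatives, and uniqueness is that of weak derivatives. The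
algebra is in `fderiv_pseudoinverse_comp` and `compPseudoinverseDeriv_apply`.

Analytically, `p > n` is used in two ways. First, `W^{2,p}` embeds into `C¹`, so `f ↦ Df` is
continuous and linear into the continuous maps on each compact piece. Injectivity of all values is
therefore an open condition, and `P` is continuous on the pieces. Secondly, multiplication is
bounded `W^{1,r} × L^p → L^{min(p,r)}` (`IsSolidConvex.exists_eLpNorm_mul_le`), so `(P, f, u) ↦ Du P
D²f` is a bounded trilinear operator `N` (`exists_correction`). With `J` for the operator `u ↦ D²u`,
the Hessian is `J - N(P(f), f, ·)`. Since `P = (L* L)⁻¹ L*`, and inversion is smooth on the units of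
the Banach algebra of continuous families of endomorphisms, `f ↦ P(f)` is smooth, and so is the
Hessian in operator norm. A bounded projection of the piecewise `L^q` forms onto those that come
from symmetric sections (`exists_symForms_retraction`) puts the values into the right space.

The Sobolev theory is developed on compact convex sets with nonempty interior. Near a boundary point
a chart contains such a set, the intersection of a ball with the convex range of the model, so no
extension operator is needed. Functions are smoothed by averaging over the points `(1 - ε) x + ε w`,
with `w` in a fixed interior ball. By convexity these points stay inside the body, and the gradient
of the average is `1 - ε` times the average of the gradient. The multiplication inequality comes
from integrating along segments, and the embedding into `L^∞` is a special case of it. The product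
rule, the chain rule and the `C¹` representative follow by approximation.

The passage to the manifold uses the transformation of weak derivatives under coordinate changes.
The second derivatives transform with a first order term, so estimates are made for whole jets
(`exists_eLpNorm_jetSize_le`). They bound the jet over any compact part of any chart by the norm
computed with the given cover, whose pieces are arbitrary compact sets. -/

theorem mono (h : HasWeakFDerivOn Ω u v) (hU : U ⊆ Ω) : HasWeakFDerivOn U u v :=
  ⟨h.1.mono_set hU, h.2.1.mono_set hU, fun φ hφ hc hs w => h.2.2 φ hφ hc (hs.trans hU) w⟩

theorem integral_smul_congr {X : Type*} [NormedAddCommGroup X] [NormedSpace ℝ X]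
    {g g' : E → X} {ψ : E → ℝ} (hΩ : MeasurableSet Ω) (hs : tsupport ψ ⊆ Ω)
    (h : g =ᵐ[volume.restrict Ω] g') : ∫ y, ψ y • g y = ∫ y, ψ y • g' y := by
  refine integral_congr_ae ?_
  filter_upwards [(ae_restrict_iff' hΩ).1 h] with y hy
  by_cases hyΩ : y ∈ Ω
  · simp only [hy hyΩ]
  · simp only [image_eq_zero_of_notMem_tsupport fun h' => hyΩ (hs h'), zero_smul]

theorem congr (h : HasWeakFDerivOn Ω u v) (hΩ : MeasurableSet Ω)
    (hu : u =ᵐ[volume.restrict Ω] u') (hv : v =ᵐ[volume.restrict Ω] v') :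
    HasWeakFDerivOn Ω u' v' := by
  refine ⟨h.1.congr hu, h.2.1.congr hv, fun φ hφ hc hs w => ?_⟩
  rw [← integral_smul_congr hΩ ((tsupport_fderiv_apply_subset ℝ w).trans hs) hu, h.2.2 φ hφ hc hs w,
    integral_smul_congr hΩ hs (g := fun y => v y w) (g' := fun y => v' y w)
      (hv.fun_comp fun L => L w)]

theorem locallyIntegrableOn_apply (h : LocallyIntegrableOn v Ω volume) (w : E) :
    LocallyIntegrableOn (fun y => v y w) Ω volume :=
  (ContinuousLinearMap.apply ℝ G w).locallyIntegrableOn_comp h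

/-- A linear map is determined by its values on a finite basis, so only finitely many exceptional
null sets have to be united. -/
theorem ae_ext {μ : Measure E} (h : ∀ w : E, ∀ᵐ y ∂μ, v y w = v' y w) : v =ᵐ[μ] v' := by
  have : ∀ᵐ y ∂μ, ∀ i, v y (Module.finBasis ℝ E i) = v' y (Module.finBasis ℝ E i) :=
    ae_all_iff.2 fun i => h _
  filter_upwards [this] with y hy
  exact ContinuousLinearMap.coe_injective ((Module.finBasis ℝ E).ext hy)

/-- The difference of the two derivatives integrates to zero against every test function; the
fundamental lemma of the calculus of variations does the rest. -/
theorem ae_eq [CompleteSpace G] (hΩ : IsOpen Ω) (h : HasWeakFDerivOn Ω u v)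
    (h' : HasWeakFDerivOn Ω u v') : v =ᵐ[volume.restrict Ω] v' := by
  refine ae_ext fun w => ?_
  rw [ae_restrict_iff' hΩ.measurableSet]
  have key := hΩ.ae_eq_zero_of_integral_contDiff_smul_eq_zero (μ := volume)
    (f := fun y => v y w - v' y w)
    ((locallyIntegrableOn_apply h.2.1 w).sub (locallyIntegrableOn_apply h'.2.1 w))
    (fun φ hφ hc hs => by
      simp only [smul_sub]
      rw [integral_sub (h.integrable_right hφ hc hs w) (h'.integrable_right hφ hc hs w), sub_eq_zero]
      exact neg_injective ((h.2.2 φ hφ hc hs w).symm.trans (h'.2.2 φ hφ hc hs w)))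
  filter_upwards [key] with y hy hyΩ
  exact sub_eq_zero.1 (hy hyΩ)

/-- Second weak derivatives are symmetric. -/
theorem ae_symm [CompleteSpace G] {D : E → E →L[ℝ] E →L[ℝ] G} (hΩ : IsOpen Ω)
    (h : HasWeakFDerivOn Ω u v) (h' : HasWeakFDerivOn Ω v D) :
    ∀ᵐ y ∂volume.restrict Ω, ∀ w w', D y w w' = D y w' w := by
  have key : ∀ w w' : E, ∀ᵐ y ∂volume.restrict Ω, D y w w' = D y w' w := by
    intro w w'
    rw [ae_restrict_iff' hΩ.measurableSet]
    have hD : ∀ a b : E, LocallyIntegrableOn (fun y => D y a b) Ω volume := fun a b =>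
      locallyIntegrableOn_apply (locallyIntegrableOn_apply h'.2.1 a) b
    -- Both derivatives are moved onto the test function, whose second derivatives commute by
    -- Schwarz's theorem.
    have hint : ∀ a b : E, ∀ φ : E → ℝ, ContDiff ℝ ∞ φ → HasCompactSupport φ → tsupport φ ⊆ Ω →
        ∫ y, φ y • D y a b = ∫ y, fderiv ℝ (fun z => fderiv ℝ φ z a) y b • u y := by
      intro a b φ hφ hc hs
      have h1 : ContDiff ℝ ∞ fun z => fderiv ℝ φ z a :=
        (hφ.fderiv_right (by simp)).clm_apply contDiff_const
      have h2 := h.2.2 _ h1 (hc.fderiv_apply ℝ a)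
        ((tsupport_fderiv_apply_subset ℝ a).trans hs) b
      have h3 := congrArg (ContinuousLinearMap.apply ℝ G b) (h'.2.2 φ hφ hc hs a)
      rw [map_neg, ← ContinuousLinearMap.integral_comp_comm _ (h'.integrable_left hφ hc hs a),
        ← ContinuousLinearMap.integral_comp_comm _ (h'.integrable_right hφ hc hs a)] at h3
      simp only [ContinuousLinearMap.apply_apply, smul_apply] at h3
      rw [h2, h3, neg_neg]
    have := hΩ.ae_eq_zero_of_integral_contDiff_smul_eq_zero (μ := volume)
      (f := fun y => D y w w' - D y w' w) ((hD w w').sub (hD w' w))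
      (fun φ hφ hc hs => by
        simp only [smul_sub]
        rw [integral_sub (integrable_smul (hD w w') hφ.continuous hc hs)
          (integrable_smul (hD w' w) hφ.continuous hc hs), hint w w' φ hφ hc hs,
          hint w' w φ hφ hc hs, sub_eq_zero]
        refine integral_congr_ae (Eventually.of_forall fun y => ?_)
        have hd : DifferentiableAt ℝ (fderiv ℝ φ) y :=
          ((hφ.fderiv_right (m := ∞) (by simp)).differentiable (by simp)).differentiableAt
        have hs : IsSymmSndFDerivAt ℝ φ y :=
          hφ.contDiffAt.isSymmSndFDerivAt (by simp; exact WithTop.coe_le_coe.2 (le_top : (2 : ℕ∞) ≤ ⊤))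
        simp only
        congr 1
        rw [fderiv_clm_apply hd (differentiableAt_const _),
          fderiv_clm_apply hd (differentiableAt_const _)]
        simpa using hs w' w)
    filter_upwards [this] with y hy hyΩ
    exact sub_eq_zero.1 (hy hyΩ)
  have h1 := ae_ext (μ := volume.restrict Ω) (v := D) (v' := fun y => (D y).flip) fun w =>
    ae_ext (v := fun y => D y w) (v' := fun y => (D y).flip w) fun w' => key w w'
  filter_upwards [h1] with y hy w w'
  exact congrArg (fun L => L w w') hy

/-- Integration by parts; it asks for differentiability of `u` only on the support of the test
function, so the behaviour of `u` off `Ω` does not matter. -/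
theorem of_contDiffOn (hΩ : IsOpen Ω) (hu : ContDiffOn ℝ 1 u Ω) :
    HasWeakFDerivOn Ω u (fderiv ℝ u) := by
  have hd : ContinuousOn (fderiv ℝ u) Ω := hu.continuousOn_fderiv_of_isOpen hΩ le_rfl
  have h1 : LocallyIntegrableOn u Ω volume := hu.continuousOn.locallyIntegrableOn hΩ.measurableSet
  have h2 : LocallyIntegrableOn (fderiv ℝ u) Ω volume := hd.locallyIntegrableOn hΩ.measurableSet
  refine ⟨h1, h2, fun φ hφ hc hs w => ?_⟩
  rw [integral_smul_fderiv_eq_neg_fderiv_smul_of_integrable, neg_neg]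
  · exact integrable_smul h1 ((hφ.continuous_fderiv (by simp)).clm_apply continuous_const)
      (hc.fderiv_apply ℝ w) ((tsupport_fderiv_apply_subset ℝ w).trans hs)
  · exact integrable_smul (locallyIntegrableOn_apply h2 w) hφ.continuous hc hs
  · exact integrable_smul h1 hφ.continuous hc hs
  · exact fun x _ => (hφ.differentiable (by simp)).differentiableAt
  · exact fun x hx => (hu.differentiableOn one_ne_zero).differentiableAt (hΩ.mem_nhds (hs hx))

/-- Being a weak derivative is a local property. -/
theorem of_forall_exists (h : ∀ y ∈ Ω, ∃ U, IsOpen U ∧ y ∈ U ∧ HasWeakFDerivOn U u v) :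
    HasWeakFDerivOn Ω u v := by
  have h1 : LocallyIntegrableOn u Ω volume := fun y hy => by
    obtain ⟨U, hU, hyU, hi⟩ := h y hy
    have := hi.1 y hyU
    rw [hU.nhdsWithin_eq hyU] at this
    exact this.filter_mono nhdsWithin_le_nhds
  have h2 : LocallyIntegrableOn v Ω volume := fun y hy => by
    obtain ⟨U, hU, hyU, hi⟩ := h y hy
    have := hi.2.1 y hyU
    rw [hU.nhdsWithin_eq hyU] at this
    exact this.filter_mono nhdsWithin_le_nhds
  refine ⟨h1, h2, fun φ hφ hc hs w => ?_⟩
  choose! V hV hmem hw using h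
  obtain ⟨t, ht⟩ := hc.isCompact.elim_finite_subcover (fun y : Ω => V y) (fun y => hV y y.2)
    (fun y hy => mem_iUnion.2 ⟨⟨y, hs hy⟩, hmem y (hs hy)⟩)
  -- A partition of unity splits the test function into finitely many test functions, each supported
  -- in one of the sets where the claim is known.
  obtain ⟨ρ, hρ⟩ := SmoothPartitionOfUnity.exists_isSubordinate 𝓘(ℝ, E)
    (s := tsupport φ) (isClosed_tsupport φ) (fun y : t => V y) (fun y => hV y y.1.2)
    (fun y hy => by
      obtain ⟨z, hz, hyz⟩ := mem_iUnion₂.1 (ht hy)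
      exact mem_iUnion.2 ⟨⟨z, hz⟩, hyz⟩)
  have hρs : ∀ i, ContDiff ℝ ∞ (ρ i) := fun i => (ρ i).contMDiff.contDiff
  have hψs : ∀ i : t, ContDiff ℝ ∞ fun y => ρ i y * φ y := fun i => (hρs i).mul hφ
  have hψc : ∀ i : t, HasCompactSupport fun y => ρ i y * φ y := fun i => hc.mul_left
  have hψt : ∀ i : t, tsupport (fun y => ρ i y * φ y) ⊆ V i := fun i =>
    (tsupport_mul_subset_left (f := ρ i) (g := φ)).trans (hρ i)
  have hψΩ : ∀ i : t, tsupport (fun y => ρ i y * φ y) ⊆ Ω := fun i =>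
    (tsupport_mul_subset_right (f := ρ i) (g := φ)).trans hs
  have hsum : φ = fun y => ∑ i : t, ρ i y * φ y := by
    funext y
    rw [← Finset.sum_mul]
    by_cases hy : y ∈ tsupport φ
    · rw [← finsum_eq_sum_of_fintype, ρ.sum_eq_one hy, one_mul]
    · rw [image_eq_zero_of_notMem_tsupport hy, mul_zero]
  have hfd : ∀ y, fderiv ℝ φ y w = ∑ i : t, fderiv ℝ (fun z => ρ i z * φ z) y w := by
    intro y
    conv_lhs => rw [hsum]
    rw [fderiv_fun_sum fun i _ => ((hψs i).differentiable (by simp)).differentiableAt]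
    simp
  have hl : ∫ y, fderiv ℝ φ y w • u y =
      ∑ i : t, ∫ y, fderiv ℝ (fun z => ρ i z * φ z) y w • u y := by
    rw [← integral_finsetSum]
    · simp only [hfd, Finset.sum_smul]
    · intro i _
      exact integrable_smul h1 (((hψs i).continuous_fderiv (by simp)).clm_apply continuous_const)
        ((hψc i).fderiv_apply ℝ w) ((tsupport_fderiv_apply_subset ℝ w).trans (hψΩ i))
  have hr : ∫ y, φ y • v y w = ∑ i : t, ∫ y, (ρ i y * φ y) • v y w := by
    rw [← integral_finsetSum]
    · refine integral_congr_ae (Eventually.of_forall fun y => ?_)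
      simp only [← Finset.sum_smul]
      exact congrArg (· • v y w) (congrFun hsum y)
    · intro i _
      exact integrable_smul (locallyIntegrableOn_apply h2 w) (hψs i).continuous (hψc i) (hψΩ i)
  rw [hl, hr, ← Finset.sum_neg_distrib]
  exact Finset.sum_congr rfl fun i _ =>
    (hw i i.1.2).2.2 _ (hψs i) (hψc i) (hψt i) w

/-- A test function is bounded and vanishes off `Ω`, so convergence in `L¹(Ω)` passes through its
pairings. -/
theorem tendsto_integral_smul {X : Type*} [NormedAddCommGroup X] [NormedSpace ℝ X]
    {g : E → X} {f : ℕ → E → X} {ψ : E → ℝ} (hψ : Continuous ψ) (hc : HasCompactSupport ψ)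
    (hs : tsupport ψ ⊆ Ω) (hf : ∀ k, LocallyIntegrableOn (f k) Ω volume)
    (hg : LocallyIntegrableOn g Ω volume) (hΩ : MeasurableSet Ω)
    (h : Tendsto (fun k => eLpNorm (f k - g) 1 (volume.restrict Ω)) atTop (𝓝 0)) :
    Tendsto (fun k => ∫ y, ψ y • f k y) atTop (𝓝 (∫ y, ψ y • g y)) := by
  obtain ⟨C, hC⟩ := hc.exists_bound_of_continuous hψ
  refine tendsto_integral_of_L1' _ (integrable_smul hg hψ hc hs).1
    (Eventually.of_forall fun k => integrable_smul (hf k) hψ hc hs) ?_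
  have hle : ∀ k, eLpNorm ((fun y => ψ y • f k y) - fun y => ψ y • g y) 1 volume ≤
      ENNReal.ofReal C * eLpNorm (f k - g) 1 (volume.restrict Ω) := by
    intro k
    have : ((fun y => ψ y • f k y) - fun y => ψ y • g y) =
        Ω.indicator (fun y => ψ y • (f k - g) y) := by
      funext y
      by_cases hy : y ∈ Ω
      · simp [hy, smul_sub]
      · simp [hy, image_eq_zero_of_notMem_tsupport fun h' => hy (hs h')]
    rw [this, eLpNorm_indicator_eq_eLpNorm_restrict hΩ]
    refine eLpNorm_le_mul_eLpNorm_of_ae_le_mul (Eventually.of_forall fun y => ?_) 1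
    rw [norm_smul]
    exact mul_le_mul_of_nonneg_right (hC y) (norm_nonneg _)
  refine tendsto_of_tendsto_of_tendsto_of_le_of_le tendsto_const_nhds ?_ (fun _ => zero_le) hle
  simpa using ENNReal.Tendsto.const_mul h (Or.inr ENNReal.ofReal_ne_top)

/-- Weak derivatives are stable under `L¹` convergence. -/
theorem of_tendsto {f : ℕ → E → G} {f' : ℕ → E → E →L[ℝ] G} (hΩ : MeasurableSet Ω)
    (h : ∀ k, HasWeakFDerivOn Ω (f k) (f' k)) (hu : LocallyIntegrableOn u Ω volume)
    (hv : LocallyIntegrableOn v Ω volume)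
    (h1 : Tendsto (fun k => eLpNorm (f k - u) 1 (volume.restrict Ω)) atTop (𝓝 0))
    (h2 : Tendsto (fun k => eLpNorm (f' k - v) 1 (volume.restrict Ω)) atTop (𝓝 0)) :
    HasWeakFDerivOn Ω u v := by
  refine ⟨hu, hv, fun φ hφ hc hs w => ?_⟩
  have t1 := tendsto_integral_smul ((hφ.continuous_fderiv (by simp)).clm_apply continuous_const)
    (hc.fderiv_apply ℝ w) ((tsupport_fderiv_apply_subset ℝ w).trans hs)
    (fun k => (h k).1) hu hΩ h1
  have h2w : Tendsto (fun k => eLpNorm ((fun y => f' k y w) - fun y => v y w) 1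
      (volume.restrict Ω)) atTop (𝓝 0) := by
    have hle : ∀ k, eLpNorm ((fun y => f' k y w) - fun y => v y w) 1 (volume.restrict Ω) ≤
        ENNReal.ofReal ‖w‖ * eLpNorm (f' k - v) 1 (volume.restrict Ω) := by
      intro k
      refine eLpNorm_le_mul_eLpNorm_of_ae_le_mul (Eventually.of_forall fun y => ?_) 1
      rw [mul_comm]
      exact (f' k y - v y).le_opNorm w
    refine tendsto_of_tendsto_of_tendsto_of_le_of_le tendsto_const_nhds ?_ (fun _ => zero_le) hle
    simpa using ENNReal.Tendsto.const_mul h2 (Or.inr (ENNReal.ofReal_ne_top (r := ‖w‖)))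
  have t2 := tendsto_integral_smul hφ.continuous hc hs
    (fun k => locallyIntegrableOn_apply (h k).2.1 w) (locallyIntegrableOn_apply hv w) hΩ h2w
  refine tendsto_nhds_unique t1 (t2.neg.congr fun k => ?_)
  exact ((h k).2.2 φ hφ hc hs w).symm

end HasWeakFDerivOn

/-! ### Smooth approximation on convex bodies, up to the boundary. -/

section Averaging

variable {E : Type*} [NormedAddCommGroup E] [InnerProductSpace ℝ E]
    [FiniteDimensional ℝ E] [MeasurableSpace E] [BorelSpace E]
    {G : Type*} [NormedAddCommGroup G] [NormedSpace ℝ G]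

/-- Compact convex sets with nonempty interior. -/
structure IsSolidConvex {E : Type*} [NormedAddCommGroup E] [NormedSpace ℝ E] (K : Set E) : Prop where
  isCompact : IsCompact K
  convex : Convex ℝ K
  interior_nonempty : (interior K).Nonempty

theorem locallyIntegrable_indicator {X : Type*} [NormedAddCommGroup X] {K : Set E} {g : E → X}
    (hK : MeasurableSet K) (hg : IntegrableOn g K) : LocallyIntegrable (K.indicator g) volume :=
  (hg.integrable_indicator hK).locallyIntegrable

theorem memLp_indicator_of_restrict {X : Type*} [NormedAddCommGroup X] {K : Set E} {g : E → X}
    {r : ℝ≥0∞} (hK : MeasurableSet K) (hg : MemLp g r (volume.restrict K)) :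
    MemLp (K.indicator g) r volume :=
  (memLp_indicator_iff_restrict hK).2 hg

/-- Serves to absorb the factor `1 - ε` that the gradient of an average carries. -/
theorem eLpNorm_smul_sub_le {X : Type*} [NormedAddCommGroup X] [NormedSpace ℝ X] {μ : Measure E}
    {r : ℝ≥0∞} (hr1 : 1 ≤ r) {f g : E → X} (hf : AEStronglyMeasurable f μ)
    (hg : AEStronglyMeasurable g μ) {a : ℝ} (ha : 0 ≤ a) :
    eLpNorm (fun x => (1 - a) • f x - g x) r μ ≤
      eLpNorm (f - g) r μ + ENNReal.ofReal a * eLpNorm f r μ := by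
  have h1 : (fun x => (1 - a) • f x - g x) = (f - g) + (-a) • f := by
    funext x
    simp only [Pi.sub_apply, Pi.add_apply, Pi.smul_apply]
    module
  rw [h1]
  refine (eLpNorm_add_le (hf.sub hg) (hf.const_smul _) hr1).trans ?_
  rw [eLpNorm_const_smul, enorm_neg, Real.enorm_eq_ofReal ha]

theorem smul_indicator_of_tsupport_subset {X : Type*} [NormedAddCommGroup X] [NormedSpace ℝ X]
    {K : Set E} (g : E → X) {ψ : E → ℝ} (hψ : tsupport ψ ⊆ K) (y : E) :
    ψ y • K.indicator g y = ψ y • g y := by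
  by_cases hy : y ∈ K
  · rw [indicator_of_mem hy]
  · rw [image_eq_zero_of_notMem_tsupport fun h' => hy (hψ h'), zero_smul, zero_smul]

theorem lintegral_comp_smul_add (f : E → ℝ≥0∞) {c : ℝ} (hc : c ≠ 0) (a : E)
    (hf : Measurable f) :
    ∫⁻ x, f (c • x + a) = ENNReal.ofReal |(c ^ Module.finrank ℝ E)⁻¹| * ∫⁻ x, f x := by
  have h1 : ∫⁻ x, f (c • x + a) =
      ∫⁻ y, f (y + a) ∂(Measure.map (fun x : E => c • x) volume) :=
    (lintegral_map (hf.comp (measurable_id.add_const a)) (measurable_const_smul c)).symm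
  rw [h1, Measure.map_addHaar_smul volume hc, lintegral_smul_measure,
    lintegral_add_right_eq_self f a, smul_eq_mul]

theorem quasiMeasurePreserving_smul_add {c : ℝ} (hc : c ≠ 0) (a : E) :
    Measure.QuasiMeasurePreserving (fun w : E => c • w + a) volume volume := by
  refine ⟨by fun_prop, Measure.AbsolutelyContinuous.mk fun s hs h => ?_⟩
  rw [Measure.map_apply (by fun_prop) hs, ← lintegral_indicator_one₀
    (((by fun_prop : Measurable fun w : E => c • w + a) hs).nullMeasurableSet)]
  have := lintegral_comp_smul_add (s.indicator 1) hc a (measurable_one.indicator hs)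
  rw [lintegral_indicator_one hs, h, mul_zero] at this
  exact this

variable {b : E} (φ : ContDiffBump b)

/-- Averages of `g` over the points `(1 - ε) x + ε w`, weighted by a bump function of `w`. -/
noncomputable def bumpAverage (ε : ℝ) (g : E → G) (x : E) : G :=
  ∫ w, φ.normed volume w • g ((1 - ε) • x + ε • w)

/-- The convolution kernel of `bumpAverage`. -/
noncomputable def averageKernel (ε : ℝ) (s : E) : ℝ :=
  |(ε ^ Module.finrank ℝ E)⁻¹| * φ.normed volume (-(ε⁻¹ • s))

variable {φ} {ε : ℝ}

theorem contDiff_averageKernel : ContDiff ℝ ∞ (averageKernel φ ε) :=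
  contDiff_const.mul (φ.contDiff_normed.comp ((contDiff_const_smul _).neg))

theorem averageKernel_ne_zero {s : E} (hε : 0 < ε) (h : averageKernel φ ε s ≠ 0) :
    ∃ w ∈ Metric.closedBall b φ.rOut, s = -(ε • w) := by
  refine ⟨-(ε⁻¹ • s), ?_, ?_⟩
  · have : -(ε⁻¹ • s) ∈ tsupport (φ.normed volume) :=
      subset_tsupport _ fun h' => h (by simp [averageKernel, h'])
    rwa [φ.tsupport_normed_eq] at this
  · rw [smul_neg, neg_neg, smul_smul, mul_inv_cancel₀ hε.ne', one_smul]

theorem hasCompactSupport_averageKernel (hε : 0 < ε) : HasCompactSupport (averageKernel φ ε) := by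
  refine HasCompactSupport.of_support_subset_isCompact
    (((isCompact_closedBall b φ.rOut).image (continuous_const_smul ε)).neg) fun s hs => ?_
  obtain ⟨w, hw, rfl⟩ := averageKernel_ne_zero hε hs
  exact Set.neg_mem_neg.2 ⟨w, hw, rfl⟩

/-- The substitution `t = -ε w` turns the average into a convolution evaluated at `(1 - ε) x`, from
which smoothness and the derivative are read off. -/
theorem bumpAverage_eq_convolution (hε : 0 < ε) (g : E → G) (x : E) :
    bumpAverage φ ε g x =
      convolution (averageKernel φ ε) g (ContinuousLinearMap.lsmul ℝ ℝ) volume ((1 - ε) • x) := by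
  have h := Measure.integral_comp_smul (volume : Measure E)
    (fun t => φ.normed volume (-(ε⁻¹ • t)) • g ((1 - ε) • x - t)) (-ε)
  have h2 : ∀ w : E, φ.normed volume (-(ε⁻¹ • (-ε) • w)) • g ((1 - ε) • x - (-ε) • w) =
      φ.normed volume w • g ((1 - ε) • x + ε • w) := by
    intro w
    rw [neg_smul, smul_neg, neg_neg, smul_smul, inv_mul_cancel₀ hε.ne', one_smul, sub_neg_eq_add]
  simp only [h2] at h
  rw [bumpAverage, h, convolution, ← integral_smul]
  refine integral_congr_ae (Eventually.of_forall fun t => ?_)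
  simp only [averageKernel, ContinuousLinearMap.lsmul_apply, smul_smul]
  congr 2
  simp [abs_inv, abs_pow]

theorem contDiff_bumpAverage (hε : 0 < ε) {g : E → G} (hg : LocallyIntegrable g volume) :
    ContDiff ℝ ∞ (bumpAverage φ ε g) := by
  have : bumpAverage φ ε g = fun x =>
      convolution (averageKernel φ ε) g (ContinuousLinearMap.lsmul ℝ ℝ) volume ((1 - ε) • x) :=
    funext (bumpAverage_eq_convolution hε g)
  rw [this]
  exact ((hasCompactSupport_averageKernel hε).contDiff_convolution_left _
    contDiff_averageKernel hg).comp (contDiff_const_smul _)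

theorem integrable_bumpAverage (hε : 0 < ε) {g : E → G} (hg : LocallyIntegrable g volume) (x : E) :
    Integrable fun w => φ.normed volume w • g ((1 - ε) • x + ε • w) := by
  have h1 : Integrable fun t => averageKernel φ ε t • g ((1 - ε) • x - t) :=
    (hasCompactSupport_averageKernel hε).convolutionExists_left
      (ContinuousLinearMap.lsmul ℝ ℝ) contDiff_averageKernel.continuous hg ((1 - ε) • x)
  have h2 := (h1.comp_smul (R := -ε) (by simpa using hε.ne')).smul
    (|(ε ^ Module.finrank ℝ E)⁻¹|⁻¹)
  refine h2.congr (Eventually.of_forall fun w => ?_)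
  have h3 : |(ε ^ Module.finrank ℝ E)⁻¹| ≠ 0 := by simp [hε.ne']
  simp only [Pi.smul_apply, averageKernel, smul_smul]
  rw [← mul_assoc, inv_mul_cancel₀ h3, one_mul, mul_neg, neg_smul, neg_neg,
    inv_mul_cancel₀ hε.ne', one_smul, neg_smul, sub_neg_eq_add]

theorem bumpAverage_sub (hε : 0 < ε) {g g' : E → G} (hg : LocallyIntegrable g volume)
    (hg' : LocallyIntegrable g' volume) :
    bumpAverage φ ε (g - g') = bumpAverage φ ε g - bumpAverage φ ε g' := by
  funext x
  simp only [bumpAverage, Pi.sub_apply, smul_sub]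
  exact integral_sub (integrable_bumpAverage hε hg x) (integrable_bumpAverage hε hg' x)

/-- Even for `x` on the boundary of `K`, the points `(1 - ε) x + ε w` with `w` in the interior ball
are interior to `K` by convexity. The recentred kernel is thus an admissible test function, and the
derivative falling on it can be moved to `u`. The chain rule for `x ↦ (1 - ε) x` produces the
factor. -/
theorem hasFDerivAt_bumpAverage [CompleteSpace G] {K : Set E} (hK : IsSolidConvex K)
    (hφ : Metric.closedBall b φ.rOut ⊆ interior K) {u : E → G} {v : E → E →L[ℝ] G}
    (h : HasWeakFDerivOn (interior K) u v) (hu : IntegrableOn u K) (hv : IntegrableOn v K)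
    (hε : 0 < ε) (hε1 : ε ≤ 1) {x : E} (hx : x ∈ K) :
    HasFDerivAt (bumpAverage φ ε (K.indicator u))
      ((1 - ε) • bumpAverage φ ε (K.indicator v) x) x := by
  have hm := hK.isCompact.measurableSet
  have hu' : LocallyIntegrable (K.indicator u) volume := locallyIntegrable_indicator hm hu
  have hv' : LocallyIntegrable (K.indicator v) volume := locallyIntegrable_indicator hm hv
  have hc := hasCompactSupport_averageKernel (φ := φ) hε
  have hd := hc.hasFDerivAt_convolution_left
    (ContinuousLinearMap.lsmul ℝ ℝ) (contDiff_averageKernel.of_le (by simp)) hu' ((1 - ε) • x)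
  have hz : HasFDerivAt (fun x : E => (1 - ε) • x) ((1 - ε) • ContinuousLinearMap.id ℝ E) x :=
    (hasFDerivAt_id x).const_smul _
  have hcomp := hd.comp x hz
  have heq : bumpAverage φ ε (K.indicator u) = convolution (averageKernel φ ε) (K.indicator u)
      (ContinuousLinearMap.lsmul ℝ ℝ) volume ∘ fun x : E => (1 - ε) • x :=
    funext (bumpAverage_eq_convolution hε _)
  rw [heq]
  refine hcomp.congr_fderiv ?_
  rw [ContinuousLinearMap.comp_smul, ContinuousLinearMap.comp_id]
  congr 1
  set z := (1 - ε) • x with hzdef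
  set θ : E → ℝ := fun y => averageKernel φ ε (z - y) with hθ
  have hθs : ContDiff ℝ ∞ θ := contDiff_averageKernel.comp (contDiff_const.sub contDiff_id)
  have hθsupp : Function.support θ ⊆
      (fun w => z + ε • w) '' Metric.closedBall b φ.rOut := by
    intro y hy
    obtain ⟨w, hw, hzy⟩ := averageKernel_ne_zero hε hy
    refine ⟨w, hw, ?_⟩
    simp only
    rw [← neg_eq_iff_eq_neg.2 hzy]; abel
  have hcomp : IsCompact ((fun w => z + ε • w) '' Metric.closedBall b φ.rOut) :=
    (isCompact_closedBall b φ.rOut).image (by fun_prop)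
  have hθc : HasCompactSupport θ := HasCompactSupport.of_support_subset_isCompact hcomp hθsupp
  have hθt : tsupport θ ⊆ interior K := by
    refine (closure_minimal hθsupp hcomp.isClosed).trans ?_
    rintro _ ⟨w, hw, rfl⟩
    exact hK.convex.combo_self_interior_mem_interior hx (hφ hw) (by linarith) hε (by ring)
  have hfd : ∀ y w, fderiv ℝ θ y w = -fderiv ℝ (averageKernel φ ε) (z - y) w := by
    intro y w
    have h1 : HasFDerivAt θ ((fderiv ℝ (averageKernel φ ε) (z - y)).comp
        (-ContinuousLinearMap.id ℝ E)) y :=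
      ((contDiff_averageKernel (φ := φ) (ε := ε)).differentiable
        (by simp)).differentiableAt.hasFDerivAt.comp y ((hasFDerivAt_id y).const_sub z)
    rw [h1.fderiv]; simp
  rw [bumpAverage_eq_convolution hε]
  ext w
  have hex : Integrable (fun t => ((ContinuousLinearMap.lsmul ℝ ℝ).precompL E
      (fderiv ℝ (averageKernel φ ε) t)) (K.indicator u (z - t))) :=
    (hc.fderiv ℝ).convolutionExists_left _
      (contDiff_averageKernel.continuous_fderiv (by simp)) hu' z
  have hex2 : Integrable (fun t => averageKernel φ ε t • K.indicator v (z - t)) :=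
    hc.convolutionExists_left (ContinuousLinearMap.lsmul ℝ ℝ)
      contDiff_averageKernel.continuous hv' z
  have e1 : (convolution (fderiv ℝ (averageKernel φ ε)) (K.indicator u)
      ((ContinuousLinearMap.lsmul ℝ ℝ).precompL E) volume z) w =
      ∫ y, -(fderiv ℝ θ y w • u y) := by
    rw [convolution, ContinuousLinearMap.integral_apply hex, ← integral_sub_left_eq_self _ volume z]
    refine integral_congr_ae (Eventually.of_forall fun y => ?_)
    simp only [sub_sub_cancel]
    rw [← smul_indicator_of_tsupport_subset (K := K) u (ψ := fun y => fderiv ℝ θ y w)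
      ((tsupport_fderiv_apply_subset ℝ w).trans (hθt.trans interior_subset)) y, hfd]
    simp [ContinuousLinearMap.precompL_apply]
  have e2 : (convolution (averageKernel φ ε) (K.indicator v)
      (ContinuousLinearMap.lsmul ℝ ℝ) volume z) w = ∫ y, θ y • v y w := by
    rw [convolution, ContinuousLinearMap.integral_apply (by exact hex2),
      ← integral_sub_left_eq_self _ volume z]
    refine integral_congr_ae (Eventually.of_forall fun y => ?_)
    simp only [sub_sub_cancel, ContinuousLinearMap.lsmul_apply]
    have := congrArg (fun L : E →L[ℝ] G => L w)
      (smul_indicator_of_tsupport_subset v (hθt.trans interior_subset) y)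
    simpa [hθ] using this
  rw [e1, e2, integral_neg, h.2.2 θ hθs hθc hθt w, neg_neg]

theorem bumpAverage_congr (hε : 0 < ε) {g g' : E → G} (h : g =ᵐ[volume] g') :
    bumpAverage φ ε g = bumpAverage φ ε g' := by
  funext x
  refine integral_congr_ae ?_
  have hq : Tendsto (fun w : E => ε • w + (1 - ε) • x) (ae volume) (ae volume) := by
    refine (quasiMeasurePreserving_smul_add (E := E) hε.ne' _).tendsto_ae
  filter_upwards [hq.eventually h] with w hw
  rw [add_comm, hw]

theorem lintegral_ofReal_normed : ∫⁻ w, ENNReal.ofReal (φ.normed volume w) = 1 := by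
  rw [← ofReal_integral_eq_lintegral_ofReal φ.integrable_normed
    (Eventually.of_forall φ.nonneg_normed), φ.integral_normed, ENNReal.ofReal_one]

/-- Jensen's inequality for the probability density `φ` moves the power inside the average. For
fixed `w` the map `x ↦ (1 - ε) x + ε w` is a dilation, which costs `(1 - ε)⁻ⁿ ≤ 2ⁿ`. -/
theorem eLpNorm_bumpAverage_le {r : ℝ≥0∞} (hr1 : 1 ≤ r) (hr : r ≠ ⊤) (hε : 0 < ε)
    (hε2 : ε ≤ 1 / 2) {g : E → G} (hg : AEStronglyMeasurable g volume) :
    eLpNorm (bumpAverage φ ε g) r volume ≤ 2 ^ Module.finrank ℝ E * eLpNorm g r volume := by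
  wlog hgm : StronglyMeasurable g with H
  · rw [bumpAverage_congr hε hg.ae_eq_mk, eLpNorm_congr_ae hg.ae_eq_mk]
    exact H hr1 hr hε hε2 hg.stronglyMeasurable_mk.aestronglyMeasurable hg.stronglyMeasurable_mk
  have hr0 : r ≠ 0 := (zero_lt_one.trans_le hr1).ne'
  have hrr : 1 ≤ r.toReal := by
    rw [← ENNReal.toReal_one]; exact ENNReal.toReal_mono hr hr1
  have hrpos : 0 < r.toReal := zero_lt_one.trans_le hrr
  have hφm : Measurable fun w => ENNReal.ofReal (φ.normed volume w) :=
    (φ.continuous_normed.measurable).ennreal_ofReal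
  set ν : Measure E := volume.withDensity fun w => ENNReal.ofReal (φ.normed volume w) with hν
  have : IsProbabilityMeasure ν := ⟨by
    rw [hν, withDensity_apply _ MeasurableSet.univ, Measure.restrict_univ, lintegral_ofReal_normed]⟩
  have hF : StronglyMeasurable fun q : E × E => g ((1 - ε) • q.1 + ε • q.2) :=
    hgm.comp_measurable (by fun_prop)
  have hpt : ∀ x, ‖bumpAverage φ ε g x‖ₑ ^ r.toReal ≤
      ∫⁻ w, ‖g ((1 - ε) • x + ε • w)‖ₑ ^ r.toReal ∂ν := by
    intro x
    have hgx : StronglyMeasurable fun w => g ((1 - ε) • x + ε • w) :=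
      hgm.comp_measurable (by fun_prop)
    have h1 : ‖bumpAverage φ ε g x‖ₑ ≤ eLpNorm (fun w => g ((1 - ε) • x + ε • w)) 1 ν := by
      rw [eLpNorm_one_eq_lintegral_enorm, hν, lintegral_withDensity_eq_lintegral_mul _ hφm
        hgx.enorm]
      refine (enorm_integral_le_lintegral_enorm _).trans (lintegral_mono fun w => ?_)
      rw [enorm_smul, Real.enorm_eq_ofReal (φ.nonneg_normed w)]
      exact le_rfl
    have h2 := h1.trans (eLpNorm_le_eLpNorm_of_exponent_le hr1 hgx.aestronglyMeasurable)
    refine (ENNReal.rpow_le_rpow h2 hrpos.le).trans ?_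
    rw [eLpNorm_eq_lintegral_rpow_enorm_toReal hr0 hr, ← ENNReal.rpow_mul, one_div,
      inv_mul_cancel₀ hrpos.ne', ENNReal.rpow_one]
  have hmain : ∫⁻ x, ‖bumpAverage φ ε g x‖ₑ ^ r.toReal ≤
      2 ^ Module.finrank ℝ E * ∫⁻ x, ‖g x‖ₑ ^ r.toReal := by
    refine (lintegral_mono hpt).trans ?_
    rw [lintegral_lintegral_swap (hF.enorm.pow_const _).aemeasurable]
    have h1 : ∀ w, ∫⁻ x, ‖g ((1 - ε) • x + ε • w)‖ₑ ^ r.toReal ≤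
        2 ^ Module.finrank ℝ E * ∫⁻ x, ‖g x‖ₑ ^ r.toReal := by
      intro w
      rw [lintegral_comp_smul_add (fun y => ‖g y‖ₑ ^ r.toReal) (c := 1 - ε) (by linarith) (ε • w)
        (hgm.enorm.pow_const _)]
      gcongr
      have h3 : (1 - ε)⁻¹ ≤ 2 := by
        rw [inv_le_comm₀ (by linarith) (by norm_num)]; linarith
      have h4 : (0 : ℝ) ≤ (1 - ε)⁻¹ := inv_nonneg.2 (by linarith)
      rw [← inv_pow, abs_of_nonneg (pow_nonneg h4 _), ENNReal.ofReal_pow h4]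
      gcongr
      exact (ENNReal.ofReal_le_ofReal h3).trans (by simp)
    refine (lintegral_mono h1).trans ?_
    rw [lintegral_const, measure_univ, mul_one]
  rw [eLpNorm_eq_lintegral_rpow_enorm_toReal hr0 hr, eLpNorm_eq_lintegral_rpow_enorm_toReal hr0 hr]
  refine (ENNReal.rpow_le_rpow hmain (by positivity)).trans ?_
  rw [ENNReal.mul_rpow_of_nonneg _ _ (by positivity)]
  gcongr
  have h5 : (1 : ℝ≥0∞) ≤ 2 ^ Module.finrank ℝ E := one_le_pow₀ (by norm_num)
  calc (2 ^ Module.finrank ℝ E : ℝ≥0∞) ^ (1 / r.toReal)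
      ≤ (2 ^ Module.finrank ℝ E : ℝ≥0∞) ^ (1 : ℝ) :=
        ENNReal.rpow_le_rpow_of_exponent_le h5 (by rw [div_le_one hrpos]; exact hrr)
    _ = _ := ENNReal.rpow_one _

theorem norm_bumpAverage_sub_le [CompleteSpace G] (hε : 0 < ε) {g : E → G}
    (hg : LocallyIntegrable g volume) {x : E} {δ : ℝ}
    (h : ∀ w ∈ Metric.closedBall b φ.rOut, ‖g ((1 - ε) • x + ε • w) - g x‖ ≤ δ) :
    ‖bumpAverage φ ε g x - g x‖ ≤ δ := by
  have h1 : bumpAverage φ ε g x - g x =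
      ∫ w, φ.normed volume w • (g ((1 - ε) • x + ε • w) - g x) := by
    simp only [smul_sub]
    rw [integral_sub (integrable_bumpAverage hε hg x) (φ.integrable_normed.smul_const _),
      integral_smul_const, φ.integral_normed, one_smul, bumpAverage]
  rw [h1]
  calc ‖∫ w, φ.normed volume w • (g ((1 - ε) • x + ε • w) - g x)‖
      ≤ ∫ w, φ.normed volume w * δ := by
        refine norm_integral_le_of_norm_le (φ.integrable_normed.mul_const _)
          (Eventually.of_forall fun w => ?_)
        rw [norm_smul, Real.norm_of_nonneg (φ.nonneg_normed w)]
        by_cases hw : w ∈ Metric.closedBall b φ.rOut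
        · exact mul_le_mul_of_nonneg_left (h w hw) (φ.nonneg_normed w)
        · have : φ.normed volume w = 0 := by
            rw [← φ.tsupport_normed_eq (μ := volume)] at hw
            exact image_eq_zero_of_notMem_tsupport hw
          simp [this]
    _ = δ := by rw [integral_mul_const, φ.integral_normed, one_mul]

/-- The parameters `1 / (k + 2)` of the averages used for approximation. -/
noncomputable def averageScale (k : ℕ) : ℝ := 1 / ((k : ℝ) + 2)

theorem averageScale_pos (k : ℕ) : 0 < averageScale k := by unfold averageScale; positivity

theorem averageScale_le (k : ℕ) : averageScale k ≤ 1 / 2 := by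
  unfold averageScale
  exact one_div_le_one_div_of_le (by norm_num) (by linarith [(Nat.cast_nonneg k : (0 : ℝ) ≤ k)])

theorem tendsto_averageScale : Tendsto averageScale atTop (𝓝 0) := by
  unfold averageScale
  refine tendsto_const_nhds.div_atTop ?_
  exact tendsto_atTop_add_const_right _ _ tendsto_natCast_atTop_atTop

/-- Approximation of `g` by a continuous, compactly supported `f`: the average of `g - f` is small
by the uniform bound, and the average of `f` is uniformly close to `f` on `K`, because each point is
moved by at most `ε · 2R`. -/
theorem tendsto_eLpNorm_bumpAverage_sub [CompleteSpace G] {r : ℝ≥0∞} (hr1 : 1 ≤ r) (hr : r ≠ ⊤)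
    {K : Set E} (hK : IsCompact K) {g : E → G} (hg : MemLp g r volume) :
    Tendsto (fun k => eLpNorm (bumpAverage φ (averageScale k) g - g) r (volume.restrict K))
      atTop (𝓝 0) := by
  -- The three summands are the constants of the three error terms: the average of `g - f`, the
  -- displacement of `f`, and `g - f` itself.
  set A : ℝ≥0∞ := 2 ^ Module.finrank ℝ E + volume.restrict K univ ^ r.toReal⁻¹ + 1 with hA
  have hAtop : A ≠ ⊤ := by
    refine ENNReal.add_ne_top.2 ⟨ENNReal.add_ne_top.2 ⟨by simp, ?_⟩, by simp⟩
    refine ENNReal.rpow_ne_top_of_nonneg (by positivity) ?_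
    simpa using hK.measure_lt_top.ne
  have hA0 : A ≠ 0 := by simp [hA]
  rw [ENNReal.tendsto_nhds_zero]
  intro η hη
  by_cases hηtop : η = ⊤
  · simp [hηtop]
  set δ : ℝ≥0∞ := η / A with hδ
  have hδ0 : δ ≠ 0 := (ENNReal.div_pos hη.ne' hAtop).ne'
  have hδtop : δ ≠ ⊤ := ENNReal.div_ne_top hηtop hA0
  obtain ⟨f, hfc, hgf, hf, hfm⟩ := hg.exists_hasCompactSupport_eLpNorm_sub_le hr hδ0
  have hδpos : 0 < δ.toReal := ENNReal.toReal_pos hδ0 hδtop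
  obtain ⟨ρ, hρ, huc⟩ := Metric.uniformContinuous_iff.1
    (hfc.uniformContinuous_of_continuous hf) δ.toReal hδpos
  obtain ⟨R, hR⟩ := (hK.isBounded.union (Metric.isBounded_closedBall (x := b) (r := φ.rOut))).exists_norm_le
  have hsmall : ∀ᶠ k in atTop, averageScale k * (2 * R) < ρ := by
    have : Tendsto (fun k => averageScale k * (2 * R)) atTop (𝓝 (0 * (2 * R))) :=
      tendsto_averageScale.mul_const _
    rw [zero_mul] at this
    exact this.eventually_lt_const hρ
  filter_upwards [hsmall] with k hk
  have hε := averageScale_pos k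
  have hgl := hg.locallyIntegrable hr1
  have hfl := hfm.locallyIntegrable hr1
  have hdec : bumpAverage φ (averageScale k) g - g = bumpAverage φ (averageScale k) (g - f) +
      (bumpAverage φ (averageScale k) f - f) - (g - f) := by
    rw [bumpAverage_sub hε hgl hfl]; abel
  have hm1 : AEStronglyMeasurable (bumpAverage φ (averageScale k) (g - f)) (volume.restrict K) :=
    (contDiff_bumpAverage hε (hgl.sub hfl)).continuous.aestronglyMeasurable
  have hm2 : AEStronglyMeasurable (bumpAverage φ (averageScale k) f - f) (volume.restrict K) :=
    ((contDiff_bumpAverage hε hfl).continuous.sub hf).aestronglyMeasurable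
  have hm3 : AEStronglyMeasurable (g - f) (volume.restrict K) := (hg.1.sub hfm.1).restrict
  have b1 : eLpNorm (bumpAverage φ (averageScale k) (g - f)) r (volume.restrict K) ≤
      2 ^ Module.finrank ℝ E * δ :=
    (eLpNorm_mono_measure _ Measure.restrict_le_self).trans
      ((eLpNorm_bumpAverage_le hr1 hr hε (averageScale_le k) (hg.1.sub hfm.1)).trans (by gcongr))
  have b2 : eLpNorm (bumpAverage φ (averageScale k) f - f) r (volume.restrict K) ≤
      volume.restrict K univ ^ r.toReal⁻¹ * δ := by
    have := eLpNorm_le_of_ae_bound (p := r) (μ := volume.restrict K)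
      (f := bumpAverage φ (averageScale k) f - f) (C := δ.toReal) ?_
    · rwa [ENNReal.ofReal_toReal hδtop] at this
    · refine (ae_restrict_iff' hK.measurableSet).2 (Eventually.of_forall fun x hx => ?_)
      refine norm_bumpAverage_sub_le hε hfl fun w hw => ?_
      rw [← dist_eq_norm]
      refine (huc ?_).le
      have : (1 - averageScale k) • x + averageScale k • w - x = averageScale k • (w - x) := by
        module
      rw [dist_eq_norm, this, norm_smul, Real.norm_of_nonneg hε.le]
      refine lt_of_le_of_lt (mul_le_mul_of_nonneg_left ?_ hε.le) hk
      refine (norm_sub_le _ _).trans ?_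
      linarith [hR x (Or.inl hx), hR w (Or.inr hw)]
  have b3 : eLpNorm (g - f) r (volume.restrict K) ≤ δ :=
    (eLpNorm_mono_measure _ Measure.restrict_le_self).trans hgf
  rw [hdec]
  calc _ ≤ eLpNorm (bumpAverage φ (averageScale k) (g - f)) r (volume.restrict K) +
        eLpNorm (bumpAverage φ (averageScale k) f - f) r (volume.restrict K) +
        eLpNorm (g - f) r (volume.restrict K) :=
        (eLpNorm_sub_le (hm1.add hm2) hm3 hr1).trans (by
          gcongr; exact eLpNorm_add_le hm1 hm2 hr1)
    _ ≤ 2 ^ Module.finrank ℝ E * δ + volume.restrict K univ ^ r.toReal⁻¹ * δ + 1 * δ := by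
        rw [one_mul]; gcongr
    _ = A * δ := by rw [hA]; ring
    _ = η := ENNReal.mul_div_cancel hA0 hAtop

section Body

variable (φ) in
/-- Smooth approximations on a convex body `K ∋ b` of a function on `K`. -/
noncomputable def bodyAverage (K : Set E) (k : ℕ) (u : E → G) : E → G :=
  bumpAverage φ (averageScale k) (K.indicator u)

variable {K : Set E} {r : ℝ≥0∞} {u : E → G} {v : E → E →L[ℝ] G}

theorem IsSolidConvex.exists_bump (hK : IsSolidConvex K) :
    ∃ (b : E) (φ : ContDiffBump b), Metric.closedBall b φ.rOut ⊆ interior K := by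
  obtain ⟨b, hb⟩ := hK.interior_nonempty
  obtain ⟨ε, hε, h⟩ := Metric.nhds_basis_closedBall.mem_iff.1 (isOpen_interior.mem_nhds hb)
  exact ⟨b, ⟨ε / 2, ε, half_pos hε, half_lt_self hε⟩, h⟩

theorem IsSolidConvex.isFiniteMeasure (hK : IsSolidConvex K) :
    IsFiniteMeasure (volume.restrict K) :=
  ⟨by simpa using hK.isCompact.measure_lt_top⟩

theorem IsSolidConvex.integrableOn (hK : IsSolidConvex K) (hr1 : 1 ≤ r)
    (hu : MemLp u r (volume.restrict K)) : IntegrableOn u K :=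
  haveI := hK.isFiniteMeasure
  hu.integrable hr1

theorem contDiff_bodyAverage (hK : MeasurableSet K) (hu : IntegrableOn u K) (k : ℕ) :
    ContDiff ℝ ∞ (bodyAverage φ K k u) :=
  contDiff_bumpAverage (averageScale_pos k) (locallyIntegrable_indicator hK hu)

theorem tendsto_bodyAverage [CompleteSpace G] (hK : IsSolidConvex K) (hr1 : 1 ≤ r) (hr : r ≠ ⊤)
    (hu : MemLp u r (volume.restrict K)) :
    Tendsto (fun k => eLpNorm (bodyAverage φ K k u - u) r (volume.restrict K)) atTop (𝓝 0) := by
  have h := tendsto_eLpNorm_bumpAverage_sub (φ := φ) hr1 hr hK.isCompact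
    (memLp_indicator_of_restrict hK.isCompact.measurableSet hu)
  refine h.congr fun k => eLpNorm_congr_ae ?_
  filter_upwards [ae_restrict_mem hK.isCompact.measurableSet] with x hx
  simp [bodyAverage, hx]

theorem hasFDerivAt_bodyAverage [CompleteSpace G] (hK : IsSolidConvex K)
    (hφ : Metric.closedBall b φ.rOut ⊆ interior K) (h : HasWeakFDerivOn (interior K) u v)
    (hu : IntegrableOn u K) (hv : IntegrableOn v K) (k : ℕ) {x : E} (hx : x ∈ K) :
    HasFDerivAt (bodyAverage φ K k u) ((1 - averageScale k) • bodyAverage φ K k v x) x :=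
  hasFDerivAt_bumpAverage hK hφ h hu hv (averageScale_pos k)
    ((averageScale_le k).trans (by norm_num)) hx

/-- On all of `K` the gradient of the average is `1 - ε` times the average of `v`, so the
convergence reaches the boundary. -/
theorem tendsto_fderiv_bodyAverage [CompleteSpace G] (hK : IsSolidConvex K)
    (hφ : Metric.closedBall b φ.rOut ⊆ interior K) (h : HasWeakFDerivOn (interior K) u v)
    (hr1 : 1 ≤ r) (hr : r ≠ ⊤)
    (hu : IntegrableOn u K) (hv : MemLp v r (volume.restrict K)) :
    Tendsto (fun k => eLpNorm (fderiv ℝ (bodyAverage φ K k u) - v) r (volume.restrict K))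
      atTop (𝓝 0) := by
  have hv1 := hK.integrableOn hr1 hv
  have hm := hK.isCompact.measurableSet
  have hvi : MemLp (K.indicator v) r volume := memLp_indicator_of_restrict hm hv
  have hle : ∀ k, eLpNorm (fderiv ℝ (bodyAverage φ K k u) - v) r (volume.restrict K) ≤
      eLpNorm (bodyAverage φ K k v - v) r (volume.restrict K) +
        ENNReal.ofReal (averageScale k) *
          (2 ^ Module.finrank ℝ E * eLpNorm (K.indicator v) r volume) := by
    intro k
    have hc := (contDiff_bodyAverage (φ := φ) hm hv1 k).continuous
    have h1 : eLpNorm (fderiv ℝ (bodyAverage φ K k u) - v) r (volume.restrict K) =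
        eLpNorm (fun x => (1 - averageScale k) • bodyAverage φ K k v x - v x) r
          (volume.restrict K) := by
      refine eLpNorm_congr_ae ?_
      filter_upwards [ae_restrict_mem hm] with x hx
      rw [Pi.sub_apply, (hasFDerivAt_bodyAverage hK hφ h hu hv1 k hx).fderiv]
    rw [h1]
    refine (eLpNorm_smul_sub_le hr1 hc.aestronglyMeasurable hv.1 (averageScale_pos k).le).trans ?_
    gcongr
    exact (eLpNorm_mono_measure _ Measure.restrict_le_self).trans
      (eLpNorm_bumpAverage_le hr1 hr (averageScale_pos k) (averageScale_le k) hvi.1)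
  refine tendsto_of_tendsto_of_tendsto_of_le_of_le tendsto_const_nhds ?_ (fun _ => zero_le) hle
  have hfin : (2 ^ Module.finrank ℝ E * eLpNorm (K.indicator v) r volume) ≠ ⊤ :=
    ENNReal.mul_ne_top (by simp) hvi.2.ne
  have h2 : Tendsto (fun k => ENNReal.ofReal (averageScale k) *
      (2 ^ Module.finrank ℝ E * eLpNorm (K.indicator v) r volume)) atTop (𝓝 0) := by
    have := ENNReal.Tendsto.mul_const (ENNReal.tendsto_ofReal tendsto_averageScale)
      (Or.inr hfin)
    simpa using this
  simpa using (tendsto_bodyAverage (φ := φ) hK hr1 hr hv).add h2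

end Body

end Averaging

/-! ### Multiplication of `W^{1,r}` and `L^p` functions, and the embedding into `L^∞`. -/

section Multiplication

open scoped NNReal

theorem lintegral_rpow_le_mul_measure_univ {α : Type*} [MeasurableSpace α] {μ : Measure α}
    {f : α → ℝ≥0∞} (hf : Measurable f) {r p : ℝ} (hr : 0 < r) (hrp : r ≤ p) :
    ∫⁻ x, f x ^ r ∂μ ≤ (∫⁻ x, f x ^ p ∂μ) ^ (r / p) * μ univ ^ (1 - r / p) := by
  have hp := hr.trans_le hrp
  have h := eLpNorm'_le_eLpNorm'_mul_rpow_measure_univ hr hrp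
    (hf.aestronglyMeasurable (μ := μ))
  simp only [eLpNorm'_eq_lintegral_enorm, enorm_eq_self] at h
  have h2 := ENNReal.rpow_le_rpow h hr.le
  rw [ENNReal.mul_rpow_of_nonneg _ _ hr.le, ← ENNReal.rpow_mul, ← ENNReal.rpow_mul,
    ← ENNReal.rpow_mul, one_div_mul_cancel hr.ne', ENNReal.rpow_one] at h2
  convert h2 using 3 <;> field_simp

theorem rpow_lintegral_le_mul {α : Type*} [MeasurableSpace α] {μ : Measure α}
    {f : α → ℝ≥0∞} (hf : Measurable f) {r : ℝ} (hr : 1 ≤ r) :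
    (∫⁻ x, f x ∂μ) ^ r ≤ μ univ ^ (r - 1) * ∫⁻ x, f x ^ r ∂μ := by
  have h0 : 0 < r := zero_lt_one.trans_le hr
  have h := lintegral_rpow_le_mul_measure_univ (μ := μ) hf zero_lt_one hr
  simp only [ENNReal.rpow_one] at h
  have h2 := ENNReal.rpow_le_rpow h h0.le
  rw [ENNReal.mul_rpow_of_nonneg _ _ h0.le, ← ENNReal.rpow_mul, ← ENNReal.rpow_mul,
    one_div_mul_cancel h0.ne', ENNReal.rpow_one, mul_comm] at h2
  convert h2 using 3
  field_simp

theorem lintegral_rpow_neg_lt_top {a : ℝ} (ha : a < 1) :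
    ∫⁻ t in Ioc (0 : ℝ) 1, ENNReal.ofReal (t ^ (-a)) < ⊤ := by
  have h : IntervalIntegrable (fun t : ℝ => t ^ (-a)) volume 0 1 :=
    intervalIntegral.intervalIntegrable_rpow' (by linarith)
  rw [intervalIntegrable_iff_integrableOn_Ioc_of_le zero_le_one] at h
  refine lt_of_le_of_lt (lintegral_mono fun t => ?_) h.2
  exact ENNReal.ofReal_le_of_le_toReal (by simpa using le_abs_self _)

/-- Jensen's inequality for the measure `t ^ (-a) dt`, after writing `W = t ^ (-a) · (t ^ a W)`. It
is applied with `a = n / p < 1`, where this measure is finite. -/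
theorem rpow_lintegral_Ioc_le {a r : ℝ} (hr : 1 ≤ r) {W : ℝ → ℝ≥0∞} (hW : Measurable W) :
    (∫⁻ t in Ioc (0 : ℝ) 1, W t) ^ r ≤
      (∫⁻ t in Ioc (0 : ℝ) 1, ENNReal.ofReal (t ^ (-a))) ^ (r - 1) *
        ∫⁻ t in Ioc (0 : ℝ) 1, ENNReal.ofReal (t ^ (a * (r - 1))) * W t ^ r := by
  have hm : Measurable fun t : ℝ => ENNReal.ofReal (t ^ (-a)) := by fun_prop
  have hm' : Measurable fun t : ℝ => ENNReal.ofReal (t ^ a) * W t := by fun_prop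
  set ν := (volume.restrict (Ioc (0 : ℝ) 1)).withDensity fun t => ENNReal.ofReal (t ^ (-a)) with hν
  have h := rpow_lintegral_le_mul (μ := ν) hm' hr
  rw [hν, lintegral_withDensity_eq_lintegral_mul _ hm hm',
    lintegral_withDensity_eq_lintegral_mul _ hm (hm'.pow_const r),
    withDensity_apply _ MeasurableSet.univ, Measure.restrict_univ] at h
  have hpos : ∀ t ∈ Ioc (0 : ℝ) 1, (0 : ℝ) < t := fun t ht => ht.1
  refine le_trans (le_of_eq ?_) (h.trans (le_of_eq ?_))
  · congr 1
    refine setLIntegral_congr_fun measurableSet_Ioc fun t ht => ?_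
    simp only [Pi.mul_apply]
    rw [← mul_assoc, ← ENNReal.ofReal_mul (Real.rpow_nonneg ht.1.le _), ← Real.rpow_add ht.1]
    simp
  · congr 1
    refine setLIntegral_congr_fun measurableSet_Ioc fun t ht => ?_
    simp only [Pi.mul_apply]
    rw [ENNReal.mul_rpow_of_nonneg _ _ (by linarith), ← mul_assoc,
      ENNReal.ofReal_rpow_of_nonneg (Real.rpow_nonneg ht.1.le _) (by linarith),
      ← ENNReal.ofReal_mul (Real.rpow_nonneg ht.1.le _), ← Real.rpow_mul ht.1.le,
      ← Real.rpow_add ht.1]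
    ring_nf

variable {E : Type*} [NormedAddCommGroup E] [InnerProductSpace ℝ E]
    [FiniteDimensional ℝ E] [MeasurableSpace E] [BorelSpace E]
    {G : Type*} [NormedAddCommGroup G] [NormedSpace ℝ G] {K : Set E}

/-- The fundamental theorem of calculus along the segment from `x` to `z`. -/
theorem enorm_le_add_lintegral_segment [CompleteSpace G] {u : E → G} (hu : ContDiff ℝ 1 u) {R : ℝ}
    {x z : E} (hR : ‖z - x‖ ≤ R) :
    ‖u x‖ₑ ≤ ‖u z‖ₑ +
      ENNReal.ofReal R * ∫⁻ t in Ioc (0 : ℝ) 1, ‖fderiv ℝ u ((1 - t) • x + t • z)‖ₑ := by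
  have hl : ∀ t : ℝ, HasDerivAt (fun t : ℝ => (1 - t) • x + t • z) (z - x) t := by
    intro t
    have h := ((((hasDerivAt_id t).const_sub 1).smul_const x)).add ((hasDerivAt_id t).smul_const z)
    refine h.congr_deriv ?_
    module
  have hd : ∀ t : ℝ, HasDerivAt (fun t : ℝ => u ((1 - t) • x + t • z))
      (fderiv ℝ u ((1 - t) • x + t • z) (z - x)) t := fun t =>
    (hu.differentiable one_ne_zero).differentiableAt.hasFDerivAt.comp_hasDerivAt t (hl t)
  have hc : Continuous fun t : ℝ => fderiv ℝ u ((1 - t) • x + t • z) (z - x) :=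
    ((hu.continuous_fderiv one_ne_zero).comp (by fun_prop)).clm_apply continuous_const
  have hint := intervalIntegral.integral_eq_sub_of_hasDerivAt (a := 0) (b := 1)
    (fun t _ => hd t) (hc.intervalIntegrable 0 1)
  simp only [sub_self, zero_smul, one_smul, zero_add, sub_zero, add_zero] at hint
  rw [intervalIntegral.integral_of_le zero_le_one] at hint
  have h1 : u x = u z - ∫ t in Ioc (0 : ℝ) 1, fderiv ℝ u ((1 - t) • x + t • z) (z - x) := by
    rw [hint]; abel
  rw [h1]
  refine (enorm_sub_le).trans ?_
  gcongr
  refine (enorm_integral_le_lintegral_enorm _).trans ?_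
  rw [← lintegral_const_mul' _ _ ENNReal.ofReal_ne_top]
  refine lintegral_mono fun t => ?_
  refine (ContinuousLinearMap.le_opENorm _ _).trans ?_
  rw [mul_comm]
  gcongr
  rw [← ofReal_norm]
  exact ENNReal.ofReal_le_ofReal hR

/-- For fixed `x`, the substitution `y = (1 - t) x + t z` costs `t⁻ⁿ` and confines `y` to distance
`tR` from `x`. After exchanging the integrals, `h ^ r` is integrated over a ball of radius `tR`
around `y`, where Hölder's inequality gains `t ^ (n (1 - r / p))`. The exponents add up to `-n r /
p`. -/
theorem lintegral_segment_le {R t r p : ℝ} (hR : ∀ x ∈ K, ∀ z ∈ K, ‖z - x‖ ≤ R)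
    (hR0 : 0 ≤ R) (hK : MeasurableSet K) (hc : Convex ℝ K) (ht : t ∈ Ioc (0 : ℝ) 1) (hr : 1 ≤ r)
    (hrp : r ≤ p) {h g : E → ℝ≥0∞} (hh : Measurable h) (hg : Measurable g) :
    ∫⁻ x in K, h x ^ r * ∫⁻ z in K, g ((1 - t) • x + t • z) ≤
      ENNReal.ofReal (t ^ (-(Module.finrank ℝ E / p * r))) *
        ((ENNReal.ofReal (R ^ Module.finrank ℝ E) * volume (Metric.ball (0 : E) 1)) ^ (1 - r / p) *
          ((∫⁻ x in K, h x ^ p) ^ (r / p) * ∫⁻ y in K, g y)) := by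
  set n := Module.finrank ℝ E with hn
  have ht0 : 0 < t := ht.1
  have hr0 : 0 < r := zero_lt_one.trans_le hr
  have hp0 : 0 < p := hr0.trans_le hrp
  set B : Set (E × E) := {q | ‖q.2 - q.1‖ ≤ t * R} with hB
  have hBm : MeasurableSet B :=
    (isClosed_le (by fun_prop) (by fun_prop)).measurableSet
  have hBx : ∀ x, MeasurableSet {y : E | (x, y) ∈ B} := fun x => measurable_prodMk_left hBm
  have hBy : ∀ y, MeasurableSet {x : E | (x, y) ∈ B} := fun y => measurable_prodMk_right hBm
  have h1 : ∀ x ∈ K, ∫⁻ z in K, g ((1 - t) • x + t • z) ≤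
      ENNReal.ofReal (t ^ (-(n : ℝ))) * ∫⁻ y in K, {y | (x, y) ∈ B}.indicator g y := by
    intro x hx
    set f : E → ℝ≥0∞ := K.indicator ({y | (x, y) ∈ B}.indicator g) with hf
    have hfm : Measurable f := (hg.indicator (hBx x)).indicator hK
    have h2 : ∫⁻ z in K, g ((1 - t) • x + t • z) ≤ ∫⁻ z, f (t • z + (1 - t) • x) := by
      rw [← lintegral_indicator hK]
      refine lintegral_mono fun z => ?_
      by_cases hz : z ∈ K
      · have m1 : t • z + (1 - t) • x ∈ K :=
          hc hz hx ht0.le (by linarith [ht.2]) (by ring)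
        have m2 : (x, t • z + (1 - t) • x) ∈ B := by
          have : t • z + (1 - t) • x - x = t • (z - x) := by module
          simp only [hB, mem_ofPred_eq, this, norm_smul, Real.norm_of_nonneg ht0.le]
          exact mul_le_mul_of_nonneg_left (hR x hx z hz) ht0.le
        have m3 : t • z + (1 - t) • x ∈ {y | (x, y) ∈ B} := m2
        rw [indicator_of_mem hz, hf, indicator_of_mem m1, indicator_of_mem m3, add_comm]
      · rw [indicator_of_notMem hz]; exact zero_le
    refine h2.trans (le_of_eq ?_)
    rw [lintegral_comp_smul_add f ht0.ne' _ hfm, hf, lintegral_indicator hK]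
    congr 2
    rw [abs_of_nonneg (by positivity), Real.rpow_neg ht0.le, Real.rpow_natCast]
  have hmeas : Measurable fun q : E × E => h q.1 ^ r * B.indicator (fun q => g q.2) q :=
    ((hh.comp measurable_fst).pow_const r).mul ((hg.comp measurable_snd).indicator hBm)
  have hind : ∀ x y, {y | (x, y) ∈ B}.indicator g y = B.indicator (fun q => g q.2) (x, y) :=
    fun x y => by simp [indicator]
  have hball : ∀ y, ∫⁻ x in K, {x | (x, y) ∈ B}.indicator (fun x => h x ^ r) x ≤
      (∫⁻ x in K, h x ^ p) ^ (r / p) *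
        (ENNReal.ofReal ((t * R) ^ n) * volume (Metric.ball (0 : E) 1)) ^ (1 - r / p) := by
    intro y
    rw [lintegral_indicator (hBy y)]
    refine (lintegral_rpow_le_mul_measure_univ hh hr0 hrp).trans ?_
    have hle : r / p ≤ 1 := (div_le_one hp0).2 hrp
    refine mul_le_mul' (ENNReal.rpow_le_rpow (lintegral_mono' Measure.restrict_le_self le_rfl)
      (by positivity)) (ENNReal.rpow_le_rpow ?_ (by linarith))
    · rw [Measure.restrict_apply_univ]
      refine (Measure.restrict_le_self _).trans ?_
      have : {x | (x, y) ∈ B} = Metric.closedBall y (t * R) := by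
        ext x; simp [hB, dist_eq_norm, norm_sub_rev]
      rw [this, Measure.addHaar_closedBall _ _ (mul_nonneg ht0.le hR0)]
  calc ∫⁻ x in K, h x ^ r * ∫⁻ z in K, g ((1 - t) • x + t • z)
      ≤ ∫⁻ x in K, h x ^ r *
          (ENNReal.ofReal (t ^ (-(n : ℝ))) * ∫⁻ y in K, {y | (x, y) ∈ B}.indicator g y) := by
        refine setLIntegral_mono' hK fun x hx => ?_
        gcongr
        exact h1 x hx
    _ = ENNReal.ofReal (t ^ (-(n : ℝ))) *
          ∫⁻ x in K, ∫⁻ y in K, h x ^ r * B.indicator (fun q => g q.2) (x, y) := by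
        rw [← lintegral_const_mul' _ _ ENNReal.ofReal_ne_top]
        refine lintegral_congr fun x => ?_
        rw [lintegral_const_mul _ (by
          simpa only [← hind] using hg.indicator (hBx x))]
        simp only [hind]
        ring
    _ = ENNReal.ofReal (t ^ (-(n : ℝ))) *
          ∫⁻ y in K, ∫⁻ x in K, h x ^ r * B.indicator (fun q => g q.2) (x, y) := by
        rw [lintegral_lintegral_swap hmeas.aemeasurable]
    _ = ENNReal.ofReal (t ^ (-(n : ℝ))) *
          ∫⁻ y in K, g y * ∫⁻ x in K, {x | (x, y) ∈ B}.indicator (fun x => h x ^ r) x := by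
        congr 1
        refine lintegral_congr fun y => ?_
        rw [← lintegral_const_mul _ ((hh.pow_const r).indicator (hBy y))]
        refine lintegral_congr fun x => ?_
        by_cases hxy : (x, y) ∈ B
        · simp [hxy, mul_comm]
        · simp [hxy]
    _ ≤ ENNReal.ofReal (t ^ (-(n : ℝ))) *
          ∫⁻ y in K, g y * ((∫⁻ x in K, h x ^ p) ^ (r / p) *
        (ENNReal.ofReal ((t * R) ^ n) * volume (Metric.ball (0 : E) 1)) ^ (1 - r / p)) := by
        gcongr with y
        exact hball y
    _ = _ := by
        rw [lintegral_mul_const _ hg]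
        have e1 : (ENNReal.ofReal ((t * R) ^ n) * volume (Metric.ball (0 : E) 1)) ^ (1 - r / p) =
            ENNReal.ofReal (t ^ (n * (1 - r / p))) *
              (ENNReal.ofReal (R ^ n) * volume (Metric.ball (0 : E) 1)) ^ (1 - r / p) := by
          have hle : 0 ≤ 1 - r / p := by
            rw [sub_nonneg]; exact (div_le_one hp0).2 hrp
          rw [mul_pow, ENNReal.ofReal_mul (by positivity), mul_assoc,
            ENNReal.mul_rpow_of_nonneg _ _ hle, ENNReal.ofReal_rpow_of_nonneg (by positivity) hle,
            ← Real.rpow_natCast, ← Real.rpow_mul ht0.le]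
        have e2 : ENNReal.ofReal (t ^ (-(n / p * r))) =
            ENNReal.ofReal (t ^ (-(n : ℝ))) * ENNReal.ofReal (t ^ (n * (1 - r / p))) := by
          rw [← ENNReal.ofReal_mul (by positivity), ← Real.rpow_add ht0]
          congr 2
          field_simp
          ring
        rw [e1, e2]
        ring

theorem IsSolidConvex.exists_norm_sub_le (hK : IsSolidConvex K) :
    ∃ R, 0 ≤ R ∧ ∀ x ∈ K, ∀ z ∈ K, ‖z - x‖ ≤ R :=
  ⟨Metric.diam K, Metric.diam_nonneg, fun x hx z hz => by
    rw [← dist_eq_norm]; exact Metric.dist_le_diam_of_mem hK.isCompact.isBounded hz hx⟩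

theorem IsSolidConvex.measure_pos (hK : IsSolidConvex K) : 0 < volume K :=
  Measure.measure_pos_of_nonempty_interior _ hK.interior_nonempty

/-- The segment estimate is raised to the power `r`, multiplied by `h(x) ^ r` and integrated over
both end points. The weighted Jensen inequality contributes `t ^ (a (r - 1))` and
`lintegral_segment_le` contributes `t ^ (-a r)`, with `a = n / p`; the product `t ^ (-a)` is
integrable on `(0, 1]` precisely because `n < p`. -/
theorem IsSolidConvex.exists_lintegral_mul_le [CompleteSpace G] (hK : IsSolidConvex K) {r p : ℝ}
    (hr : 1 ≤ r) (hrp : r ≤ p) (hn : Module.finrank ℝ E < p) :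
    ∃ C : ℝ≥0∞, C ≠ ⊤ ∧ ∀ (u : E → G) (h : E → ℝ≥0∞), ContDiff ℝ 1 u → Measurable h →
      ∫⁻ x in K, (‖u x‖ₑ * h x) ^ r ≤ C * ((∫⁻ x in K, h x ^ p) ^ (r / p) *
        ((∫⁻ x in K, ‖u x‖ₑ ^ r) + ∫⁻ x in K, ‖fderiv ℝ u x‖ₑ ^ r)) := by
  obtain ⟨R, hR0, hR⟩ := hK.exists_norm_sub_le
  have hm := hK.isCompact.measurableSet
  have hr0 : 0 < r := zero_lt_one.trans_le hr
  have hp0 : 0 < p := hr0.trans_le hrp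
  set a : ℝ := Module.finrank ℝ E / p with ha
  have ha1 : a < 1 := (div_lt_one hp0).2 hn
  set Ca := ∫⁻ t in Ioc (0 : ℝ) 1, ENNReal.ofReal (t ^ (-a)) with hCa
  have hCatop : Ca ≠ ⊤ := (lintegral_rpow_neg_lt_top ha1).ne
  set B := (ENNReal.ofReal (R ^ Module.finrank ℝ E) * volume (Metric.ball (0 : E) 1)) ^ (1 - r / p)
    with hB
  have hle : 0 ≤ 1 - r / p := by
    rw [sub_nonneg]; exact (div_le_one hp0).2 hrp
  have hBtop : B ≠ ⊤ := ENNReal.rpow_ne_top_of_nonneg hle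
    (ENNReal.mul_ne_top ENNReal.ofReal_ne_top Metric.isBounded_ball.measure_lt_top.ne)
  have hV0 : volume K ≠ 0 := hK.measure_pos.ne'
  have hVtop : volume K ≠ ⊤ := hK.isCompact.measure_lt_top.ne
  set D := ENNReal.ofReal R ^ r * Ca ^ (r - 1) with hD
  have hDtop : D ≠ ⊤ := ENNReal.mul_ne_top (ENNReal.rpow_ne_top_of_nonneg hr0.le
    ENNReal.ofReal_ne_top) (ENNReal.rpow_ne_top_of_nonneg (by linarith) hCatop)
  have h2top : (2 : ℝ≥0∞) ^ (r - 1) ≠ ⊤ := ENNReal.rpow_ne_top_of_nonneg (by linarith) (by simp)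
  -- `(volume K)⁻¹` undoes the integration over the free end point, `2 ^ (r - 1)` comes from the
  -- power of a sum, and the two summands belong to the end point value and to the integral along
  -- the segment.
  refine ⟨(volume K)⁻¹ * (2 ^ (r - 1) * (volume K ^ (1 - r / p) + D * (Ca * B))), ?_, ?_⟩
  · exact ENNReal.mul_ne_top (ENNReal.inv_ne_top.2 hV0) (ENNReal.mul_ne_top h2top
      (ENNReal.add_ne_top.2 ⟨ENNReal.rpow_ne_top_of_nonneg hle hVtop,
        ENNReal.mul_ne_top hDtop (ENNReal.mul_ne_top hCatop hBtop)⟩))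
  intro u h hu hh
  have hdu : Continuous (fderiv ℝ u) := hu.continuous_fderiv one_ne_zero
  set g : E → ℝ≥0∞ := fun x => ‖fderiv ℝ u x‖ₑ ^ r with hg
  have hgm : Measurable g := hdu.enorm.measurable.pow_const r
  have hum : Measurable fun x => ‖u x‖ₑ ^ r := hu.continuous.enorm.measurable.pow_const r
  set Hp := (∫⁻ x in K, h x ^ p) ^ (r / p) with hHp
  have hhr : ∫⁻ x in K, h x ^ r ≤ Hp * volume K ^ (1 - r / p) := by
    simpa using lintegral_rpow_le_mul_measure_univ (μ := volume.restrict K) hh hr0 hrp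
  have hF : Measurable fun q : (E × ℝ) × E =>
      ENNReal.ofReal (q.1.2 ^ (a * (r - 1))) * g ((1 - q.1.2) • q.1.1 + q.1.2 • q.2) := by
    refine Measurable.mul ?_ (hgm.comp (by fun_prop))
    exact ((measurable_snd.comp measurable_fst).pow_const _).ennreal_ofReal
  have hpt : ∀ x ∈ K, ∀ z ∈ K, ‖u x‖ₑ ^ r ≤ 2 ^ (r - 1) * (‖u z‖ₑ ^ r + D *
      ∫⁻ t in Ioc (0 : ℝ) 1, ENNReal.ofReal (t ^ (a * (r - 1))) * g ((1 - t) • x + t • z)) := by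
    intro x hx z hz
    have hWm : Measurable fun t : ℝ => ‖fderiv ℝ u ((1 - t) • x + t • z)‖ₑ :=
      (hdu.enorm.comp (by fun_prop)).measurable
    refine (ENNReal.rpow_le_rpow (enorm_le_add_lintegral_segment hu (hR x hx z hz)) hr0.le).trans ?_
    refine (ENNReal.rpow_add_le_mul_rpow_add_rpow _ _ hr).trans ?_
    gcongr
    rw [ENNReal.mul_rpow_of_nonneg _ _ hr0.le, hD, mul_assoc]
    gcongr
    exact rpow_lintegral_Ioc_le hr hWm
  have hint : volume K * ∫⁻ x in K, (‖u x‖ₑ * h x) ^ r ≤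
      2 ^ (r - 1) * ((∫⁻ x in K, h x ^ r) * (∫⁻ z in K, ‖u z‖ₑ ^ r) + D *
        ∫⁻ t in Ioc (0 : ℝ) 1, ENNReal.ofReal (t ^ (a * (r - 1))) *
          ∫⁻ x in K, h x ^ r * ∫⁻ z in K, g ((1 - t) • x + t • z)) := by
    have hin : ∀ x ∈ K, volume K * (‖u x‖ₑ * h x) ^ r ≤ h x ^ r * (2 ^ (r - 1) *
        ((∫⁻ z in K, ‖u z‖ₑ ^ r) + D * ∫⁻ t in Ioc (0 : ℝ) 1, ∫⁻ z in K,
          ENNReal.ofReal (t ^ (a * (r - 1))) * g ((1 - t) • x + t • z))) := by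
      intro x hx
      have h1 : volume K * ‖u x‖ₑ ^ r ≤ ∫⁻ z in K, 2 ^ (r - 1) * (‖u z‖ₑ ^ r + D *
          ∫⁻ t in Ioc (0 : ℝ) 1,
            ENNReal.ofReal (t ^ (a * (r - 1))) * g ((1 - t) • x + t • z)) := by
        rw [mul_comm, ← setLIntegral_const]
        exact setLIntegral_mono' hm fun z hz => hpt x hx z hz
      have hFx : Measurable fun q : E × ℝ =>
          ENNReal.ofReal (q.2 ^ (a * (r - 1))) * g ((1 - q.2) • x + q.2 • q.1) :=
        hF.comp (by fun_prop : Measurable fun q : E × ℝ => ((x, q.2), q.1))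
      rw [lintegral_const_mul' _ _ h2top, lintegral_add_left hum,
        lintegral_const_mul' _ _ hDtop, lintegral_lintegral_swap hFx.aemeasurable] at h1
      rw [ENNReal.mul_rpow_of_nonneg _ _ hr0.le, ← mul_assoc, mul_comm]
      gcongr
    have hFs : Measurable fun q : E × ℝ => ∫⁻ z in K,
        ENNReal.ofReal (q.2 ^ (a * (r - 1))) * g ((1 - q.2) • q.1 + q.2 • z) :=
      hF.lintegral_prod_right'
    calc volume K * ∫⁻ x in K, (‖u x‖ₑ * h x) ^ r
        ≤ ∫⁻ x in K, h x ^ r * (2 ^ (r - 1) *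
        ((∫⁻ z in K, ‖u z‖ₑ ^ r) + D * ∫⁻ t in Ioc (0 : ℝ) 1, ∫⁻ z in K,
          ENNReal.ofReal (t ^ (a * (r - 1))) * g ((1 - t) • x + t • z))) := by
          rw [← lintegral_const_mul' _ _ hVtop]
          exact setLIntegral_mono' hm hin
      _ = 2 ^ (r - 1) * ∫⁻ x in K, (h x ^ r * (∫⁻ z in K, ‖u z‖ₑ ^ r) +
          D * ∫⁻ t in Ioc (0 : ℝ) 1, h x ^ r * ∫⁻ z in K,
          ENNReal.ofReal (t ^ (a * (r - 1))) * g ((1 - t) • x + t • z)) := by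
          rw [← lintegral_const_mul' _ _ h2top]
          refine lintegral_congr fun x => ?_
          have hFx : Measurable fun t : ℝ => ∫⁻ z in K,
              ENNReal.ofReal (t ^ (a * (r - 1))) * g ((1 - t) • x + t • z) :=
            hFs.comp (measurable_prodMk_left (x := x))
          rw [lintegral_const_mul _ hFx]
          ring
      _ = _ := by
          congr 1
          rw [lintegral_add_left ((hh.pow_const r).mul_const _), lintegral_mul_const _
            (hh.pow_const r), lintegral_const_mul' _ _ hDtop, lintegral_lintegral_swap
            (((hh.comp measurable_fst).pow_const r).mul hFs).aemeasurable]
          congr 2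
          refine lintegral_congr fun t => ?_
          rw [← lintegral_const_mul' _ _ ENNReal.ofReal_ne_top]
          refine lintegral_congr fun x => ?_
          rw [lintegral_const_mul' _ _ ENNReal.ofReal_ne_top]
          ring
  have hlast : ∫⁻ t in Ioc (0 : ℝ) 1, ENNReal.ofReal (t ^ (a * (r - 1))) *
      ∫⁻ x in K, h x ^ r * ∫⁻ z in K, g ((1 - t) • x + t • z) ≤
      Ca * (B * (Hp * ∫⁻ x in K, g x)) := by
    rw [hCa, ← lintegral_mul_const _ (by fun_prop)]
    refine setLIntegral_mono' measurableSet_Ioc fun t ht => ?_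
    have h3 := lintegral_segment_le hR hR0 hm hK.convex ht hr hrp hh hgm
    refine (mul_le_mul_right h3 _).trans (le_of_eq ?_)
    rw [← mul_assoc, ← ENNReal.ofReal_mul (Real.rpow_nonneg ht.1.le _), ← Real.rpow_add ht.1]
    congr 3
    rw [← ha]; ring
  have hfin : volume K * ∫⁻ x in K, (‖u x‖ₑ * h x) ^ r ≤
      2 ^ (r - 1) * (volume K ^ (1 - r / p) + D * (Ca * B)) * (Hp *
        ((∫⁻ x in K, ‖u x‖ₑ ^ r) + ∫⁻ x in K, g x)) := by
    refine hint.trans ?_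
    rw [mul_assoc ((2 : ℝ≥0∞) ^ (r - 1))]
    refine mul_le_mul_right ?_ _
    set U := ∫⁻ x in K, ‖u x‖ₑ ^ r
    set V := ∫⁻ x in K, g x
    calc _ ≤ Hp * volume K ^ (1 - r / p) * U + D * (Ca * (B * (Hp * V))) := by gcongr
      _ = volume K ^ (1 - r / p) * (Hp * U) + D * (Ca * B) * (Hp * V) := by ring
      _ ≤ volume K ^ (1 - r / p) * (Hp * (U + V)) + D * (Ca * B) * (Hp * (U + V)) := by
          gcongr
          · exact le_self_add
          · exact le_add_self
      _ = _ := by ring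
  calc ∫⁻ x in K, (‖u x‖ₑ * h x) ^ r
      = (volume K)⁻¹ * (volume K * ∫⁻ x in K, (‖u x‖ₑ * h x) ^ r) := by
        rw [← mul_assoc, ENNReal.inv_mul_cancel hV0 hVtop, one_mul]
    _ ≤ (volume K)⁻¹ * (2 ^ (r - 1) * (volume K ^ (1 - r / p) + D * (Ca * B)) * (Hp *
        ((∫⁻ x in K, ‖u x‖ₑ ^ r) + ∫⁻ x in K, g x))) := by gcongr
    _ = _ := by ring

theorem IsSolidConvex.exists_eLpNorm_mul_le_of_contDiff [CompleteSpace G] (hK : IsSolidConvex K)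
    {r p : ℝ≥0∞} (hr : 1 ≤ r) (hrp : r ≤ p) (hp : p ≠ ⊤) (hn : (Module.finrank ℝ E : ℝ≥0∞) < p) :
    ∃ C : ℝ≥0, ∀ (u : E → G) (h : E → ℝ), ContDiff ℝ 1 u →
      AEStronglyMeasurable h (volume.restrict K) →
      eLpNorm (fun x => ‖u x‖ * h x) r (volume.restrict K) ≤ C * eLpNorm h p (volume.restrict K) *
        (eLpNorm u r (volume.restrict K) + eLpNorm (fderiv ℝ u) r (volume.restrict K)) := by
  have hrtop : r ≠ ⊤ := ne_top_of_le_ne_top hp hrp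
  have hr0 : r ≠ 0 := (zero_lt_one.trans_le hr).ne'
  have hp0 : p ≠ 0 := ((zero_lt_one.trans_le hr).trans_le hrp).ne'
  have hr1' : 1 ≤ r.toReal := by rw [← ENNReal.toReal_one]; exact ENNReal.toReal_mono hrtop hr
  have hrp' : r.toReal ≤ p.toReal := ENNReal.toReal_mono hp hrp
  have hn' : (Module.finrank ℝ E : ℝ) < p.toReal := by
    have := (ENNReal.toReal_lt_toReal (by simp) hp).2 hn
    simpa using this
  have hrpos : 0 < r.toReal := zero_lt_one.trans_le hr1'
  have hppos : 0 < p.toReal := hrpos.trans_le hrp'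
  obtain ⟨C, hC, hmain⟩ := hK.exists_lintegral_mul_le (G := G) hr1' hrp' hn'
  have hCtop : C ^ (1 / r.toReal) ≠ ⊤ := ENNReal.rpow_ne_top_of_nonneg (by positivity) hC
  refine ⟨(C ^ (1 / r.toReal)).toNNReal, fun u h hu hh => ?_⟩
  rw [ENNReal.coe_toNNReal hCtop]
  have key := hmain u (fun x => ‖hh.mk h x‖ₑ) hu hh.stronglyMeasurable_mk.enorm
  have e1 : eLpNorm (fun x => ‖u x‖ * h x) r (volume.restrict K) =
      (∫⁻ x in K, (‖u x‖ₑ * ‖hh.mk h x‖ₑ) ^ r.toReal) ^ (1 / r.toReal) := by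
    rw [eLpNorm_eq_lintegral_rpow_enorm_toReal hr0 hrtop]
    congr 1
    refine lintegral_congr_ae ?_
    filter_upwards [hh.ae_eq_mk] with x hx
    rw [hx, enorm_mul, enorm_norm]
  have e2 : eLpNorm h p (volume.restrict K) =
      (∫⁻ x in K, ‖hh.mk h x‖ₑ ^ p.toReal) ^ (1 / p.toReal) := by
    rw [eLpNorm_congr_ae hh.ae_eq_mk, eLpNorm_eq_lintegral_rpow_enorm_toReal hp0 hp]
  rw [e1, e2, eLpNorm_eq_lintegral_rpow_enorm_toReal hr0 hrtop,
    eLpNorm_eq_lintegral_rpow_enorm_toReal hr0 hrtop]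
  refine (ENNReal.rpow_le_rpow key (by positivity)).trans ?_
  rw [ENNReal.mul_rpow_of_nonneg _ _ (by positivity),
    ENNReal.mul_rpow_of_nonneg _ _ (by positivity), ← ENNReal.rpow_mul, mul_assoc]
  have e3 : r.toReal / p.toReal * (1 / r.toReal) = 1 / p.toReal := by field_simp
  rw [e3]
  gcongr
  exact ENNReal.rpow_add_le_add_rpow _ _ (by positivity) ((div_le_one hrpos).2 hr1')

/-- The inequality for smooth functions is passed to the limit: a subsequence of the averages of `u`
converges almost everywhere, Fatou's lemma treats the left-hand side, and the norms on the right
converge. -/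
theorem IsSolidConvex.exists_eLpNorm_mul_le_of_le [CompleteSpace G] (hK : IsSolidConvex K)
    {r p : ℝ≥0∞} (hr : 1 ≤ r) (hrp : r ≤ p) (hp : p ≠ ⊤) (hn : (Module.finrank ℝ E : ℝ≥0∞) < p) :
    ∃ C : ℝ≥0, ∀ (u : E → G) (v : E → E →L[ℝ] G) (h : E → ℝ),
      HasWeakFDerivOn (interior K) u v → MemLp u r (volume.restrict K) →
      MemLp v r (volume.restrict K) → MemLp h p (volume.restrict K) →
      eLpNorm (fun x => ‖u x‖ * h x) r (volume.restrict K) ≤ C * eLpNorm h p (volume.restrict K) *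
        (eLpNorm u r (volume.restrict K) + eLpNorm v r (volume.restrict K)) := by
  have hrtop : r ≠ ⊤ := ne_top_of_le_ne_top hp hrp
  have hr0 : r ≠ 0 := (zero_lt_one.trans_le hr).ne'
  obtain ⟨C, hC⟩ := hK.exists_eLpNorm_mul_le_of_contDiff (G := G) hr hrp hp hn
  refine ⟨C, fun u v h huv hu hv hh => ?_⟩
  obtain ⟨b, φ, hφ⟩ := hK.exists_bump
  have hm := hK.isCompact.measurableSet
  have hu1 := hK.integrableOn hr hu
  set f : ℕ → E → G := fun k => bodyAverage φ K k u with hf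
  have hfs : ∀ k, ContDiff ℝ ∞ (f k) := fun k => contDiff_bodyAverage hm hu1 k
  have hfm : ∀ k, AEStronglyMeasurable (f k) (volume.restrict K) := fun k =>
    (hfs k).continuous.aestronglyMeasurable
  have hdfm : ∀ k, AEStronglyMeasurable (fderiv ℝ (f k)) (volume.restrict K) := fun k =>
    ((hfs k).continuous_fderiv (by simp)).aestronglyMeasurable
  have t1 : Tendsto (fun k => eLpNorm (f k - u) r (volume.restrict K)) atTop (𝓝 0) :=
    tendsto_bodyAverage hK hr hrtop hu
  have t2 : Tendsto (fun k => eLpNorm (fderiv ℝ (f k) - v) r (volume.restrict K)) atTop (𝓝 0) :=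
    tendsto_fderiv_bodyAverage hK hφ huv hr hrtop hu1 hv
  obtain ⟨ns, hns, hae⟩ :=
    (tendstoInMeasure_of_tendsto_eLpNorm hr0 hfm hu.1 t1).exists_seq_tendsto_ae
  have hbound : ∀ k, eLpNorm (fun x => ‖f k x‖ * h x) r (volume.restrict K) ≤
      C * eLpNorm h p (volume.restrict K) *
        ((eLpNorm (f k - u) r (volume.restrict K) + eLpNorm u r (volume.restrict K)) +
          (eLpNorm (fderiv ℝ (f k) - v) r (volume.restrict K) +
            eLpNorm v r (volume.restrict K))) := by
    intro k
    refine (hC (f k) h ((hfs k).of_le (by simp)) hh.1).trans ?_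
    gcongr
    · have := eLpNorm_add_le ((hfm k).sub hu.1) hu.1 hr
      rwa [sub_add_cancel] at this
    · have := eLpNorm_add_le ((hdfm k).sub hv.1) hv.1 hr
      rwa [sub_add_cancel] at this
  have hlim : Tendsto (fun k => C * eLpNorm h p (volume.restrict K) *
        ((eLpNorm (f (ns k) - u) r (volume.restrict K) + eLpNorm u r (volume.restrict K)) +
          (eLpNorm (fderiv ℝ (f (ns k)) - v) r (volume.restrict K) +
            eLpNorm v r (volume.restrict K)))) atTop
      (𝓝 (C * eLpNorm h p (volume.restrict K) *
        ((0 + eLpNorm u r (volume.restrict K)) + (0 + eLpNorm v r (volume.restrict K))))) := by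
    refine ENNReal.Tendsto.const_mul ?_ (Or.inr (ENNReal.mul_ne_top (by simp) hh.2.ne))
    exact ((t1.comp hns.tendsto_atTop).add tendsto_const_nhds).add
      ((t2.comp hns.tendsto_atTop).add tendsto_const_nhds)
  rw [zero_add, zero_add] at hlim
  rw [← hlim.liminf_eq]
  refine (Lp.eLpNorm_lim_le_liminf_eLpNorm (f := fun k x => ‖f (ns k) x‖ * h x)
    (fun k => (hfm (ns k)).norm.mul hh.1) _ ?_).trans
    (liminf_le_liminf (Eventually.of_forall fun k => hbound (ns k)))
  filter_upwards [hae] with x hx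
  exact hx.norm.mul_const _

/-- Multiplication `W^{1,r} × L^p → L^{min(p,r)}` for `p > dim E` on convex bodies. -/
theorem IsSolidConvex.exists_eLpNorm_mul_le [CompleteSpace G] (hK : IsSolidConvex K)
    {r p : ℝ≥0∞} (hr : 1 ≤ r) (hp : 1 ≤ p) (hn : (Module.finrank ℝ E : ℝ≥0∞) < p) :
    ∃ C : ℝ≥0, ∀ (u : E → G) (v : E → E →L[ℝ] G) (h : E → ℝ),
      HasWeakFDerivOn (interior K) u v → MemLp u r (volume.restrict K) →
      MemLp v r (volume.restrict K) → MemLp h p (volume.restrict K) →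
      eLpNorm (fun x => ‖u x‖ * h x) (min p r) (volume.restrict K) ≤
        C * eLpNorm h p (volume.restrict K) *
        (eLpNorm u r (volume.restrict K) + eLpNorm v r (volume.restrict K)) := by
  have hfin := hK.isFiniteMeasure
  rcases eq_or_ne p ⊤ with rfl | hptop
  · refine ⟨1, fun u v h _ hu _ _ => ?_⟩
    rw [min_eq_right le_top]
    refine (eLpNorm_le_eLpNorm_mul_eLpNorm_top r hu.1 h (fun a b => ‖a‖ * b) 1 ?_).trans ?_
    · refine Eventually.of_forall fun x => ?_
      rw [nnnorm_mul, nnnorm_norm, one_mul]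
    · rw [ENNReal.coe_one, one_mul, one_mul, mul_comm]
      gcongr
      exact le_self_add
  · rcases le_total p r with hpr | hrp
    -- For `p ≤ r` the inequality is used with both exponents equal to `p`; since `K` has finite
    -- measure, the `L^p` norms of `u` and `v` are at most `A` times their `L^r` norms.
    · obtain ⟨C, hC⟩ := hK.exists_eLpNorm_mul_le_of_le (G := G) hp le_rfl hptop hn
      set A := volume.restrict K univ ^ (1 / p.toReal - 1 / r.toReal) with hA
      have hAtop : A ≠ ⊤ := by
        refine ENNReal.rpow_ne_top_of_ne_zero ?_ (measure_ne_top _ _)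
        simpa using hK.measure_pos.ne'
      refine ⟨C * A.toNNReal, fun u v h huv hu hv hh => ?_⟩
      rw [min_eq_left hpr, ENNReal.coe_mul, ENNReal.coe_toNNReal hAtop]
      refine (hC u v h huv (hu.mono_exponent hpr) (hv.mono_exponent hpr) hh).trans ?_
      calc _ ≤ C * eLpNorm h p (volume.restrict K) * (eLpNorm u r (volume.restrict K) * A +
            eLpNorm v r (volume.restrict K) * A) := by
            gcongr
            · exact eLpNorm_le_eLpNorm_mul_rpow_measure_univ hpr hu.1
            · exact eLpNorm_le_eLpNorm_mul_rpow_measure_univ hpr hv.1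
        _ = _ := by ring
    · rw [min_eq_right hrp]
      exact hK.exists_eLpNorm_mul_le_of_le (G := G) hr hrp hptop hn

/-- The Sobolev embedding `W^{1,p} → L^∞` for `p > dim E` on convex bodies. -/
theorem IsSolidConvex.exists_ae_norm_le [CompleteSpace G] (hK : IsSolidConvex K)
    {p : ℝ≥0∞} (hp : 1 ≤ p) (hn : (Module.finrank ℝ E : ℝ≥0∞) < p) :
    ∃ C : ℝ≥0, ∀ (u : E → G) (v : E → E →L[ℝ] G),
      HasWeakFDerivOn (interior K) u v → MemLp u p (volume.restrict K) →
      MemLp v p (volume.restrict K) →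
      eLpNorm u ⊤ (volume.restrict K) ≤
        C * (eLpNorm u p (volume.restrict K) + eLpNorm v p (volume.restrict K)) := by
  have hfin := hK.isFiniteMeasure
  rcases eq_or_ne p ⊤ with rfl | hptop
  · refine ⟨1, fun u v _ hu hv => ?_⟩
    rw [ENNReal.coe_one, one_mul]
    exact le_self_add
  have hp0 : p ≠ 0 := (zero_lt_one.trans_le hp).ne'
  obtain ⟨C, hC⟩ := hK.exists_eLpNorm_mul_le_of_le (G := G) hp le_rfl hptop hn
  refine ⟨C, fun u v huv hu hv => ?_⟩
  set N := C * (eLpNorm u p (volume.restrict K) + eLpNorm v p (volume.restrict K)) with hN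
  have hNtop : N ≠ ⊤ := ENNReal.mul_ne_top (by simp)
    (ENNReal.add_ne_top.2 ⟨hu.2.ne, hv.2.ne⟩)
  rw [eLpNorm_exponent_top, eLpNormEssSup]
  refine essSup_le_of_ae_le _ ?_
  -- If `‖u‖ > N` on a set `A` of positive measure, multiplication by the indicator of `A` gives `‖u
  -- 1_A‖_p ≤ N |A| ^ (1 / p)`, which contradicts the strict inequality on `A`. Thus the
  -- multiplication inequality contains the embedding.
  by_contra hcon
  set u' := hu.1.mk u with hu'
  have hu'm : StronglyMeasurable u' := hu.1.stronglyMeasurable_mk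
  set A : Set E := {x | N < ‖u' x‖ₑ} with hA
  have hAm : MeasurableSet A := measurableSet_lt measurable_const hu'm.enorm
  have hApos : volume.restrict K A ≠ 0 := by
    intro h0
    refine hcon ?_
    have : ∀ᵐ x ∂volume.restrict K, x ∉ A := measure_eq_zero_iff_ae_notMem.1 h0
    filter_upwards [this, hu.1.ae_eq_mk] with x hx hx'
    rw [hx']
    exact not_lt.1 hx
  have hAtop : volume.restrict K A ≠ ⊤ := measure_ne_top _ _
  have key := hC u v (A.indicator fun _ => (1 : ℝ)) huv hu hv
    (memLp_indicator_const p hAm 1 (Or.inr hAtop))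
  rw [eLpNorm_indicator_const hAm hp0 hptop, enorm_one, one_mul, mul_assoc, mul_comm _ (_ + _),
    ← mul_assoc, ← hN] at key
  have hrpos : 0 < p.toReal := ENNReal.toReal_pos hp0 hptop
  have hpw : eLpNorm (fun x => ‖u x‖ * A.indicator (fun _ => (1 : ℝ)) x) p (volume.restrict K) =
      (∫⁻ x in A, ‖u' x‖ₑ ^ p.toReal ∂volume.restrict K) ^ (1 / p.toReal) := by
    rw [eLpNorm_eq_lintegral_rpow_enorm_toReal hp0 hptop, ← lintegral_indicator hAm]
    congr 1
    refine lintegral_congr_ae ?_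
    filter_upwards [hu.1.ae_eq_mk] with x hx
    rw [hx]
    by_cases hxA : x ∈ A
    · simp [hxA, hu']
    · simp [hxA, hrpos]
  rw [hpw] at key
  have key2 := ENNReal.rpow_le_rpow key hrpos.le
  rw [← ENNReal.rpow_mul, one_div_mul_cancel hrpos.ne', ENNReal.rpow_one,
    ENNReal.mul_rpow_of_nonneg _ _ hrpos.le, ← ENNReal.rpow_mul, one_div_mul_cancel hrpos.ne',
    ENNReal.rpow_one] at key2
  have hlt : N ^ p.toReal * volume.restrict K A <
      ∫⁻ x in A, ‖u' x‖ₑ ^ p.toReal ∂volume.restrict K := by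
    rw [← setLIntegral_const]
    refine setLIntegral_strict_mono hAm hApos (hu'm.enorm.pow_const _) ?_ ?_
    · rw [setLIntegral_const]
      exact ENNReal.mul_ne_top (ENNReal.rpow_ne_top_of_nonneg hrpos.le hNtop) hAtop
    · exact Eventually.of_forall fun x hx => ENNReal.rpow_lt_rpow hx hrpos
  exact absurd key2 (not_le.2 hlt)

end Multiplication

/-! ### Continuous representatives, product rule and chain rule on convex bodies. -/

section BodyCalculus

open scoped NNReal

variable {E : Type*} [NormedAddCommGroup E] [InnerProductSpace ℝ E]
    [FiniteDimensional ℝ E] [MeasurableSpace E] [BorelSpace E]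
    {G : Type*} [NormedAddCommGroup G] [NormedSpace ℝ G] {K : Set E}
    {p : ℝ≥0∞} {u : E → G} {v : E → E →L[ℝ] G}

theorem MeasureTheory.MemLp.of_exponent_le {X : Type*} [NormedAddCommGroup X] {μ : Measure E}
    [IsFiniteMeasure μ] {f : E → X} {q : ℝ≥0∞} (hf : MemLp f p μ) (hq : q ≤ p) : MemLp f q μ :=
  hf.mono_exponent hq

theorem memLp_restrict_of_continuousOn {X : Type*} [NormedAddCommGroup X] (hK : IsCompact K)
    {f : E → X} (hf : ContinuousOn f K) (p : ℝ≥0∞) : MemLp f p (volume.restrict K) := by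
  have : IsFiniteMeasure (volume.restrict K) := ⟨by simpa using hK.measure_lt_top⟩
  obtain ⟨c, hc⟩ := hK.exists_bound_of_continuousOn hf
  exact MemLp.of_bound (hf.aestronglyMeasurable_of_isCompact hK hK.measurableSet) c
    ((ae_restrict_iff' hK.measurableSet).2 (Eventually.of_forall hc))

theorem HasWeakFDerivOn.sub {Ω : Set E} {u u' : E → G} {v v' : E → E →L[ℝ] G}
    (h : HasWeakFDerivOn Ω u v) (h' : HasWeakFDerivOn Ω u' v') :
    HasWeakFDerivOn Ω (u - u') (v - v') := by
  have := h.add (h'.const_smul (-1))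
  simp only [neg_smul, one_smul, ← sub_eq_add_neg] at this
  exact this

theorem IsSolidConvex.closure_interior (hK : IsSolidConvex K) : closure (interior K) = K := by
  rw [hK.convex.closure_interior_eq_closure_of_nonempty_interior hK.interior_nonempty,
    hK.isCompact.isClosed.closure_eq]

/-- An almost everywhere bound on a continuous function holds everywhere on `K`, since the interior
of `K` is dense in `K` and nonempty open sets have positive measure. -/
theorem IsSolidConvex.enorm_le_eLpNorm_top (hK : IsSolidConvex K) {g g' : E → G}
    (hg : ContinuousOn g K) (h : g =ᵐ[volume.restrict K] g') {y : E} (hy : y ∈ K) :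
    ‖g y‖ₑ ≤ eLpNorm g' ⊤ (volume.restrict K) := by
  set N := eLpNorm g' ⊤ (volume.restrict K) with hN
  have hae : (fun x => max ‖g x‖ₑ N) =ᵐ[volume.restrict K] fun _ => N := by
    filter_upwards [enorm_ae_le_eLpNormEssSup g' (volume.restrict K), h] with x hx hx'
    rw [max_eq_right]
    rw [hx', hN, eLpNorm_exponent_top]
    exact hx
  have := Measure.eqOn_of_ae_eq hae (ContinuousOn.sup hg.enorm continuousOn_const) continuousOn_const
    hK.closure_interior.ge hy
  exact max_eq_right_iff.1 this

variable {b : E} {φ : ContDiffBump b}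

/-- The embedding into `L^∞` is applied to the difference of `u` and its average, which tends to
zero in `W^{1,p}`. -/
theorem tendsto_eLpNorm_top_bodyAverage [CompleteSpace G] (hK : IsSolidConvex K)
    (hφ : Metric.closedBall b φ.rOut ⊆ interior K) (hp : 1 ≤ p) (hpt : p ≠ ⊤)
    (hn : (Module.finrank ℝ E : ℝ≥0∞) < p) (h : HasWeakFDerivOn (interior K) u v)
    (hu : MemLp u p (volume.restrict K)) (hv : MemLp v p (volume.restrict K)) :
    Tendsto (fun k => eLpNorm (bodyAverage φ K k u - u) ⊤ (volume.restrict K)) atTop (𝓝 0) := by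
  have hm := hK.isCompact.measurableSet
  have hu1 := hK.integrableOn hp hu
  obtain ⟨C, hC⟩ := hK.exists_ae_norm_le (G := G) hp hn
  have hfs : ∀ k, ContDiff ℝ ∞ (bodyAverage φ K k u) := fun k => contDiff_bodyAverage hm hu1 k
  have t1 := tendsto_bodyAverage (φ := φ) hK hp hpt hu
  have t2 := tendsto_fderiv_bodyAverage hK hφ h hp hpt hu1 hv
  have hfin := hK.isFiniteMeasure
  refine tendsto_of_tendsto_of_tendsto_of_le_of_le tendsto_const_nhds ?_ (fun _ => zero_le)
    (fun k => hC _ (fderiv ℝ (bodyAverage φ K k u) - v)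
      ((HasWeakFDerivOn.of_contDiffOn isOpen_interior
        ((hfs k).of_le (by simp)).contDiffOn).sub h)
      ((memLp_restrict_of_continuousOn hK.isCompact (hfs k).continuous.continuousOn p).sub hu)
      ((memLp_restrict_of_continuousOn hK.isCompact
        ((hfs k).continuous_fderiv (by simp)).continuousOn p).sub hv))
  simpa using ENNReal.Tendsto.const_mul (t1.add t2) (Or.inr (ENNReal.coe_ne_top (r := C)))

/-- The averages are continuous and Cauchy in `L^∞`. For continuous functions on `K` this means
uniformly Cauchy, and the uniform limit is the continuous representative. -/
theorem exists_tendstoUniformlyOn_bodyAverage [CompleteSpace G] (hK : IsSolidConvex K)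
    (hφ : Metric.closedBall b φ.rOut ⊆ interior K) (hp : 1 ≤ p) (hpt : p ≠ ⊤)
    (hn : (Module.finrank ℝ E : ℝ≥0∞) < p) (h : HasWeakFDerivOn (interior K) u v)
    (hu : MemLp u p (volume.restrict K)) (hv : MemLp v p (volume.restrict K)) :
    ∃ g : E → G, ContinuousOn g K ∧ g =ᵐ[volume.restrict K] u ∧
      TendstoUniformlyOn (fun k => bodyAverage φ K k u) g atTop K := by
  have hm := hK.isCompact.measurableSet
  have hu1 := hK.integrableOn hp hu
  have t := tendsto_eLpNorm_top_bodyAverage hK hφ hp hpt hn h hu hv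
  have hc : ∀ k, Continuous (bodyAverage φ K k u) := fun k =>
    (contDiff_bodyAverage hm hu1 k).continuous
  have hcau : UniformCauchySeqOn (fun k => bodyAverage φ K k u) atTop K := by
    rw [Metric.uniformCauchySeqOn_iff]
    intro ε hε
    have hε4 : (0 : ℝ≥0∞) < ENNReal.ofReal (ε / 4) := ENNReal.ofReal_pos.2 (by positivity)
    obtain ⟨N, hN⟩ := eventually_atTop.1 (ENNReal.tendsto_nhds_zero.1 t _ hε4)
    refine ⟨N, fun i hi j hj x hx => ?_⟩
    have h1 := hK.enorm_le_eLpNorm_top (g := bodyAverage φ K i u - bodyAverage φ K j u)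
      ((hc i).sub (hc j)).continuousOn (EventuallyEq.refl _ _) hx
    have h2 : eLpNorm (bodyAverage φ K i u - bodyAverage φ K j u) ⊤ (volume.restrict K) ≤
        ENNReal.ofReal (ε / 4) + ENNReal.ofReal (ε / 4) := by
      have e : bodyAverage φ K i u - bodyAverage φ K j u =
          (bodyAverage φ K i u - u) - (bodyAverage φ K j u - u) := by abel
      rw [e]
      exact (eLpNorm_sub_le ((hc i).aestronglyMeasurable.sub hu.1)
        ((hc j).aestronglyMeasurable.sub hu.1) le_top).trans (add_le_add (hN i hi) (hN j hj))
    have h3 := h1.trans h2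
    rw [← ENNReal.ofReal_add (by positivity) (by positivity), ← ofReal_norm,
      ENNReal.ofReal_le_ofReal_iff (by positivity)] at h3
    rw [dist_eq_norm]
    simp only [Pi.sub_apply] at h3
    linarith
  have hlim : ∀ x, ∃ y, x ∈ K → Tendsto (fun k => bodyAverage φ K k u x) atTop (𝓝 y) := by
    intro x
    by_cases hx : x ∈ K
    · obtain ⟨y, hy⟩ := cauchySeq_tendsto_of_complete (hcau.cauchySeq hx)
      exact ⟨y, fun _ => hy⟩
    · exact ⟨0, fun h' => absurd h' hx⟩
  choose g hg using hlim
  have htu := hcau.tendstoUniformlyOn_of_tendsto (f := g) fun x hx => hg x hx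
  refine ⟨g, htu.continuousOn (Frequently.of_forall fun k => (hc k).continuousOn), ?_, htu⟩
  have hae : ∀ᵐ x ∂volume.restrict K, ∀ k, ‖(bodyAverage φ K k u - u) x‖ₑ ≤
      eLpNorm (bodyAverage φ K k u - u) ⊤ (volume.restrict K) := by
    rw [ae_all_iff]
    intro k
    rw [eLpNorm_exponent_top]
    exact enorm_ae_le_eLpNormEssSup _ _
  filter_upwards [hae, ae_restrict_mem hm] with x hx hxK
  refine tendsto_nhds_unique (hg x hxK) ?_
  rw [tendsto_iff_edist_tendsto_0]
  refine tendsto_of_tendsto_of_tendsto_of_le_of_le tendsto_const_nhds t (fun _ => zero_le) fun k => ?_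
  rw [edist_eq_enorm_sub]
  exact hx k

/-- Averages need not converge to their function in `L^∞`. On bounded sets `p = ∞` can be replaced
by the finite exponent `n + 1`. -/
theorem exists_finite_exponent (hp : 1 ≤ p) (hn : (Module.finrank ℝ E : ℝ≥0∞) < p) :
    ∃ q, 1 ≤ q ∧ q ≠ ⊤ ∧ q ≤ p ∧ (Module.finrank ℝ E : ℝ≥0∞) < q := by
  rcases eq_or_ne p ⊤ with rfl | hpt
  · exact ⟨Module.finrank ℝ E + 1, le_add_self, by simp, le_top,
      ENNReal.lt_add_right (by simp) one_ne_zero⟩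
  · exact ⟨p, hp, hpt, le_rfl, hn⟩

/-- A `W^{2,p}` function on a convex body, `p > dim E`, has a representative which is
continuously differentiable up to the boundary. -/
theorem IsSolidConvex.exists_hasFDerivWithinAt [CompleteSpace G] (hK : IsSolidConvex K)
    (hp : 1 ≤ p) (hn : (Module.finrank ℝ E : ℝ≥0∞) < p) {w : E → E →L[ℝ] E →L[ℝ] G}
    (h : HasWeakFDerivOn (interior K) u v) (h' : HasWeakFDerivOn (interior K) v w)
    (hu : MemLp u p (volume.restrict K)) (hv : MemLp v p (volume.restrict K))
    (hw : MemLp w p (volume.restrict K)) :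
    ∃ (f : E → G) (g : E → E →L[ℝ] G), f =ᵐ[volume.restrict K] u ∧ g =ᵐ[volume.restrict K] v ∧
      ContinuousOn g K ∧ ∀ y ∈ K, HasFDerivWithinAt f (g y) K y := by
  have hfin := hK.isFiniteMeasure
  obtain ⟨b, φ, hφ⟩ := hK.exists_bump
  obtain ⟨q, hq1, hqt, hqp, hnq⟩ := exists_finite_exponent hp hn
  replace hu := hu.mono_exponent hqp
  replace hv := hv.mono_exponent hqp
  have hwq : MemLp w q (volume.restrict K) := hw.of_exponent_le hqp
  obtain ⟨f, hf, hfu, hft⟩ := exists_tendstoUniformlyOn_bodyAverage hK hφ hq1 hqt hnq h hu hv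
  obtain ⟨g, hg, hgv, hgt⟩ := exists_tendstoUniformlyOn_bodyAverage hK hφ hq1 hqt hnq h' hv hwq
  refine ⟨f, g, hfu, hgv, hg, ?_⟩
  -- The factor `1 - ε` is harmless, since the continuous limit `g` is bounded on `K`.
  have hgt' : TendstoUniformlyOn (fun k x => (1 - averageScale k) • bodyAverage φ K k v x) g
      atTop K := by
    obtain ⟨c, hc⟩ := hK.isCompact.exists_bound_of_continuousOn hg
    rw [Metric.tendstoUniformlyOn_iff] at hgt ⊢
    intro ε hε
    have hc0 : 0 ≤ |c| + 1 := by positivity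
    have hs : ∀ᶠ k in atTop, averageScale k * (|c| + 1) < ε / 2 := by
      have := tendsto_averageScale.mul_const (|c| + 1)
      rw [zero_mul] at this
      exact this.eventually_lt_const (half_pos hε)
    filter_upwards [hgt (ε / 2) (half_pos hε), hs] with k hk hk' x hx
    have e : g x - (1 - averageScale k) • bodyAverage φ K k v x =
        (1 - averageScale k) • (g x - bodyAverage φ K k v x) + averageScale k • g x := by module
    have a0 := averageScale_pos k
    have a1 := averageScale_le k
    have h1 := hk x hx
    rw [dist_eq_norm] at h1 ⊢
    rw [e]
    refine (norm_add_le _ _).trans_lt ?_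
    rw [norm_smul, norm_smul, Real.norm_of_nonneg a0.le, Real.norm_of_nonneg (by linarith)]
    have h2 : (1 - averageScale k) * ‖g x - bodyAverage φ K k v x‖ ≤
        ‖g x - bodyAverage φ K k v x‖ :=
      mul_le_of_le_one_left (norm_nonneg _) (by linarith)
    have h3 : averageScale k * ‖g x‖ ≤ averageScale k * (|c| + 1) :=
      mul_le_mul_of_nonneg_left ((hc x hx).trans (by linarith [le_abs_self c])) a0.le
    linarith
  have hint : ∀ y ∈ interior K, HasFDerivAt f (g y) y := fun y hy =>
    hasFDerivAt_of_tendstoUniformlyOn isOpen_interior (hgt'.mono interior_subset)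
      (fun k x hx => hasFDerivAt_bodyAverage hK hφ h (hK.integrableOn hq1 hu)
        (hK.integrableOn hq1 hv) k (interior_subset hx))
      (fun x hx => hft.tendsto_at (interior_subset hx)) hy
  intro y hy
  -- In the interior, uniform convergence of functions and gradients gives the derivative. As `g` is
  -- continuous up to the boundary and the interior is convex, differentiability relative to `K`
  -- extends to boundary points.
  have := hasFDerivWithinAt_closure_of_tendsto_fderiv (f := f) (s := interior K) (x := y)
    (f' := g y) (fun z hz => (hint z hz).differentiableAt.differentiableWithinAt)
    hK.convex.interior isOpen_interior
    (fun z hz => (hf z (hK.closure_interior ▸ hz)).mono interior_subset) ?_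
  · rwa [hK.closure_interior] at this
  · refine ((hg y hy).mono interior_subset).congr' ?_
    filter_upwards [self_mem_nhdsWithin] with z hz
    exact (hint z hz).fderiv.symm

section Bilinear

variable {G₁ G₂ G₃ : Type*} [NormedAddCommGroup G₁] [NormedSpace ℝ G₁] [NormedAddCommGroup G₂]
  [NormedSpace ℝ G₂] [NormedAddCommGroup G₃] [NormedSpace ℝ G₃] {μ : Measure E}

/-- The assumptions concern products of norms because in one term of the product rule neither factor
need be bounded; the multiplication inequality then supplies them. -/
theorem tendsto_eLpNorm_bilin_sub (B : G₁ →L[ℝ] G₂ →L[ℝ] G₃) {x : ℕ → E → G₁} {y : ℕ → E → G₂}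
    {x₀ : E → G₁} {y₀ : E → G₂} (hx : ∀ k, AEStronglyMeasurable (x k) μ)
    (hy : ∀ k, AEStronglyMeasurable (y k) μ) (hx₀ : AEStronglyMeasurable x₀ μ)
    (hy₀ : AEStronglyMeasurable y₀ μ)
    (t1 : Tendsto (fun k => eLpNorm (fun z => ‖x k z - x₀ z‖ * ‖y k z‖) 1 μ) atTop (𝓝 0))
    (t2 : Tendsto (fun k => eLpNorm (fun z => ‖x₀ z‖ * ‖y k z - y₀ z‖) 1 μ) atTop (𝓝 0)) :
    Tendsto (fun k => eLpNorm ((fun z => B (x k z) (y k z)) - fun z => B (x₀ z) (y₀ z)) 1 μ)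
      atTop (𝓝 0) := by
  have hle : ∀ k, eLpNorm ((fun z => B (x k z) (y k z)) - fun z => B (x₀ z) (y₀ z)) 1 μ ≤
      ENNReal.ofReal ‖B‖ * (eLpNorm (fun z => ‖x k z - x₀ z‖ * ‖y k z‖) 1 μ +
        eLpNorm (fun z => ‖x₀ z‖ * ‖y k z - y₀ z‖) 1 μ) := by
    intro k
    refine (eLpNorm_le_mul_eLpNorm_of_ae_le_mul (g := fun z => ‖x k z - x₀ z‖ * ‖y k z‖ +
      ‖x₀ z‖ * ‖y k z - y₀ z‖) (c := ‖B‖) (Eventually.of_forall fun z => ?_) 1).trans ?_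
    · have e : B (x k z) (y k z) - B (x₀ z) (y₀ z) =
          B (x k z - x₀ z) (y k z) + B (x₀ z) (y k z - y₀ z) := by
        simp only [map_sub, sub_apply]; abel
      simp only [Pi.sub_apply]
      rw [e, Real.norm_of_nonneg (by positivity), mul_add]
      refine (norm_add_le _ _).trans (add_le_add ?_ ?_)
      · rw [← mul_assoc]; exact B.le_opNorm₂ _ _
      · rw [← mul_assoc]; exact B.le_opNorm₂ _ _
    · gcongr
      exact eLpNorm_add_le (((hx k).sub hx₀).norm.mul (hy k).norm)
        (hx₀.norm.mul ((hy k).sub hy₀).norm) le_rfl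
  refine tendsto_of_tendsto_of_tendsto_of_le_of_le tendsto_const_nhds ?_ (fun _ => zero_le) hle
  simpa using ENNReal.Tendsto.const_mul (t1.add t2)
    (Or.inr (ENNReal.ofReal_ne_top (r := ‖B‖)))

theorem tendsto_mul_mul_add_zero {C c : ℝ≥0∞} (hC : C ≠ ⊤) (hc : c ≠ ⊤) {α β : ℕ → ℝ≥0∞}
    (hα : Tendsto α atTop (𝓝 0)) (hβ : Tendsto β atTop (𝓝 0)) :
    Tendsto (fun k => C * (α k * (β k + c))) atTop (𝓝 0) := by
  have h1 : Tendsto (fun k => α k * (β k + c)) atTop (𝓝 (0 * (0 + c))) :=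
    ENNReal.Tendsto.mul hα (Or.inr (by simpa using hc)) (hβ.add tendsto_const_nhds)
      (Or.inr (by simp))
  simpa using ENNReal.Tendsto.const_mul h1 (Or.inr hC)

/-- Bilinear maps are continuous `L¹ × L^∞ → L¹`. -/
theorem tendsto_eLpNorm_bilin_sub_top (B : G₁ →L[ℝ] G₂ →L[ℝ] G₃) {x : ℕ → E → G₁}
    {y : ℕ → E → G₂} {x₀ : E → G₁} {y₀ : E → G₂} (hx : ∀ k, AEStronglyMeasurable (x k) μ)
    (hy : ∀ k, AEStronglyMeasurable (y k) μ) (hx₀ : MemLp x₀ 1 μ) (hy₀ : MemLp y₀ ⊤ μ)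
    (t1 : Tendsto (fun k => eLpNorm (x k - x₀) 1 μ) atTop (𝓝 0))
    (t2 : Tendsto (fun k => eLpNorm (y k - y₀) ⊤ μ) atTop (𝓝 0)) :
    Tendsto (fun k => eLpNorm ((fun z => B (x k z) (y k z)) - fun z => B (x₀ z) (y₀ z)) 1 μ)
      atTop (𝓝 0) := by
  refine tendsto_eLpNorm_bilin_sub B hx hy hx₀.1 hy₀.1 ?_ ?_
  · refine tendsto_of_tendsto_of_tendsto_of_le_of_le tendsto_const_nhds
      (tendsto_mul_mul_add_zero ENNReal.one_ne_top hy₀.2.ne t1 t2) (fun _ => zero_le) fun k => ?_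
    refine (eLpNorm_le_eLpNorm_mul_eLpNorm_top 1 ((hx k).sub hx₀.1) (y k) (fun a b => ‖a‖ * ‖b‖) 1
      (Eventually.of_forall fun z => by simp)).trans ?_
    rw [ENNReal.coe_one, one_mul, one_mul]
    gcongr
    have := eLpNorm_add_le ((hy k).sub hy₀.1) hy₀.1 (p := ⊤) le_top
    rwa [sub_add_cancel] at this
  · have t3 := ENNReal.Tendsto.const_mul t2 (Or.inr hx₀.2.ne)
    rw [mul_zero] at t3
    refine tendsto_of_tendsto_of_tendsto_of_le_of_le tendsto_const_nhds t3
      (fun _ => zero_le) fun k => ?_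
    refine (eLpNorm_le_eLpNorm_mul_eLpNorm_top 1 hx₀.1 (y k - y₀) (fun a b => ‖a‖ * ‖b‖) 1
      (Eventually.of_forall fun z => by simp)).trans ?_
    rw [ENNReal.coe_one, one_mul]

end Bilinear

/-- The product rule for `W^{1,1} × W^{1,p}`, `p > dim E`, on convex bodies. -/
theorem IsSolidConvex.hasWeakFDerivOn_bilin {G₁ G₂ G₃ : Type*} [NormedAddCommGroup G₁]
    [NormedSpace ℝ G₁] [NormedAddCommGroup G₂] [NormedSpace ℝ G₂] [NormedAddCommGroup G₃]
    [NormedSpace ℝ G₃] [CompleteSpace G₁] [CompleteSpace G₂] (B : G₁ →L[ℝ] G₂ →L[ℝ] G₃)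
    (hK : IsSolidConvex K) (hp : 1 ≤ p) (hn : (Module.finrank ℝ E : ℝ≥0∞) < p)
    {x : E → G₁} {x' : E → E →L[ℝ] G₁} {y : E → G₂} {y' : E → E →L[ℝ] G₂}
    (hx : HasWeakFDerivOn (interior K) x x') (hy : HasWeakFDerivOn (interior K) y y')
    (hx1 : MemLp x 1 (volume.restrict K)) (hx1' : MemLp x' 1 (volume.restrict K))
    (hyp : MemLp y p (volume.restrict K)) (hyp' : MemLp y' p (volume.restrict K)) :
    HasWeakFDerivOn (interior K) (fun z => B (x z) (y z))
      (fun z => B.precompR E (x z) (y' z) + B.precompL E (x' z) (y z)) := by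
  have hfin := hK.isFiniteMeasure
  have hm := hK.isCompact.measurableSet
  obtain ⟨b, φ, hφ⟩ := hK.exists_bump
  obtain ⟨q, hq1, hqt, hqp, hnq⟩ := exists_finite_exponent hp hn
  replace hyp := hyp.of_exponent_le hqp
  replace hyp' := hyp'.of_exponent_le hqp
  have hxi := hK.integrableOn le_rfl hx1
  have hyi := hK.integrableOn hq1 hyp
  set X : ℕ → E → G₁ := fun k => bodyAverage φ K k x with hX
  set Y : ℕ → E → G₂ := fun k => bodyAverage φ K k y with hY
  have hXs : ∀ k, ContDiff ℝ 1 (X k) := fun k => (contDiff_bodyAverage hm hxi k).of_le (by simp)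
  have hYs : ∀ k, ContDiff ℝ 1 (Y k) := fun k => (contDiff_bodyAverage hm hyi k).of_le (by simp)
  have hXm : ∀ k, AEStronglyMeasurable (X k) (volume.restrict K) := fun k =>
    (hXs k).continuous.aestronglyMeasurable
  have hYm : ∀ k, AEStronglyMeasurable (Y k) (volume.restrict K) := fun k =>
    (hYs k).continuous.aestronglyMeasurable
  have hXm' : ∀ k, AEStronglyMeasurable (fderiv ℝ (X k)) (volume.restrict K) := fun k =>
    ((hXs k).continuous_fderiv one_ne_zero).aestronglyMeasurable
  have hYm' : ∀ k, AEStronglyMeasurable (fderiv ℝ (Y k)) (volume.restrict K) := fun k =>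
    ((hYs k).continuous_fderiv one_ne_zero).aestronglyMeasurable
  have tX := tendsto_bodyAverage (φ := φ) hK le_rfl ENNReal.one_ne_top hx1
  have tX' := tendsto_fderiv_bodyAverage hK hφ hx le_rfl ENNReal.one_ne_top hxi hx1'
  have tY' := tendsto_fderiv_bodyAverage hK hφ hy hq1 hqt hyi hyp'
  have tYtop := tendsto_eLpNorm_top_bodyAverage hK hφ hq1 hqt hnq hy hyp hyp'
  have hytop : MemLp y ⊤ (volume.restrict K) := by
    obtain ⟨C, hC⟩ := hK.exists_ae_norm_le (G := G₂) hq1 hnq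
    exact ⟨hyp.1, (hC y y' hy hyp hyp').trans_lt (ENNReal.mul_lt_top (by simp)
      (ENNReal.add_lt_top.2 ⟨hyp.2, hyp'.2⟩))⟩
  -- With `r = 1` the multiplication inequality reads `W^{1,1} × L^q → L¹`, which is what the term
  -- with the derivative of `y` requires.
  obtain ⟨C, hC⟩ := hK.exists_eLpNorm_mul_le (G := G₁) (r := 1) le_rfl hq1 hnq
  rw [min_eq_right hq1] at hC
  have hXmem : ∀ k, MemLp (X k) 1 (volume.restrict K) := fun k =>
    memLp_restrict_of_continuousOn hK.isCompact (hXs k).continuous.continuousOn 1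
  have hXmem' : ∀ k, MemLp (fderiv ℝ (X k)) 1 (volume.restrict K) := fun k =>
    memLp_restrict_of_continuousOn hK.isCompact
      ((hXs k).continuous_fderiv one_ne_zero).continuousOn 1
  have hYmem' : ∀ k, MemLp (fderiv ℝ (Y k)) q (volume.restrict K) := fun k =>
    memLp_restrict_of_continuousOn hK.isCompact
      ((hYs k).continuous_fderiv one_ne_zero).continuousOn q
  have hweakX : ∀ k, HasWeakFDerivOn (interior K) (X k) (fderiv ℝ (X k)) := fun k =>
    HasWeakFDerivOn.of_contDiffOn isOpen_interior (hXs k).contDiffOn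
  have c1 : Tendsto (fun k => eLpNorm ((fun z => B (X k z) (Y k z)) - fun z => B (x z) (y z)) 1
      (volume.restrict K)) atTop (𝓝 0) :=
    tendsto_eLpNorm_bilin_sub_top B hXm hYm hx1 hytop tX tYtop
  have c2 : Tendsto (fun k => eLpNorm ((fun z => B.precompL E (fderiv ℝ (X k) z) (Y k z)) -
      fun z => B.precompL E (x' z) (y z)) 1 (volume.restrict K)) atTop (𝓝 0) :=
    tendsto_eLpNorm_bilin_sub_top (B.precompL E) hXm' hYm hx1' hytop tX' tYtop
  -- Here `x` is only integrable and `y'` is only in `L^q`: convergence of the first factor in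
  -- `W^{1,1}` and of the second in `L^q` is combined by the multiplication inequality.
  have c3 : Tendsto (fun k => eLpNorm ((fun z => B.precompR E (X k z) (fderiv ℝ (Y k) z)) -
      fun z => B.precompR E (x z) (y' z)) 1 (volume.restrict K)) atTop (𝓝 0) := by
    refine tendsto_eLpNorm_bilin_sub (B.precompR E) hXm hYm' hx1.1 hyp'.1 ?_ ?_
    · have tsum := tX.add tX'
      rw [add_zero] at tsum
      refine tendsto_of_tendsto_of_tendsto_of_le_of_le tendsto_const_nhds
        (tendsto_mul_mul_add_zero (C := C) (by simp) hyp'.2.ne tsum tY') (fun _ => zero_le)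
        fun k => ?_
      refine (hC (X k - x) (fderiv ℝ (X k) - x') (fun z => ‖fderiv ℝ (Y k) z‖)
        ((hweakX k).sub hx) ((hXmem k).sub hx1) ((hXmem' k).sub hx1') (hYmem' k).norm).trans ?_
      rw [eLpNorm_norm, mul_assoc, mul_comm (eLpNorm _ q _)]
      gcongr
      have := eLpNorm_add_le ((hYm' k).sub hyp'.1) hyp'.1 hq1
      rwa [sub_add_cancel] at this
    · have hfin2 : eLpNorm x 1 (volume.restrict K) + eLpNorm x' 1 (volume.restrict K) ≠ ⊤ :=
        ENNReal.add_ne_top.2 ⟨hx1.2.ne, hx1'.2.ne⟩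
      refine tendsto_of_tendsto_of_tendsto_of_le_of_le tendsto_const_nhds
        (tendsto_mul_mul_add_zero (C := C) (by simp) hfin2 tY' (tendsto_const_nhds (x := 0)))
        (fun _ => zero_le) fun k => ?_
      refine (hC x x' (fun z => ‖fderiv ℝ (Y k) z - y' z‖) hx hx1 hx1'
        ((hYmem' k).sub hyp').norm).trans ?_
      rw [eLpNorm_norm, mul_assoc, zero_add]
      exact le_rfl
  have hl1 : MemLp (fun z => B (x z) (y z)) 1 (volume.restrict K) := by
    refine ⟨B.aestronglyMeasurable_comp₂ hx1.1 hyp.1, ?_⟩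
    refine (eLpNorm_le_eLpNorm_mul_eLpNorm_top 1 hx1.1 y (fun a b => B a b) ‖B‖₊
      (Eventually.of_forall fun z => B.le_opNorm₂ _ _)).trans_lt ?_
    exact ENNReal.mul_lt_top (ENNReal.mul_lt_top (by simp) hx1.2) hytop.2
  have hl2 : MemLp (fun z => B.precompL E (x' z) (y z)) 1 (volume.restrict K) := by
    refine ⟨(B.precompL E).aestronglyMeasurable_comp₂ hx1'.1 hyp.1, ?_⟩
    refine (eLpNorm_le_eLpNorm_mul_eLpNorm_top 1 hx1'.1 y (fun a b => B.precompL E a b)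
      ‖B.precompL E‖₊ (Eventually.of_forall fun z => (B.precompL E).le_opNorm₂ _ _)).trans_lt ?_
    exact ENNReal.mul_lt_top (ENNReal.mul_lt_top (by simp) hx1'.2) hytop.2
  have hl3 : MemLp (fun z => B.precompR E (x z) (y' z)) 1 (volume.restrict K) := by
    refine ⟨(B.precompR E).aestronglyMeasurable_comp₂ hx1.1 hyp'.1, ?_⟩
    refine (eLpNorm_le_mul_eLpNorm_of_ae_le_mul (g := fun z => ‖x z‖ * ‖y' z‖)
      (c := ‖B.precompR E‖) (Eventually.of_forall fun z => ?_) 1).trans_lt ?_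
    · rw [Real.norm_of_nonneg (by positivity), ← mul_assoc]
      exact (B.precompR E).le_opNorm₂ _ _
    · refine ENNReal.mul_lt_top (by simp)
        ((hC x x' (fun z => ‖y' z‖) hx hx1 hx1' hyp'.norm).trans_lt ?_)
      exact ENNReal.mul_lt_top (ENNReal.mul_lt_top (by simp) hyp'.norm.2)
        (ENNReal.add_lt_top.2 ⟨hx1.2, hx1'.2⟩)
  have hsub : (volume.restrict (interior K) : Measure E) ≤ volume.restrict K :=
    Measure.restrict_mono interior_subset le_rfl
  have hdf : ∀ k, fderiv ℝ (fun z => B (X k z) (Y k z)) =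
      fun z => B.precompR E (X k z) (fderiv ℝ (Y k) z) + B.precompL E (fderiv ℝ (X k) z) (Y k z) :=
    fun k => funext fun z => B.fderiv_of_bilinear ((hXs k).differentiable one_ne_zero z)
      ((hYs k).differentiable one_ne_zero z)
  refine HasWeakFDerivOn.of_tendsto (f := fun k z => B (X k z) (Y k z))
    (f' := fun k => fderiv ℝ fun z => B (X k z) (Y k z)) isOpen_interior.measurableSet ?_ ?_ ?_ ?_ ?_
  · intro k
    exact HasWeakFDerivOn.of_contDiffOn isOpen_interior
      (B.isBoundedBilinearMap.contDiff.comp ((hXs k).prodMk (hYs k))).contDiffOn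
  · exact IntegrableOn.locallyIntegrableOn ((memLp_one_iff_integrable.1 hl1).mono_measure hsub)
  · exact IntegrableOn.locallyIntegrableOn
      ((memLp_one_iff_integrable.1 (hl3.add hl2)).mono_measure hsub)
  · exact tendsto_of_tendsto_of_tendsto_of_le_of_le tendsto_const_nhds c1 (fun _ => zero_le)
      fun k => eLpNorm_mono_measure _ hsub
  · have c4 := c3.add c2
    rw [add_zero] at c4
    refine tendsto_of_tendsto_of_tendsto_of_le_of_le tendsto_const_nhds c4 (fun _ => zero_le)
      fun k => (eLpNorm_mono_measure _ hsub).trans ?_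
    have e : (fderiv ℝ (fun z => B (X k z) (Y k z)) - fun z =>
        B.precompR E (x z) (y' z) + B.precompL E (x' z) (y z)) =
        ((fun z => B.precompR E (X k z) (fderiv ℝ (Y k) z)) - fun z => B.precompR E (x z) (y' z)) +
        ((fun z => B.precompL E (fderiv ℝ (X k) z) (Y k z)) -
          fun z => B.precompL E (x' z) (y z)) := by
      rw [hdf]
      funext z
      simp only [Pi.sub_apply, Pi.add_apply]
      abel
    rw [e]
    exact eLpNorm_add_le
      (((B.precompR E).aestronglyMeasurable_comp₂ (hXm k) (hYm' k)).sub hl3.1)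
      (((B.precompL E).aestronglyMeasurable_comp₂ (hXm' k) (hYm k)).sub hl2.1) le_rfl

/-- `f` is uniformly continuous on the compact set `T`; the shift by `N` discards the indices for
which `U` may leave `T`. -/
theorem tendsto_eLpNorm_top_comp {Y : Type*} [NormedAddCommGroup Y] (hK : MeasurableSet K)
    {f : G → Y} {T : Set G} (hf : ContinuousOn f T) (hT : IsCompact T) {U : ℕ → E → G}
    (hU : TendstoUniformlyOn U u atTop K) {N : ℕ} (hN : ∀ k, N ≤ k → ∀ x ∈ K, U k x ∈ T)
    (huT : ∀ x ∈ K, u x ∈ T) :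
    Tendsto (fun k => eLpNorm ((fun z => f (U (k + N) z)) - fun z => f (u z)) ⊤
      (volume.restrict K)) atTop (𝓝 0) := by
  have huf := hT.uniformContinuousOn_of_continuous hf
  rw [ENNReal.tendsto_nhds_zero]
  intro ε hε
  by_cases hεt : ε = ⊤
  · simp [hεt]
  have hε' : 0 < ε.toReal := ENNReal.toReal_pos hε.ne' hεt
  obtain ⟨η, hη, hfη⟩ := Metric.uniformContinuousOn_iff.1 huf ε.toReal hε'
  have ht' := (tendsto_add_atTop_nat N).eventually (Metric.tendstoUniformlyOn_iff.1 hU η hη)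
  filter_upwards [ht'] with k hk
  rw [eLpNorm_exponent_top]
  refine eLpNormEssSup_le_of_ae_enorm_bound ?_
  filter_upwards [ae_restrict_mem hK] with x hx
  rw [← ofReal_norm, ← ENNReal.ofReal_toReal hεt]
  refine ENNReal.ofReal_le_ofReal ?_
  rw [Pi.sub_apply, ← dist_eq_norm]
  refine (hfη _ (hN (k + N) (by omega) x hx) _ (huT x hx) ?_).le
  rw [dist_comm]; exact hk x hx

/-- The chain rule for `W^{1,p}` functions, `p > dim E`, on convex bodies. -/
theorem IsSolidConvex.hasWeakFDerivOn_comp {G' : Type*} [NormedAddCommGroup G'] [NormedSpace ℝ G']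
    [FiniteDimensional ℝ G] (hK : IsSolidConvex K) (hp : 1 ≤ p)
    (hn : (Module.finrank ℝ E : ℝ≥0∞) < p) {O : Set G} (hO : IsOpen O) {h : G → G'}
    (hh : ContDiffOn ℝ 1 h O) (huc : ContinuousOn u K) (huO : MapsTo u K O)
    (huv : HasWeakFDerivOn (interior K) u v) (hv : MemLp v p (volume.restrict K)) :
    HasWeakFDerivOn (interior K) (fun z => h (u z)) (fun z => (fderiv ℝ h (u z)).comp (v z)) := by
  have hfin := hK.isFiniteMeasure
  have hm := hK.isCompact.measurableSet
  have : CompleteSpace G := FiniteDimensional.complete ℝ G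
  have : ProperSpace G := FiniteDimensional.proper ℝ G
  obtain ⟨b, φ, hφ⟩ := hK.exists_bump
  obtain ⟨q, hq1, hqt, hqp, hnq⟩ := exists_finite_exponent hp hn
  replace hv := hv.of_exponent_le hqp
  have hup : MemLp u q (volume.restrict K) := memLp_restrict_of_continuousOn hK.isCompact huc q
  have hui := hK.integrableOn hq1 hup
  obtain ⟨g, hg, hgu, hgt⟩ := exists_tendstoUniformlyOn_bodyAverage hK hφ hq1 hqt hnq huv hup hv
  have hgu' : EqOn g u K := Measure.eqOn_of_ae_eq hgu hg huc hK.closure_interior.ge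
  replace hgt := hgt.congr_right hgu'
  set U : ℕ → E → G := fun k => bodyAverage φ K k u with hU
  have hUs : ∀ k, ContDiff ℝ 1 (U k) := fun k => (contDiff_bodyAverage hm hui k).of_le (by simp)
  have hKu : IsCompact (u '' K) := hK.isCompact.image_of_continuousOn huc
  -- A closed neighbourhood of the compact image of `u` still lies in `O`. By uniform convergence
  -- the averages eventually take their values there, where `h` and its derivative are uniformly
  -- continuous.
  obtain ⟨δ, hδ, hT⟩ := hKu.exists_cthickening_subset_open hO (image_subset_iff.2 huO)
  set T := Metric.cthickening δ (u '' K) with hTdef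
  have hTc : IsCompact T := hKu.cthickening
  have hUT : ∀ᶠ k in atTop, ∀ x ∈ K, U k x ∈ T := by
    filter_upwards [Metric.tendstoUniformlyOn_iff.1 hgt δ hδ] with k hk x hx
    refine Metric.mem_cthickening_of_dist_le _ (u x) δ _ (mem_image_of_mem u hx) ?_
    rw [dist_comm]; exact (hk x hx).le
  have huT : ∀ x ∈ K, u x ∈ T := fun x hx => Metric.self_subset_cthickening _ (mem_image_of_mem u hx)
  have hdh : ContinuousOn (fderiv ℝ h) T := (hh.continuousOn_fderiv_of_isOpen hO le_rfl).mono hT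
  have hhc : ContinuousOn h T := hh.continuousOn.mono hT
  obtain ⟨N, hN⟩ := eventually_atTop.1 hUT
  have tdh : Tendsto (fun k => eLpNorm ((fun z => fderiv ℝ h (U (k + N) z)) -
      fun z => fderiv ℝ h (u z)) ⊤ (volume.restrict K)) atTop (𝓝 0) :=
    tendsto_eLpNorm_top_comp hm hdh hTc hgt (fun k hk => hN k hk) huT
  have th : Tendsto (fun k => eLpNorm ((fun z => h (U (k + N) z)) -
      fun z => h (u z)) ⊤ (volume.restrict K)) atTop (𝓝 0) :=
    tendsto_eLpNorm_top_comp hm hhc hTc hgt (fun k hk => hN k hk) huT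
  set B := (ContinuousLinearMap.compL ℝ E G G').flip with hB
  have hUm' : ∀ k, AEStronglyMeasurable (fderiv ℝ (U (k + N))) (volume.restrict K) := fun k =>
    ((hUs _).continuous_fderiv one_ne_zero).aestronglyMeasurable
  have hcomp : ∀ k, ∀ x ∈ K, U (k + N) x ∈ T := fun k => hN (k + N) (by omega)
  have hdhU : ∀ k, AEStronglyMeasurable (fun z => fderiv ℝ h (U (k + N) z))
      (volume.restrict K) := fun k =>
    (hdh.comp (hUs _).continuous.continuousOn (hcomp k)).aestronglyMeasurable_of_isCompact
      hK.isCompact hm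
  have hv1 : MemLp v 1 (volume.restrict K) := hv.of_exponent_le hq1
  have tv1 : Tendsto (fun k => eLpNorm (fderiv ℝ (U (k + N)) - v) 1 (volume.restrict K)) atTop
      (𝓝 0) :=
    (tendsto_fderiv_bodyAverage hK hφ huv le_rfl ENNReal.one_ne_top hui hv1).comp
      (tendsto_add_atTop_nat N)
  have hdhu : MemLp (fun z => fderiv ℝ h (u z)) ⊤ (volume.restrict K) :=
    memLp_restrict_of_continuousOn hK.isCompact (hdh.comp huc huT) ⊤
  have tB := tendsto_eLpNorm_bilin_sub_top B hUm' hdhU hv1 hdhu tv1 tdh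
  have hsub : (volume.restrict (interior K) : Measure E) ≤ volume.restrict K :=
    Measure.restrict_mono interior_subset le_rfl
  have hlim : MemLp (fun z => B (v z) (fderiv ℝ h (u z))) 1 (volume.restrict K) := by
    refine ⟨B.aestronglyMeasurable_comp₂ hv1.1 hdhu.1, ?_⟩
    refine (eLpNorm_le_eLpNorm_mul_eLpNorm_top 1 hv1.1 _ (fun a b => B a b) ‖B‖₊
      (Eventually.of_forall fun z => B.le_opNorm₂ _ _)).trans_lt ?_
    exact ENNReal.mul_lt_top (ENNReal.mul_lt_top (by simp) hv1.2) hdhu.2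
  have hhu : MemLp (fun z => h (u z)) 1 (volume.restrict K) :=
    memLp_restrict_of_continuousOn hK.isCompact (hhc.comp huc huT) 1
  have hUO : ∀ k, MapsTo (U (k + N)) (interior K) O := fun k z hz =>
    hT (hcomp k z (interior_subset hz))
  refine HasWeakFDerivOn.of_tendsto (f := fun k z => h (U (k + N) z))
    (f' := fun k z => B (fderiv ℝ (U (k + N)) z) (fderiv ℝ h (U (k + N) z)))
    isOpen_interior.measurableSet ?_ ?_ ?_ ?_ ?_
  · intro k
    refine (HasWeakFDerivOn.of_contDiffOn isOpen_interior
      (hh.comp (hUs (k + N)).contDiffOn (hUO k))).congr isOpen_interior.measurableSet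
      (EventuallyEq.refl _ _) ?_
    filter_upwards [ae_restrict_mem isOpen_interior.measurableSet] with z hz
    exact fderiv_comp z ((hh.differentiableOn one_ne_zero).differentiableAt
      (hO.mem_nhds (hUO k hz))) ((hUs (k + N)).differentiable one_ne_zero z)
  · exact IntegrableOn.locallyIntegrableOn ((memLp_one_iff_integrable.1 hhu).mono_measure hsub)
  · exact IntegrableOn.locallyIntegrableOn ((memLp_one_iff_integrable.1 hlim).mono_measure hsub)
  · have th' := ENNReal.Tendsto.mul_const (b := volume.restrict K univ ^
      (1 / (1 : ℝ≥0∞).toReal - 1 / (⊤ : ℝ≥0∞).toReal)) th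
      (Or.inr (ENNReal.rpow_ne_top_of_nonneg (by simp) (measure_ne_top _ _)))
    rw [zero_mul] at th'
    refine tendsto_of_tendsto_of_tendsto_of_le_of_le tendsto_const_nhds th' (fun _ => zero_le)
      fun k => (eLpNorm_mono_measure _ hsub).trans
        (eLpNorm_le_eLpNorm_mul_rpow_measure_univ le_top ?_)
    exact ((hhc.comp (hUs _).continuous.continuousOn
      (hcomp k)).aestronglyMeasurable_of_isCompact hK.isCompact hm).sub hhu.1
  · exact tendsto_of_tendsto_of_tendsto_of_le_of_le tendsto_const_nhds tB (fun _ => zero_le)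
      fun k => eLpNorm_mono_measure _ hsub

end BodyCalculus

/-! ### Null sets, `L^q` norms and weak derivatives under changes of variables. -/

section ChangeOfVariables

open scoped NNReal

variable {E : Type*} [NormedAddCommGroup E] [InnerProductSpace ℝ E]
    [FiniteDimensional ℝ E] [MeasurableSpace E] [BorelSpace E]
    {G : Type*} [NormedAddCommGroup G] [NormedSpace ℝ G] {K L : Set E} {τ σ : E → E}

/-- The part of `K` that is mapped into `A` lies in the `σ`-image of `τ(K) ∩ A`, whose volume is at
most the integral of `|det σ'|` there. Hence only a bound on the Jacobian of the inverse is needed.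
-/
theorem map_restrict_le_smul (hK : IsCompact K) (hτ : ContinuousOn τ K)
    (hmaps : MapsTo τ K L) (hinv : LeftInvOn σ τ K) {σ' : E → E →L[ℝ] E}
    (hσ : ∀ z ∈ τ '' K, HasFDerivWithinAt σ (σ' z) (τ '' K) z) {C : ℝ}
    (hC : ∀ z ∈ τ '' K, |(σ' z).det| ≤ C) :
    Measure.map τ (volume.restrict K) ≤ ENNReal.ofReal C • volume.restrict L := by
  refine Measure.le_iff.2 fun A hA => ?_
  have hτm : AEMeasurable τ (volume.restrict K) := hτ.aemeasurable hK.measurableSet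
  have him : MeasurableSet (τ '' K) := (hK.image_of_continuousOn hτ).measurableSet
  rw [Measure.map_apply_of_aemeasurable hτm hA]
  have h0 : MeasurableSet (τ '' K ∩ A) := him.inter hA
  calc volume.restrict K (τ ⁻¹' A) = volume (τ ⁻¹' A ∩ K) :=
        Measure.restrict_apply' hK.measurableSet
    _ ≤ volume (σ '' (τ '' K ∩ A)) := by
        refine measure_mono ?_
        rintro y ⟨hyA, hyK⟩
        exact ⟨τ y, ⟨mem_image_of_mem τ hyK, hyA⟩, hinv hyK⟩
    _ ≤ ∫⁻ z in τ '' K ∩ A, ENNReal.ofReal |(σ' z).det| :=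
        addHaar_image_le_lintegral_abs_det_fderiv volume h0 fun z hz =>
          (hσ z hz.1).mono inter_subset_left
    _ ≤ ∫⁻ _ in τ '' K ∩ A, ENNReal.ofReal C :=
        setLIntegral_mono' h0 fun z hz => ENNReal.ofReal_le_ofReal (hC z hz.1)
    _ = ENNReal.ofReal C * volume (τ '' K ∩ A) := setLIntegral_const _ _
    _ ≤ ENNReal.ofReal C * volume.restrict L A := by
        rw [Measure.restrict_apply hA]
        refine mul_le_mul_right (measure_mono fun z hz => ?_) _
        obtain ⟨⟨y, hy, rfl⟩, hzA⟩ := hz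
        exact ⟨hzA, hmaps hy⟩
    _ = _ := by simp

section Comp

variable {X : Type*} [NormedAddCommGroup X] {μ ν : Measure E} {c : ℝ≥0∞} {g : E → X}

theorem map_absolutelyContinuous (hle : μ.map τ ≤ c • ν) : μ.map τ ≪ ν :=
  (Measure.absolutelyContinuous_of_le hle).trans (Measure.smul_absolutelyContinuous)

theorem aestronglyMeasurable_comp_of_map_le (hτ : AEMeasurable τ μ) (hle : μ.map τ ≤ c • ν)
    (hg : AEStronglyMeasurable g ν) : AEStronglyMeasurable (fun y => g (τ y)) μ :=
  (hg.mono_ac (map_absolutelyContinuous hle)).comp_aemeasurable hτ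

/-- The natural constant is `c ^ (1 / q)`. Since `1 + c ≥ 1` dominates its own powers with exponent
at most one, it serves for all `q`, including `q = ∞`. -/
theorem eLpNorm_comp_le (hτ : AEMeasurable τ μ) (hle : μ.map τ ≤ c • ν)
    (hg : AEStronglyMeasurable g ν) {q : ℝ≥0∞} (hq : 1 ≤ q) :
    eLpNorm (fun y => g (τ y)) q μ ≤ (1 + c) * eLpNorm g q ν := by
  have h1 : eLpNorm (fun y => g (τ y)) q μ = eLpNorm g q (μ.map τ) :=
    (eLpNorm_map_measure (hg.mono_ac (map_absolutelyContinuous hle)) hτ).symm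
  have h2 : μ.map τ ≤ (1 + c) • ν := hle.trans (by
    rw [add_smul, one_smul]; exact Measure.le_add_left le_rfl)
  rw [h1]
  refine (eLpNorm_mono_measure g h2).trans ?_
  rw [eLpNorm_smul_measure_of_ne_zero (by simp), smul_eq_mul]
  gcongr
  calc (1 + c) ^ (1 / q).toReal ≤ (1 + c) ^ (1 : ℝ) := by
        refine ENNReal.rpow_le_rpow_of_exponent_le le_self_add ?_
        rw [← ENNReal.toReal_one]
        refine ENNReal.toReal_mono ENNReal.one_ne_top ?_
        rw [one_div]
        exact ENNReal.inv_le_one.2 hq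
    _ = 1 + c := ENNReal.rpow_one _

end Comp

theorem isSolidConvex_closedBall (y : E) {ε : ℝ} (hε : 0 < ε) :
    IsSolidConvex (Metric.closedBall y ε) :=
  ⟨isCompact_closedBall y ε, convex_closedBall y ε,
    ⟨y, Metric.ball_subset_interior_closedBall (Metric.mem_ball_self hε)⟩⟩

/-- Weak derivatives under a change of variables. -/
theorem HasWeakFDerivOn.comp_diffeo [CompleteSpace G] {Ω Ω' : Set E} (hΩ : IsOpen Ω)
    (hΩ' : IsOpen Ω') (hτ : ContDiffOn ℝ 1 τ Ω) (hσ : ContDiffOn ℝ 1 σ Ω') (hmaps : MapsTo τ Ω Ω')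
    (hinv : LeftInvOn σ τ Ω) {u : E → G} {v : E → E →L[ℝ] G} (h : HasWeakFDerivOn Ω' u v) :
    HasWeakFDerivOn Ω (fun y => u (τ y)) (fun y => (v (τ y)).comp (fderiv ℝ τ y)) := by
  refine of_forall_exists fun y₀ hy₀ => ?_
  obtain ⟨ρ, hρ, hK'⟩ := Metric.nhds_basis_closedBall.mem_iff.1 (hΩ'.mem_nhds (hmaps hy₀))
  have hpre : Ω ∩ τ ⁻¹' Metric.closedBall (τ y₀) ρ ∈ 𝓝 y₀ :=
    inter_mem (hΩ.mem_nhds hy₀) ((hτ.continuousOn.continuousAt (hΩ.mem_nhds hy₀)).preimage_mem_nhds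
      (Metric.closedBall_mem_nhds _ hρ))
  obtain ⟨ε, hε, hKsub⟩ := Metric.nhds_basis_closedBall.mem_iff.1 hpre
  set K := Metric.closedBall y₀ ε with hKdef
  set K' := Metric.closedBall (τ y₀) ρ with hKdef'
  have hKs : IsSolidConvex K := isSolidConvex_closedBall y₀ hε
  have hKs' : IsSolidConvex K' := isSolidConvex_closedBall _ hρ
  have hKΩ : K ⊆ Ω := fun y hy => (hKsub hy).1
  have hKK' : MapsTo τ K K' := fun y hy => (hKsub hy).2
  refine ⟨interior K, isOpen_interior,
    Metric.ball_subset_interior_closedBall (Metric.mem_ball_self hε), ?_⟩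
  have himK' : τ '' K ⊆ K' := image_subset_iff.2 hKK'
  have hdσ : ContinuousOn (fun z => |(fderiv ℝ σ z).det|) K' :=
    (ContinuousLinearMap.continuous_det.comp_continuousOn
      ((hσ.continuousOn_fderiv_of_isOpen hΩ' le_rfl).mono hK')).abs
  obtain ⟨C, hC⟩ := hKs'.isCompact.exists_bound_of_continuousOn hdσ
  -- Being a weak derivative is local, so balls `K` and `K'` with `τ(K) ⊆ K'` suffice; on them all
  -- derivatives and Jacobians are bounded.
  have hle : Measure.map τ (volume.restrict K) ≤ ENNReal.ofReal C • volume.restrict K' :=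
    map_restrict_le_smul hKs.isCompact (hτ.continuousOn.mono hKΩ) hKK'
      (fun y hy => hinv (hKΩ hy))
      (fun z hz => ((hσ.differentiableOn one_ne_zero).differentiableAt
        (hΩ'.mem_nhds (hK' (himK' hz)))).hasFDerivAt.hasFDerivWithinAt)
      (fun z hz => by simpa using hC z (himK' hz))
  have hτm : AEMeasurable τ (volume.restrict K) :=
    (hτ.continuousOn.mono hKΩ).aemeasurable hKs.isCompact.measurableSet
  have hu1 : IntegrableOn u K' := h.1.integrableOn_compact_subset hK' hKs'.isCompact
  have hv1 : IntegrableOn v K' := h.2.1.integrableOn_compact_subset hK' hKs'.isCompact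
  obtain ⟨b, φ, hφ⟩ := hKs'.exists_bump
  have hw : HasWeakFDerivOn (interior K') u v := h.mono (interior_subset.trans hK')
  -- The smooth averages on `K'` obey the classical chain rule after composition with `τ`, and the
  -- bound on the image measure carries their `L¹` convergence back to `K`.
  have t1 := tendsto_bodyAverage (φ := φ) hKs' le_rfl ENNReal.one_ne_top
    (memLp_one_iff_integrable.2 hu1)
  have t2 := tendsto_fderiv_bodyAverage hKs' hφ hw le_rfl ENNReal.one_ne_top hu1
    (memLp_one_iff_integrable.2 hv1)
  set U : ℕ → E → G := fun k => bodyAverage φ K' k u with hU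
  have hUs : ∀ k, ContDiff ℝ 1 (U k) := fun k =>
    (contDiff_bodyAverage hKs'.isCompact.measurableSet hu1 k).of_le (by simp)
  have hsub : (volume.restrict (interior K) : Measure E) ≤ volume.restrict K :=
    Measure.restrict_mono interior_subset le_rfl
  have hdτ : ContinuousOn (fderiv ℝ τ) K :=
    (hτ.continuousOn_fderiv_of_isOpen hΩ le_rfl).mono hKΩ
  obtain ⟨D, hD⟩ := hKs.isCompact.exists_bound_of_continuousOn hdτ
  have hvm : MemLp (fun y => (v (τ y)).comp (fderiv ℝ τ y)) 1 (volume.restrict K) := by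
    have hvτ := aestronglyMeasurable_comp_of_map_le hτm hle hv1.1
    have hdτm := hdτ.aestronglyMeasurable_of_isCompact hKs.isCompact hKs.isCompact.measurableSet
      (μ := volume)
    refine ⟨(ContinuousLinearMap.compL ℝ E E G).aestronglyMeasurable_comp₂ hvτ hdτm, ?_⟩
    have hb : ∀ᵐ y ∂volume.restrict K,
        ‖(v (τ y)).comp (fderiv ℝ τ y)‖ ≤ D * ‖v (τ y)‖ := by
      filter_upwards [ae_restrict_mem hKs.isCompact.measurableSet] with y hy
      refine (ContinuousLinearMap.opNorm_comp_le _ _).trans ?_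
      rw [mul_comm]
      exact mul_le_mul_of_nonneg_right (hD y hy) (norm_nonneg _)
    refine (eLpNorm_le_mul_eLpNorm_of_ae_le_mul hb 1).trans_lt ?_
    refine ENNReal.mul_lt_top (by simp)
      ((eLpNorm_comp_le (g := v) hτm hle hv1.1 le_rfl).trans_lt ?_)
    exact ENNReal.mul_lt_top (by simp) (memLp_one_iff_integrable.2 hv1).2
  have hum : MemLp (fun y => u (τ y)) 1 (volume.restrict K) :=
    ⟨aestronglyMeasurable_comp_of_map_le hτm hle hu1.1,
      (eLpNorm_comp_le (g := u) hτm hle hu1.1 le_rfl).trans_lt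
        (ENNReal.mul_lt_top (by simp) (memLp_one_iff_integrable.2 hu1).2)⟩
  refine of_tendsto (f := fun k y => U k (τ y))
    (f' := fun k y => (fderiv ℝ (U k) (τ y)).comp (fderiv ℝ τ y)) isOpen_interior.measurableSet
    ?_ ?_ ?_ ?_ ?_
  · intro k
    refine (HasWeakFDerivOn.of_contDiffOn isOpen_interior ((hUs k).comp_contDiffOn
      (hτ.mono (interior_subset.trans hKΩ)))).congr isOpen_interior.measurableSet
      (EventuallyEq.refl _ _) ?_
    filter_upwards [ae_restrict_mem isOpen_interior.measurableSet] with z hz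
    exact fderiv_comp z ((hUs k).differentiable one_ne_zero _)
      ((hτ.differentiableOn one_ne_zero).differentiableAt
        (hΩ.mem_nhds (hKΩ (interior_subset hz))))
  · exact IntegrableOn.locallyIntegrableOn ((memLp_one_iff_integrable.1 hum).mono_measure hsub)
  · exact IntegrableOn.locallyIntegrableOn ((memLp_one_iff_integrable.1 hvm).mono_measure hsub)
  · have t := ENNReal.Tendsto.const_mul (a := 1 + ENNReal.ofReal C) t1 (Or.inr (by simp))
    rw [mul_zero] at t
    refine tendsto_of_tendsto_of_tendsto_of_le_of_le tendsto_const_nhds t (fun _ => zero_le)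
      fun k => (eLpNorm_mono_measure _ hsub).trans ?_
    exact eLpNorm_comp_le (g := U k - u) hτm hle
      ((hUs k).continuous.aestronglyMeasurable.sub hu1.1) le_rfl
  · have t := ENNReal.Tendsto.const_mul (a := ENNReal.ofReal D * (1 + ENNReal.ofReal C)) t2
      (Or.inr (ENNReal.mul_ne_top (by simp) (by simp)))
    rw [mul_zero] at t
    refine tendsto_of_tendsto_of_tendsto_of_le_of_le tendsto_const_nhds t (fun _ => zero_le)
      fun k => (eLpNorm_mono_measure _ hsub).trans ?_
    have hb : ∀ᵐ y ∂volume.restrict K,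
        ‖((fun y => (fderiv ℝ (U k) (τ y)).comp (fderiv ℝ τ y)) -
          fun y => (v (τ y)).comp (fderiv ℝ τ y)) y‖ ≤ D * ‖(fderiv ℝ (U k) - v) (τ y)‖ := by
      filter_upwards [ae_restrict_mem hKs.isCompact.measurableSet] with y hy
      simp only [Pi.sub_apply]
      rw [← ContinuousLinearMap.sub_comp]
      refine (ContinuousLinearMap.opNorm_comp_le _ _).trans ?_
      rw [mul_comm]
      exact mul_le_mul_of_nonneg_right (hD y hy) (norm_nonneg _)
    refine (eLpNorm_le_mul_eLpNorm_of_ae_le_mul hb 1).trans ?_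
    rw [mul_assoc]
    gcongr
    exact eLpNorm_comp_le (g := fderiv ℝ (U k) - v) hτm hle
      (((hUs k).continuous_fderiv one_ne_zero).aestronglyMeasurable.sub hv1.1) le_rfl

end ChangeOfVariables

/-! ### Coordinate changes up to the boundary. -/

section Charts

open scoped NNReal

variable {E : Type*} [NormedAddCommGroup E] [InnerProductSpace ℝ E]
    [FiniteDimensional ℝ E] [MeasurableSpace E] [BorelSpace E]
    {G : Type*} [NormedAddCommGroup G] [NormedSpace ℝ G]
    {H : Type*} [TopologicalSpace H] (I : ModelWithCorners ℝ E H)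
    {M : Type*} [TopologicalSpace M] [ChartedSpace H M]

/-- The domain of a coordinate change: the part of the target of the chart around `c` which lies in
the chart around `c'`. -/
def overlap (c c' : M) : Set E :=
  (extChartAt I c).target ∩ (extChartAt I c).symm ⁻¹' (extChartAt I c').source

/-- The coordinate change from the chart around `c` to the chart around `c'`. -/
noncomputable def coordChange (c c' : M) (y : E) : E := extChartAt I c' ((extChartAt I c).symm y)

/-- The derivative of a coordinate change. -/
noncomputable def coordDeriv (c c' : M) : E → E →L[ℝ] E := fderivWithin ℝ (coordChange I c c') (overlap I c c')

variable {I} {c c' : M} {y : E}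

/-- At boundary points an overlap is not open in `E`, but it is open relative to the closed convex
set `range I`. Measurability, unique differentiability and the null boundary of overlaps are all
derived from this. -/
theorem exists_isOpen_overlap (c c' : M) : ∃ W : Set E, IsOpen W ∧ overlap I c c' = range I ∩ W := by
  obtain ⟨W, hW, h⟩ := continuousOn_iff'.1 (continuousOn_extChartAt_symm (I := I) c)
    (extChartAt I c').source (isOpen_extChartAt_source c')
  refine ⟨I.symm ⁻¹' (chartAt H c).target ∩ W,
    ((chartAt H c).open_target.preimage I.continuous_symm).inter hW, ?_⟩
  rw [overlap, inter_comm, h, extChartAt_target]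
  ext y
  simp only [mem_inter_iff]
  tauto

theorem overlap_self (c : M) : overlap I c c = (extChartAt I c).target :=
  inter_eq_left.2 fun _ hy => (extChartAt I c).map_target hy

section RelativelyOpen

variable {W : Set E}

theorem measurableSet_range_inter (hW : IsOpen W) : MeasurableSet (range I ∩ W) :=
  I.isClosed_range.measurableSet.inter hW.measurableSet

/-- The frontier of a convex set is null. This lets weak derivatives, tested only in the interior,
determine everything almost everywhere on the chart. -/
theorem range_inter_ae_eq (hW : IsOpen W) : (range I ∩ W : Set E) =ᵐ[volume] interior (range I ∩ W) := by
  have h0 : volume (frontier (range I)) = 0 := Convex.addHaar_frontier volume I.convex_range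
  have h : ∀ᵐ y : E, y ∉ frontier (range I) := compl_mem_ae_iff.2 h0
  filter_upwards [h] with y hy
  rw [interior_inter, hW.interior_eq]
  refine propext ⟨fun h => ⟨?_, h.2⟩, fun h => ⟨interior_subset h.1, h.2⟩⟩
  by_contra h'
  exact hy ⟨subset_closure h.1, h'⟩

end RelativelyOpen

theorem measurableSet_overlap (c c' : M) : MeasurableSet (overlap I c c') := by
  obtain ⟨W, hW, h⟩ := exists_isOpen_overlap (I := I) c c'
  exact h ▸ measurableSet_range_inter hW

theorem uniqueDiffOn_overlap (c c' : M) : UniqueDiffOn ℝ (overlap I c c') := by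
  obtain ⟨W, hW, h⟩ := exists_isOpen_overlap (I := I) c c'
  exact h ▸ I.uniqueDiffOn.inter hW

theorem overlap_ae_eq (c c' : M) : overlap I c c' =ᵐ[volume] interior (overlap I c c') := by
  obtain ⟨W, hW, h⟩ := exists_isOpen_overlap (I := I) c c'
  exact h ▸ range_inter_ae_eq hW

theorem nhdsWithin_overlap (hy : y ∈ overlap I c c') : 𝓝[overlap I c c'] y = 𝓝[range I] y := by
  obtain ⟨W, hW, h⟩ := exists_isOpen_overlap (I := I) c c'
  rw [h] at hy ⊢
  exact nhdsWithin_inter_of_mem' (mem_nhdsWithin_of_mem_nhds (hW.mem_nhds hy.2))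

theorem overlap_subset_target : overlap I c c' ⊆ (extChartAt I c).target := inter_subset_left

theorem measurableSet_target (c : M) : MeasurableSet (extChartAt I c).target :=
  overlap_self (I := I) c ▸ measurableSet_overlap c c

theorem uniqueDiffOn_target (c : M) : UniqueDiffOn ℝ (extChartAt I c).target :=
  overlap_self (I := I) c ▸ uniqueDiffOn_overlap c c

theorem target_ae_eq (c : M) :
    (extChartAt I c).target =ᵐ[volume] interior (extChartAt I c).target :=
  overlap_self (I := I) c ▸ overlap_ae_eq c c

theorem restrict_interior_target (c : M) :
    (volume.restrict (interior (extChartAt I c).target) : Measure E) =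
      volume.restrict (extChartAt I c).target :=
  (Measure.restrict_congr_set (target_ae_eq c)).symm

theorem mapsTo_coordChange (c c' : M) :
    MapsTo (coordChange I c c') (overlap I c c') (overlap I c' c) := fun y hy =>
  ⟨(extChartAt I c').map_source hy.2, by
    simp only [coordChange, mem_preimage, (extChartAt I c').left_inv hy.2]
    exact (extChartAt I c).map_target hy.1⟩

theorem symm_coordChange (hy : y ∈ overlap I c c') :
    (extChartAt I c').symm (coordChange I c c' y) = (extChartAt I c).symm y :=
  (extChartAt I c').left_inv hy.2

theorem leftInvOn_coordChange (c c' : M) :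
    LeftInvOn (coordChange I c' c) (coordChange I c c') (overlap I c c') := fun y hy => by
  rw [coordChange, symm_coordChange hy, (extChartAt I c).right_inv hy.1]

section Smooth

variable [IsManifold I ∞ M]

theorem contDiffOn_coordChange (c c' : M) :
    ContDiffOn ℝ ∞ (coordChange I c c') (overlap I c c') := by
  have h := contDiffOn_ext_coord_change (I := I) (n := ∞) c' c
  rw [PartialEquiv.trans_source, PartialEquiv.symm_source] at h
  exact h

theorem contDiffOn_coordDeriv (c c' : M) :
    ContDiffOn ℝ ∞ (coordDeriv I c c') (overlap I c c') :=
  (contDiffOn_coordChange c c').fderivWithin (uniqueDiffOn_overlap c c') le_rfl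

theorem coordDeriv_eq_fderiv (hy : y ∈ interior (overlap I c c')) :
    coordDeriv I c c' y = fderiv ℝ (coordChange I c c') y :=
  fderivWithin_of_mem_nhds (mem_interior_iff_mem_nhds.1 hy)

/-- The preimage of a null set is an image under the inverse coordinate change, and maps
differentiable on a set preserve null sets. -/
theorem volume_preimage_coordChange {N : Set E} (hN : volume N = 0) :
    volume (overlap I c c' ∩ coordChange I c c' ⁻¹' N) = 0 := by
  refine measure_mono_null (t := coordChange I c' c '' (N ∩ overlap I c' c)) ?_ ?_
  · rintro y ⟨hy, hyN⟩
    exact ⟨_, ⟨hyN, mapsTo_coordChange c c' hy⟩, leftInvOn_coordChange c c' hy⟩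
  · exact addHaar_image_eq_zero_of_differentiableOn_of_addHaar_eq_zero volume
      (((contDiffOn_coordChange c' c).differentiableOn (by simp)).mono inter_subset_right)
      (measure_mono_null inter_subset_left hN)

theorem ae_coordChange {P : E → Prop} (h : ∀ᵐ z ∂(volume.restrict (overlap I c' c)), P z) :
    ∀ᵐ y ∂(volume.restrict (overlap I c c')), P (coordChange I c c' y) := by
  rw [ae_restrict_iff' (measurableSet_overlap _ _)] at h ⊢
  have := volume_preimage_coordChange (I := I) (c := c) (c' := c') (ae_iff.1 h)
  have h2 : ∀ᵐ y : E, y ∉ overlap I c c' ∩ coordChange I c c' ⁻¹'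
      {a | ¬(a ∈ overlap I c' c → P a)} := compl_mem_ae_iff.2 this
  filter_upwards [h2] with y hy hyo
  by_contra hP
  exact hy ⟨hyo, fun h => hP (h (mapsTo_coordChange c c' hyo))⟩

/-- The interior points of an overlap which correspond to interior points of the other chart. -/
def openOverlap (I : ModelWithCorners ℝ E H) (c c' : M) : Set E :=
  interior (overlap I c c') ∩ coordChange I c c' ⁻¹' interior (overlap I c' c)

theorem isOpen_openOverlap (c c' : M) : IsOpen (openOverlap I c c') :=
  ((contDiffOn_coordChange c c').continuousOn.mono interior_subset).isOpen_inter_preimage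
    isOpen_interior isOpen_interior

theorem openOverlap_subset : openOverlap I c c' ⊆ overlap I c c' :=
  inter_subset_left.trans interior_subset

/-- The points removed are boundary points of the overlap or correspond to boundary points of the
opposite overlap. Both kinds form null sets, so invariance of the boundary is not needed. -/
theorem restrict_openOverlap (c c' : M) :
    (volume.restrict (openOverlap I c c') : Measure E) = volume.restrict (overlap I c c') := by
  refine (Measure.restrict_congr_set ?_).symm
  have h1 : ∀ᵐ z ∂(volume.restrict (overlap I c' c)), z ∈ interior (overlap I c' c) := by
    rw [ae_restrict_iff' (measurableSet_overlap _ _)]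
    filter_upwards [overlap_ae_eq (I := I) c' c] with z hz h
    exact hz.mp h
  have h2 := ae_coordChange h1
  rw [ae_restrict_iff' (measurableSet_overlap _ _)] at h2
  filter_upwards [h2, overlap_ae_eq (I := I) c c'] with y hy hy'
  exact propext ⟨fun h => ⟨hy'.mp h, hy h⟩, fun h => openOverlap_subset h⟩

theorem openOverlap_subset_interior (c c' : M) :
    openOverlap I c c' ⊆ interior (extChartAt I c).target :=
  inter_subset_left.trans (interior_mono overlap_subset_target)

/-- Coordinate changes of frames. -/
theorem chartFrame_coordChange (hy : y ∈ overlap I c c') :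
    (chartFrame I c y : E →L[ℝ] E) =
      (chartFrame I c' (coordChange I c c' y) : E →L[ℝ] E).comp (coordDeriv I c c' y) := by
  have h1 : HasMFDerivWithinAt 𝓘(ℝ, E) I (extChartAt I c').symm (overlap I c' c)
      (coordChange I c c' y) (chartFrame I c' (coordChange I c c' y)) :=
    (mdifferentiableWithinAt_extChartAt_symm (mapsTo_coordChange c c' hy).1).hasMFDerivWithinAt.mono
      (overlap_subset_target.trans (extChartAt_target_subset_range c'))
  have h2 : HasMFDerivWithinAt 𝓘(ℝ, E) 𝓘(ℝ, E) (coordChange I c c') (overlap I c c') y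
      (coordDeriv (E := E) I c c' y) :=
    (((contDiffOn_coordChange c c').differentiableOn (by simp)) y hy).hasFDerivWithinAt.hasMFDerivWithinAt
  have h3 : HasMFDerivWithinAt 𝓘(ℝ, E) I (extChartAt I c).symm (overlap I c c') y
      (chartFrame I c y) :=
    (mdifferentiableWithinAt_extChartAt_symm hy.1).hasMFDerivWithinAt.mono
      (overlap_subset_target.trans (extChartAt_target_subset_range c))
  have h4 := (h1.comp y h2 (mapsTo_coordChange c c')).congr_of_eventuallyEq
    (f₁ := (extChartAt I c).symm) (by
      filter_upwards [self_mem_nhdsWithin] with z hz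
      exact (symm_coordChange hz).symm) (symm_coordChange hy).symm
  have hu : UniqueMDiffWithinAt 𝓘(ℝ, E) (overlap I c c') y :=
    (uniqueDiffOn_overlap c c' y hy).uniqueMDiffWithinAt
  exact hu.eq h3 h4

theorem isInvertible_chartFrame (hy : y ∈ (extChartAt I c).target) :
    (chartFrame I c y).IsInvertible :=
  isInvertible_mfderivWithin_extChartAt_symm hy

theorem chartForm_coordChange (σ : ∀ x : M, TangentSpace I x →L[ℝ] G) (hy : y ∈ overlap I c c') :
    chartForm I σ c y = (chartForm I σ c' (coordChange I c c' y)).comp (coordDeriv I c c' y) := by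
  -- The base point is written in two ways. All tangent spaces are `E`, so the two values of `σ` are
  -- compared as operators on `E`, which avoids transport between fibres.
  have key : ∀ x : M, x = (extChartAt I c).symm y →
      (σ x : E →L[ℝ] G) = (σ ((extChartAt I c).symm y) : E →L[ℝ] G) := by
    rintro x rfl; rfl
  have h := key _ (symm_coordChange hy)
  ext w
  have hf := DFunLike.congr_fun (chartFrame_coordChange hy) w
  have h' := DFunLike.congr_fun h
    ((chartFrame I c' (coordChange I c c' y) : E →L[ℝ] E) (coordDeriv I c c' y w))
  have hf' : (σ ((extChartAt I c).symm y) : E →L[ℝ] G) ((chartFrame I c y : E →L[ℝ] E) w) =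
    (σ ((extChartAt I c).symm y) : E →L[ℝ] G) ((chartFrame I c' (coordChange I c c' y) : E →L[ℝ] E)
      (coordDeriv I c c' y w)) := congrArg _ hf
  exact hf'.trans h'.symm

theorem chartBilin_coordChange {F : Type*} [NormedAddCommGroup F] [InnerProductSpace ℝ F]
    (S : ∀ x : M, TangentSpace I x →L[ℝ] TangentSpace I x →L[ℝ] F) (hy : y ∈ overlap I c c')
    (w w' : E) :
    chartBilin I S c y w w' = chartBilin I S c' (coordChange I c c' y) (coordDeriv I c c' y w)
      (coordDeriv I c c' y w') := by
  have key : ∀ x : M, x = (extChartAt I c).symm y →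
      (S x : E →L[ℝ] E →L[ℝ] F) = (S ((extChartAt I c).symm y) : E →L[ℝ] E →L[ℝ] F) := by
    rintro x rfl; rfl
  have h := key _ (symm_coordChange hy)
  have hf := DFunLike.congr_fun (chartFrame_coordChange hy)
  have h' := DFunLike.congr_fun (DFunLike.congr_fun h
    ((chartFrame I c' (coordChange I c c' y) : E →L[ℝ] E) (coordDeriv I c c' y w)))
    ((chartFrame I c' (coordChange I c c' y) : E →L[ℝ] E) (coordDeriv I c c' y w'))
  have hf' : (S ((extChartAt I c).symm y) : E →L[ℝ] E →L[ℝ] F) ((chartFrame I c y : E →L[ℝ] E) w)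
      ((chartFrame I c y : E →L[ℝ] E) w') =
    (S ((extChartAt I c).symm y) : E →L[ℝ] E →L[ℝ] F)
      ((chartFrame I c' (coordChange I c c' y) : E →L[ℝ] E) (coordDeriv I c c' y w))
      ((chartFrame I c' (coordChange I c c' y) : E →L[ℝ] E) (coordDeriv I c c' y w')) :=
    congrArg₂ (fun a b => (S ((extChartAt I c).symm y) : E →L[ℝ] E →L[ℝ] F) a b) (hf w) (hf w')
  exact hf'.trans h'.symm

/-- Around each point of a chart there is a convex body inside the chart which is a neighbourhood
of the point relative to the model. -/
theorem exists_isSolidConvex_subset {V : Set E} (hV : V ∈ 𝓝[range I] y) (hy : y ∈ range I) :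
    ∃ K : Set E, IsSolidConvex K ∧ y ∈ K ∧ K ⊆ V ∧ K ⊆ range I ∧ K ∈ 𝓝[range I] y := by
  obtain ⟨ε, hε, h⟩ := Metric.mem_nhdsWithin_iff.1 hV
  refine ⟨Metric.closedBall y (ε / 2) ∩ range I, ⟨(isCompact_closedBall _ _).inter_right
    I.isClosed_range, (convex_closedBall _ _).inter I.convex_range, ?_⟩,
    ⟨Metric.mem_closedBall_self (half_pos hε).le, hy⟩, ?_, inter_subset_right, ?_⟩
  · rw [interior_inter]
    have := mem_closure_iff.1 (I.range_subset_closure_interior hy) (Metric.ball y (ε / 2))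
      Metric.isOpen_ball (Metric.mem_ball_self (half_pos hε))
    exact this.mono (inter_subset_inter_left _ Metric.ball_subset_interior_closedBall)
  · exact fun z hz => h ⟨Metric.closedBall_subset_ball (half_lt_self hε) hz.1, hz.2⟩
  · exact inter_mem (mem_nhdsWithin_of_mem_nhds (Metric.closedBall_mem_nhds _ (half_pos hε)))
      self_mem_nhdsWithin

end Smooth

end Charts

/-! ### Weak derivatives of pulled back one-forms. -/

section FormPullback

variable {E : Type*} [NormedAddCommGroup E] [InnerProductSpace ℝ E]
    [FiniteDimensional ℝ E] [MeasurableSpace E] [BorelSpace E]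
    {G : Type*} [NormedAddCommGroup G] [NormedSpace ℝ G]

/-- The derivative of `y ↦ v (τ y) ∘ A y`, where `a = v (τ y)`, `d` is the derivative of `v ∘ τ`,
and `B` is the derivative of `A`. -/
noncomputable def pullbackDeriv (a : E →L[ℝ] G) (d : E →L[ℝ] E →L[ℝ] G) (A : E →L[ℝ] E)
    (B : E →L[ℝ] E →L[ℝ] E) : E →L[ℝ] E →L[ℝ] G :=
  (ContinuousLinearMap.compL ℝ E E G).precompR E a B +
    (ContinuousLinearMap.compL ℝ E E G).precompL E (d.comp A) A

theorem pullbackDeriv_apply (a : E →L[ℝ] G) (d : E →L[ℝ] E →L[ℝ] G) (A : E →L[ℝ] E)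
    (B : E →L[ℝ] E →L[ℝ] E) (w w' : E) :
    pullbackDeriv a d A B w w' = a (B w w') + d (A w) (A w') := by
  simp [pullbackDeriv]

theorem norm_pullbackDeriv_le (a : E →L[ℝ] G) (d : E →L[ℝ] E →L[ℝ] G) (A : E →L[ℝ] E)
    (B : E →L[ℝ] E →L[ℝ] E) :
    ‖pullbackDeriv a d A B‖ ≤ ‖B‖ * ‖a‖ + ‖A‖ ^ 2 * ‖d‖ := by
  refine ContinuousLinearMap.opNorm_le_bound₂ _ (by positivity) fun w w' => ?_
  rw [pullbackDeriv_apply]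
  calc ‖a (B w w') + d (A w) (A w')‖ ≤ ‖a (B w w')‖ + ‖d (A w) (A w')‖ := norm_add_le _ _
    _ ≤ ‖a‖ * (‖B‖ * ‖w‖ * ‖w'‖) + ‖d‖ * (‖A‖ * ‖w‖) * (‖A‖ * ‖w'‖) := by
        gcongr
        · exact a.le_opNorm_of_le (B.le_opNorm₂ w w')
        · refine (d.le_opNorm₂ _ _).trans ?_
          gcongr <;> exact A.le_opNorm _
    _ = _ := by ring

/-- On small balls this is the product rule for `v ∘ τ`, of class `W^{1,1}`, and the continuously
differentiable factor `Dτ`, with exponent `∞` for the latter; hence `τ` has to be `C²`. -/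
theorem HasWeakFDerivOn.comp_diffeo_form [CompleteSpace G] {τ σ : E → E} {Ω Ω' : Set E}
    (hΩ : IsOpen Ω) (hΩ' : IsOpen Ω') (hτ : ContDiffOn ℝ 2 τ Ω) (hσ : ContDiffOn ℝ 1 σ Ω')
    (hmaps : MapsTo τ Ω Ω') (hinv : LeftInvOn σ τ Ω) {v : E → E →L[ℝ] G}
    {D : E → E →L[ℝ] E →L[ℝ] G} (h : HasWeakFDerivOn Ω' v D) :
    HasWeakFDerivOn Ω (fun y => (v (τ y)).comp (fderiv ℝ τ y))
      (fun y => pullbackDeriv (v (τ y)) (D (τ y)) (fderiv ℝ τ y) (fderiv ℝ (fderiv ℝ τ) y)) := by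
  have h1 := h.comp_diffeo hΩ hΩ' (hτ.of_le one_le_two) hσ hmaps hinv
  have hd : ContDiffOn ℝ 1 (fderiv ℝ τ) Ω := hτ.fderiv_of_isOpen hΩ (by norm_num)
  have h2 := HasWeakFDerivOn.of_contDiffOn hΩ hd
  refine of_forall_exists fun y hy => ?_
  obtain ⟨ε, hε, hK⟩ := Metric.nhds_basis_closedBall.mem_iff.1 (hΩ.mem_nhds hy)
  have hKs := isSolidConvex_closedBall y hε
  refine ⟨interior (Metric.closedBall y ε), isOpen_interior,
    Metric.ball_subset_interior_closedBall (Metric.mem_ball_self hε), ?_⟩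
  exact IsSolidConvex.hasWeakFDerivOn_bilin (p := ⊤) (ContinuousLinearMap.compL ℝ E E G) hKs le_top
    (by simp) (h1.mono (interior_subset.trans hK)) (h2.mono (interior_subset.trans hK))
    (memLp_one_iff_integrable.2 (h1.1.integrableOn_compact_subset hK hKs.isCompact))
    (memLp_one_iff_integrable.2 (h1.2.1.integrableOn_compact_subset hK hKs.isCompact))
    (memLp_restrict_of_continuousOn hKs.isCompact (hd.continuousOn.mono hK) _)
    (memLp_restrict_of_continuousOn hKs.isCompact
      ((hd.continuousOn_fderiv_of_isOpen hΩ le_rfl).mono hK) _)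

end FormPullback

/-! ### Transformation of first and second weak derivatives between charts. -/

section Transition

variable {E : Type*} [NormedAddCommGroup E] [InnerProductSpace ℝ E]
    [FiniteDimensional ℝ E] [MeasurableSpace E] [BorelSpace E]
    {G : Type*} [NormedAddCommGroup G] [NormedSpace ℝ G] [CompleteSpace G]
    {H : Type*} [TopologicalSpace H] {I : ModelWithCorners ℝ E H}
    {M : Type*} [TopologicalSpace M] [ChartedSpace H M] [IsManifold I ∞ M] {c c' : M}

/-- The second derivative of a coordinate change. -/
noncomputable def coordDeriv₂ (I : ModelWithCorners ℝ E H) (c c' : M) : E → E →L[ℝ] E →L[ℝ] E :=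
  fderivWithin ℝ (coordDeriv I c c') (overlap I c c')

theorem continuousOn_coordDeriv (c c' : M) : ContinuousOn (coordDeriv I c c') (overlap I c c') :=
  (contDiffOn_coordDeriv c c').continuousOn

theorem continuousOn_coordDeriv₂ (c c' : M) :
    ContinuousOn (coordDeriv₂ I c c') (overlap I c c') :=
  (contDiffOn_coordDeriv c c').continuousOn_fderivWithin (uniqueDiffOn_overlap c c') (by simp)

theorem coordDeriv_eq_fderiv_of_mem {y : E} (hy : y ∈ openOverlap I c c') :
    coordDeriv I c c' y = fderiv ℝ (coordChange I c c') y := coordDeriv_eq_fderiv hy.1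

theorem coordDeriv₂_eq_fderiv {y : E} (hy : y ∈ openOverlap I c c') :
    coordDeriv₂ I c c' y = fderiv ℝ (fderiv ℝ (coordChange I c c')) y := by
  have h : coordDeriv₂ I c c' y = fderiv ℝ (coordDeriv I c c') y :=
    fderivWithin_of_mem_nhds (mem_interior_iff_mem_nhds.1 hy.1)
  rw [h]
  refine Filter.EventuallyEq.fderiv_eq ?_
  filter_upwards [(isOpen_openOverlap c c').mem_nhds hy] with z hz
  exact coordDeriv_eq_fderiv_of_mem hz

/-- On the open overlap both sides are weak derivatives of the same function, hence agree almost
everywhere. -/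
theorem weakFDeriv_coordChange {u : M → G} {v v' : E → E →L[ℝ] G}
    (h : HasWeakFDerivOn (interior (extChartAt I c).target)
      (fun y => u ((extChartAt I c).symm y)) v)
    (h' : HasWeakFDerivOn (interior (extChartAt I c').target)
      (fun y => u ((extChartAt I c').symm y)) v') :
    ∀ᵐ y ∂(volume.restrict (overlap I c c')),
      v y = (v' (coordChange I c c' y)).comp (coordDeriv I c c' y) := by
  rw [← restrict_openOverlap]
  have ho := isOpen_openOverlap (I := I) c c'
  have h1 := HasWeakFDerivOn.comp_diffeo (σ := coordChange I c' c) ho isOpen_interior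
    (((contDiffOn_coordChange c c').of_le (by simp)).mono openOverlap_subset)
    (((contDiffOn_coordChange c' c).of_le (by simp)).mono interior_subset)
    (fun y hy => hy.2) ((leftInvOn_coordChange c c').mono openOverlap_subset)
    (h'.mono (interior_mono overlap_subset_target))
  have h2 := (h.mono (openOverlap_subset_interior c c')).congr ho.measurableSet
    (u' := fun y => u ((extChartAt I c').symm (coordChange I c c' y))) (v' := v)
    (by
      filter_upwards [ae_restrict_mem ho.measurableSet] with y hy
      rw [symm_coordChange (openOverlap_subset hy)]) (EventuallyEq.refl _ _)
  filter_upwards [h2.ae_eq ho h1, ae_restrict_mem ho.measurableSet] with y hy hyo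
  rw [hy, coordDeriv_eq_fderiv_of_mem hyo]

/-- Again by uniqueness. Second derivatives are not tensorial: the term with `coordDeriv₂` brings in
first derivatives, so later bounds must treat the jet as a whole. -/
theorem weakFDeriv_chartForm_coordChange {σ : ∀ x : M, TangentSpace I x →L[ℝ] G}
    {D D' : E → E →L[ℝ] E →L[ℝ] G}
    (h : HasWeakFDerivOn (interior (extChartAt I c).target) (chartForm I σ c) D)
    (h' : HasWeakFDerivOn (interior (extChartAt I c').target) (chartForm I σ c') D') :
    ∀ᵐ y ∂(volume.restrict (overlap I c c')),
      D y = pullbackDeriv (chartForm I σ c' (coordChange I c c' y)) (D' (coordChange I c c' y))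
        (coordDeriv I c c' y) (coordDeriv₂ I c c' y) := by
  rw [← restrict_openOverlap]
  have ho := isOpen_openOverlap (I := I) c c'
  have h1 := HasWeakFDerivOn.comp_diffeo_form (σ := coordChange I c' c) ho isOpen_interior
    (((contDiffOn_coordChange c c').of_le (by norm_cast)).mono openOverlap_subset)
    (((contDiffOn_coordChange c' c).of_le (by simp)).mono interior_subset)
    (fun y hy => hy.2) ((leftInvOn_coordChange c c').mono openOverlap_subset)
    (h'.mono (interior_mono overlap_subset_target))
  have h2 := (h.mono (openOverlap_subset_interior c c')).congr ho.measurableSet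
    (u' := fun y => (chartForm I σ c' (coordChange I c c' y)).comp
      (fderiv ℝ (coordChange I c c') y)) (v' := D)
    (by
      filter_upwards [ae_restrict_mem ho.measurableSet] with y hy
      rw [chartForm_coordChange σ (openOverlap_subset hy), coordDeriv_eq_fderiv_of_mem hy])
    (EventuallyEq.refl _ _)
  filter_upwards [h2.ae_eq ho h1, ae_restrict_mem ho.measurableSet] with y hy hyo
  rw [hy, coordDeriv_eq_fderiv_of_mem hyo, coordDeriv₂_eq_fderiv hyo]

end Transition

/-! ### Passing from the pieces of a cover to all charts. -/

section Cover

open scoped NNReal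

variable {E : Type*} [NormedAddCommGroup E] [InnerProductSpace ℝ E]
    [FiniteDimensional ℝ E] [MeasurableSpace E] [BorelSpace E]
    {F : Type*} [NormedAddCommGroup F] [InnerProductSpace ℝ F]
    {G : Type*} [NormedAddCommGroup G] [NormedSpace ℝ G]
    {H : Type*} [TopologicalSpace H] {I : ModelWithCorners ℝ E H}
    {M : Type*} [TopologicalSpace M] [ChartedSpace H M] {c c' : M}

open Classical in
/-- The index of the first piece of the cover which contains the point `x`. -/
noncomputable def ChartCover.index (𝒰 : ChartCover I M) (x : M) : Fin 𝒰.size :=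
  Fin.find (fun i => x ∈ (extChartAt I (𝒰.center i)).source ∧
    extChartAt I (𝒰.center i) x ∈ 𝒰.piece i) (𝒰.covers x)

theorem ChartCover.index_spec (𝒰 : ChartCover I M) (x : M) :
    x ∈ (extChartAt I (𝒰.center (𝒰.index x))).source ∧
      extChartAt I (𝒰.center (𝒰.index x)) x ∈ 𝒰.piece (𝒰.index x) := by
  classical
  exact Fin.find_spec (𝒰.covers x)

theorem ChartCover.index_eq_iff (𝒰 : ChartCover I M) (x : M) (j : Fin 𝒰.size) :
    𝒰.index x = j ↔ (x ∈ (extChartAt I (𝒰.center j)).source ∧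
      extChartAt I (𝒰.center j) x ∈ 𝒰.piece j) ∧ ∀ k < j,
      ¬ (x ∈ (extChartAt I (𝒰.center k)).source ∧ extChartAt I (𝒰.center k) x ∈ 𝒰.piece k) := by
  classical
  exact Fin.find_eq_iff (𝒰.covers x)

/-- The part of the set `K` in the chart around `c` which lies in the `j`-th piece of the cover. -/
def ChartCover.trace (𝒰 : ChartCover I M) (c : M) (K : Set E) (j : Fin 𝒰.size) : Set E :=
  {y ∈ K | (extChartAt I c).symm y ∈ (extChartAt I (𝒰.center j)).source ∧
    coordChange I c (𝒰.center j) y ∈ 𝒰.piece j}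

/-- The image of a piece in `M` is compact, hence closed because `M` is Hausdorff, and so the trace
is closed in `K`. -/
theorem ChartCover.isCompact_trace [T2Space M] (𝒰 : ChartCover I M) {K : Set E} (hK : IsCompact K)
    (hKc : K ⊆ (extChartAt I c).target) (j : Fin 𝒰.size) : IsCompact (𝒰.trace c K j) := by
  have h : 𝒰.trace c K j = K ∩ (extChartAt I c).symm ⁻¹'
      ((extChartAt I (𝒰.center j)).symm '' 𝒰.piece j) := by
    ext y
    constructor
    · rintro ⟨hy, h1, h2⟩
      exact ⟨hy, _, h2, (extChartAt I (𝒰.center j)).left_inv h1⟩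
    · rintro ⟨hy, z, hz, hzy⟩
      have hz' := 𝒰.piece_subset j hz
      have h1 : (extChartAt I c).symm y ∈ (extChartAt I (𝒰.center j)).source := by
        rw [← hzy]; exact (extChartAt I (𝒰.center j)).map_target hz'
      refine ⟨hy, h1, ?_⟩
      rw [coordChange, ← hzy, (extChartAt I (𝒰.center j)).right_inv hz']
      exact hz
  rw [h]
  have hcl : IsClosed ((extChartAt I (𝒰.center j)).symm '' 𝒰.piece j) :=
    ((𝒰.isCompact_piece j).image_of_continuousOn
      ((continuousOn_extChartAt_symm (𝒰.center j)).mono (𝒰.piece_subset j))).isClosed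
  exact hK.of_isClosed_subset
    (((continuousOn_extChartAt_symm c).mono hKc).preimage_isClosed_of_isClosed hK.isClosed hcl)
    inter_subset_left

theorem ChartCover.trace_subset_overlap (𝒰 : ChartCover I M) {K : Set E}
    (hKc : K ⊆ (extChartAt I c).target) (j : Fin 𝒰.size) :
    𝒰.trace c K j ⊆ overlap I c (𝒰.center j) := fun _ hy => ⟨hKc hy.1, hy.2.1⟩

theorem ChartCover.mapsTo_trace (𝒰 : ChartCover I M) (c : M) (K : Set E) (j : Fin 𝒰.size) :
    MapsTo (coordChange I c (𝒰.center j)) (𝒰.trace c K j) (𝒰.piece j) := fun _ hy => hy.2.2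

theorem ChartCover.mem_trace_index (𝒰 : ChartCover I M) {K : Set E} {y : E} (hy : y ∈ K) :
    y ∈ 𝒰.trace c K (𝒰.index ((extChartAt I c).symm y)) :=
  ⟨hy, 𝒰.index_spec _⟩

theorem ChartCover.iUnion_trace (𝒰 : ChartCover I M) (c : M) (K : Set E) :
    ⋃ j, 𝒰.trace c K j = K :=
  Subset.antisymm (iUnion_subset fun _ _ hy => hy.1) fun _ hy =>
    mem_iUnion.2 ⟨_, 𝒰.mem_trace_index hy⟩

theorem eLpNorm_restrict_le_sum {X : Type*} [NormedAddCommGroup X] {n : ℕ} {A : Fin n → Set E}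
    {K : Set E} (hA : ∀ j, MeasurableSet (A j)) (hK : K ⊆ ⋃ j, A j) {g : E → X} {q : ℝ≥0∞}
    (hq : 1 ≤ q) (hg : ∀ j, AEStronglyMeasurable g (volume.restrict (A j))) :
    eLpNorm g q (volume.restrict K) ≤ ∑ j, eLpNorm g q (volume.restrict (A j)) := by
  have hm : AEStronglyMeasurable g (volume.restrict (⋃ j, A j)) :=
    aestronglyMeasurable_iUnion_iff.2 hg
  have hi : ∀ j ∈ Finset.univ, AEStronglyMeasurable ((A j).indicator fun y => ‖g y‖)
      (volume.restrict (⋃ j, A j)) := fun j _ => hm.norm.indicator (hA j)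
  refine (eLpNorm_mono_measure g (Measure.restrict_mono hK le_rfl)).trans ?_
  calc eLpNorm g q (volume.restrict (⋃ j, A j))
      ≤ eLpNorm (∑ j, (A j).indicator fun y => ‖g y‖) q (volume.restrict (⋃ j, A j)) := by
        refine eLpNorm_mono_ae_real ?_
        filter_upwards [ae_restrict_mem (MeasurableSet.iUnion hA)] with y hy
        obtain ⟨j, hj⟩ := mem_iUnion.1 hy
        rw [Finset.sum_apply]
        refine le_trans ?_ (Finset.single_le_sum (f := fun j => (A j).indicator (fun y => ‖g y‖) y)
          (fun k _ => indicator_nonneg (fun _ _ => norm_nonneg _) _) (Finset.mem_univ j))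
        simp [indicator_of_mem hj]
    _ ≤ ∑ j, eLpNorm ((A j).indicator fun y => ‖g y‖) q (volume.restrict (⋃ j, A j)) :=
        eLpNorm_sum_le hi hq
    _ ≤ ∑ j, eLpNorm g q (volume.restrict (A j)) := by
        refine Finset.sum_le_sum fun j _ => ?_
        rw [eLpNorm_indicator_eq_eLpNorm_restrict (hA j), eLpNorm_norm]
        exact eLpNorm_mono_measure g (Measure.restrict_mono le_rfl Measure.restrict_le_self)

variable [IsManifold I ∞ M]

theorem aemeasurable_coordChange {A : Set E} (hA : MeasurableSet A) (hAo : A ⊆ overlap I c c') :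
    AEMeasurable (coordChange I c c') (volume.restrict A) :=
  ((contDiffOn_coordChange c c').continuousOn.mono hAo).aemeasurable hA

/-- The Jacobian of the inverse coordinate change is continuous, hence bounded on the compact image
of `A`. -/
theorem exists_map_coordChange_le {A L : Set E} (hA : IsCompact A) (hAo : A ⊆ overlap I c c')
    (hL : MapsTo (coordChange I c c') A L) :
    ∃ C : ℝ≥0, Measure.map (coordChange I c c') (volume.restrict A) ≤
      (C : ℝ≥0∞) • volume.restrict L := by
  have hc := (contDiffOn_coordChange (I := I) c c').continuousOn.mono hAo
  have him : coordChange I c c' '' A ⊆ overlap I c' c :=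
    image_subset_iff.2 fun y hy => mapsTo_coordChange c c' (hAo hy)
  have hdet : ContinuousOn (fun z => |(coordDeriv I c' c z).det|) (coordChange I c c' '' A) :=
    (ContinuousLinearMap.continuous_det.comp_continuousOn
      ((continuousOn_coordDeriv c' c).mono him)).abs
  obtain ⟨C, hC⟩ := (hA.image_of_continuousOn hc).exists_bound_of_continuousOn hdet
  exact ⟨C.toNNReal, map_restrict_le_smul hA hc hL ((leftInvOn_coordChange c c').mono hAo)
    (fun z hz => (((contDiffOn_coordChange c' c).differentiableOn (by simp)) z
      (him hz)).hasFDerivWithinAt.mono him) (fun z hz => by simpa [coordDeriv] using hC z hz)⟩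

/-- A property which holds almost everywhere on the pieces of a cover holds almost everywhere. -/
theorem chartAE_of_piece (𝒰 : ChartCover I M) {Q : M → Prop}
    (h : ∀ i, ∀ᵐ y ∂(volume.restrict (𝒰.piece i)), Q ((extChartAt I (𝒰.center i)).symm y)) :
    ChartAE I Q := by
  intro c
  have h1 : ∀ i, ∀ᵐ y ∂(volume.restrict (extChartAt I c).target), y ∈ overlap I c (𝒰.center i) →
      coordChange I c (𝒰.center i) y ∈ 𝒰.piece i → Q ((extChartAt I c).symm y) := by
    intro i
    have h2 : ∀ᵐ z ∂(volume.restrict (overlap I (𝒰.center i) c)), z ∈ 𝒰.piece i →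
        Q ((extChartAt I (𝒰.center i)).symm z) :=
      ae_restrict_of_ae ((ae_restrict_iff' (𝒰.isCompact_piece i).measurableSet).1 (h i))
    have h3 := ae_coordChange h2
    rw [ae_restrict_iff' (measurableSet_overlap _ _)] at h3
    refine ae_restrict_of_ae ?_
    filter_upwards [h3] with y hy hyo hyp
    rw [← symm_coordChange hyo]
    exact hy hyo hyp
  filter_upwards [ae_all_iff.2 h1, ae_restrict_mem (measurableSet_target c)] with y hy hyc
  have hs := 𝒰.index_spec ((extChartAt I c).symm y)
  exact hy _ ⟨hyc, hs.1⟩ hs.2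

theorem chartAE_iff_interior {Q : M → Prop} : ChartAE I Q ↔
    ∀ c : M, ∀ᵐ y ∂(volume.restrict (interior (extChartAt I c).target)),
      Q ((extChartAt I c).symm y) := by
  simp only [restrict_interior_target]; rfl

theorem ChartAE.mono {Q Q' : M → Prop} (h : ChartAE I Q) (h' : ∀ x, Q x → Q' x) :
    ChartAE I Q' := fun c => (h c).mono fun _ => h' _

theorem ChartAE.and {Q Q' : M → Prop} (h : ChartAE I Q) (h' : ChartAE I Q') :
    ChartAE I fun x => Q x ∧ Q' x := fun c => (h c).and (h' c)

theorem chartForm_injective {y : E} (hy : y ∈ (extChartAt I c).target)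
    {σ σ' : ∀ x : M, TangentSpace I x →L[ℝ] G} (h : chartForm I σ c y = chartForm I σ' c y) :
    σ ((extChartAt I c).symm y) = σ' ((extChartAt I c).symm y) := by
  obtain ⟨e, he⟩ := isInvertible_chartFrame hy
  ext w
  have := DFunLike.congr_fun h (e.symm w)
  simp only [chartForm, ← he] at this
  change σ _ (e (e.symm w)) = σ' _ (e (e.symm w)) at this
  rwa [e.apply_symm_apply] at this

/-- Weak differentials are unique up to null sets. -/
theorem HasWeakDifferential.chartAE_eq [CompleteSpace G] {u u' : M → G}
    {σ σ' : ∀ x : M, TangentSpace I x →L[ℝ] G} (h : HasWeakDifferential I u σ)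
    (h' : HasWeakDifferential I u' σ') (hu : ChartAE I fun x => u x = u' x) :
    ChartAE I fun x => σ x = σ' x := by
  rw [chartAE_iff_interior] at hu ⊢
  intro c
  have h1 := (h c).congr isOpen_interior.measurableSet (hu c) (EventuallyEq.refl _ _)
  filter_upwards [h1.ae_eq isOpen_interior (h' c), ae_restrict_mem isOpen_interior.measurableSet]
    with y hy hyc
  exact chartForm_injective (interior_subset hyc) hy

/-- Weak derivatives in the charts come from a weak differential. -/
theorem exists_hasWeakDifferential [CompleteSpace G] (𝒰 : ChartCover I M) {u : M → G}
    {v : M → E → E →L[ℝ] G}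
    (h : ∀ c, HasWeakFDerivOn (interior (extChartAt I c).target)
      (fun y => u ((extChartAt I c).symm y)) (v c)) :
    ∃ σ : ∀ x : M, TangentSpace I x →L[ℝ] G, HasWeakDifferential I u σ ∧
      ∀ c, chartForm I σ c =ᵐ[volume.restrict (extChartAt I c).target] v c := by
  -- At `x` the derivative in the chart of the first piece containing `x` is taken and transported
  -- to the tangent space by the inverse frame. By the transformation rule the result agrees, almost
  -- everywhere in each chart, with the given derivative.
  let z : M → E := fun x => extChartAt I (𝒰.center (𝒰.index x)) x
  let σ : ∀ x : M, TangentSpace I x →L[ℝ] G := fun x =>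
    (v (𝒰.center (𝒰.index x)) (z x)).comp
      (chartFrame I (𝒰.center (𝒰.index x)) (z x) : E →L[ℝ] E).inverse
  have key : ∀ c, chartForm I σ c =ᵐ[volume.restrict (extChartAt I c).target] v c := by
    intro c
    have h1 : ∀ i, ∀ᵐ y ∂(volume.restrict (extChartAt I c).target), y ∈ overlap I c (𝒰.center i) →
        v c y = (v (𝒰.center i) (coordChange I c (𝒰.center i) y)).comp
          (coordDeriv I c (𝒰.center i) y) := fun i =>
      ae_restrict_of_ae ((ae_restrict_iff' (measurableSet_overlap _ _)).1
        (weakFDeriv_coordChange (h c) (h (𝒰.center i))))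
    filter_upwards [ae_all_iff.2 h1, ae_restrict_mem (measurableSet_target c)] with y hy hyc
    have hs := 𝒰.index_spec ((extChartAt I c).symm y)
    have ho : y ∈ overlap I c (𝒰.center (𝒰.index ((extChartAt I c).symm y))) := ⟨hyc, hs.1⟩
    rw [hy _ ho]
    obtain ⟨e, he⟩ := isInvertible_chartFrame (mapsTo_coordChange _ _ ho).1
    have hfr := chartFrame_coordChange ho
    ext w
    have hw := DFunLike.congr_fun hfr w
    have hinv : (chartFrame I (𝒰.center (𝒰.index ((extChartAt I c).symm y)))
        (z ((extChartAt I c).symm y)) : E →L[ℝ] E).inverse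
        ((chartFrame I c y : E →L[ℝ] E) w) =
        coordDeriv I c (𝒰.center (𝒰.index ((extChartAt I c).symm y))) y w := by
      rw [hw]
      exact (ContinuousLinearMap.IsInvertible.inverse_apply_eq ⟨e, he⟩).2 rfl
    exact congrArg (v (𝒰.center (𝒰.index ((extChartAt I c).symm y)))
      (z ((extChartAt I c).symm y))) hinv
  refine ⟨σ, fun c => ?_, key⟩
  refine (h c).congr isOpen_interior.measurableSet (EventuallyEq.refl _ _) ?_
  rw [restrict_interior_target]
  exact (key c).symm

end Cover

/-! ### Norms of 2-jets in arbitrary charts. -/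

section Jets

open scoped NNReal

variable {E : Type*} [NormedAddCommGroup E] [InnerProductSpace ℝ E]
    [FiniteDimensional ℝ E] [MeasurableSpace E] [BorelSpace E]
    {F : Type*} [NormedAddCommGroup F] [InnerProductSpace ℝ F] [FiniteDimensional ℝ F]
    {H : Type*} [TopologicalSpace H] {I : ModelWithCorners ℝ E H}
    {M : Type*} [TopologicalSpace M] [ChartedSpace H M] {c c' : M}
    {𝒰 : ChartCover I M} {r : ℝ≥0∞} {t : LocalJets 𝒰 r F} {u u' : M → F}
    {du du' : ∀ x : M, TangentSpace I x →L[ℝ] F} {ddu ddu' : M → E → E →L[ℝ] E →L[ℝ] F}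

/-- `u` has the weak differential `du` and the second weak derivatives `ddu` in charts. -/
structure HasWeakJet (I : ModelWithCorners ℝ E H) (u : M → F)
    (du : ∀ x : M, TangentSpace I x →L[ℝ] F) (ddu : M → E → E →L[ℝ] E →L[ℝ] F) : Prop where
  hasWeakDifferential : HasWeakDifferential I u du
  hasWeakFDerivOn : ∀ c : M,
    HasWeakFDerivOn (interior (extChartAt I c).target) (chartForm I du c) (ddu c)

/-- The local jets `t` are those of `u`, with weak derivatives `du` and `ddu`. -/
structure HasLocalJets (t : LocalJets 𝒰 r F) (u : M → F)
    (du : ∀ x : M, TangentSpace I x →L[ℝ] F) (ddu : M → E → E →L[ℝ] E →L[ℝ] F) : Prop extends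
    HasWeakJet I u du ddu where
  ae_eq : ∀ i, t.1 i =ᵐ[volume.restrict (𝒰.piece i)]
        (fun y => u ((extChartAt I (𝒰.center i)).symm y)) ∧
      t.2.1 i =ᵐ[volume.restrict (𝒰.piece i)] chartForm I du (𝒰.center i) ∧
      t.2.2 i =ᵐ[volume.restrict (𝒰.piece i)] ddu (𝒰.center i)

theorem isWeakJetOf_iff : IsWeakJetOf t u ↔ ∃ du ddu, HasLocalJets t u du ddu :=
  ⟨fun ⟨du, ddu, h1, h2, h3⟩ => ⟨du, ddu, ⟨⟨h1, h2⟩, h3⟩⟩,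
    fun ⟨du, ddu, h⟩ => ⟨du, ddu, h.1.1, h.1.2, h.2⟩⟩

/-- The size of the 2-jet of `u` in the chart around `c`. -/
noncomputable def jetSize (I : ModelWithCorners ℝ E H) (u : M → F)
    (du : ∀ x : M, TangentSpace I x →L[ℝ] F) (ddu : M → E → E →L[ℝ] E →L[ℝ] F) (c : M) (y : E) :
    ℝ :=
  ‖u ((extChartAt I c).symm y)‖ + ‖chartForm I du c y‖ + ‖ddu c y‖

section Measurability

variable (h : HasWeakJet I u du ddu)
include h

theorem HasWeakJet.aestronglyMeasurable (c : M) :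
    AEStronglyMeasurable (fun y => u ((extChartAt I c).symm y))
      (volume.restrict (extChartAt I c).target) := by
  rw [← restrict_interior_target]
  exact (h.hasWeakDifferential c).1.aestronglyMeasurable

theorem HasWeakJet.aestronglyMeasurable_chartForm (c : M) :
    AEStronglyMeasurable (chartForm I du c) (volume.restrict (extChartAt I c).target) := by
  rw [← restrict_interior_target]
  exact (h.hasWeakDifferential c).2.1.aestronglyMeasurable

theorem HasWeakJet.aestronglyMeasurable_second (c : M) :
    AEStronglyMeasurable (ddu c) (volume.restrict (extChartAt I c).target) := by
  rw [← restrict_interior_target]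
  exact (h.hasWeakFDerivOn c).2.1.aestronglyMeasurable

theorem HasWeakJet.aestronglyMeasurable_jetSize (c : M) :
    AEStronglyMeasurable (jetSize I u du ddu c) (volume.restrict (extChartAt I c).target) :=
  ((h.aestronglyMeasurable c).norm.add (h.aestronglyMeasurable_chartForm c).norm).add
    (h.aestronglyMeasurable_second c).norm

end Measurability

theorem enorm_piece_le {X : Type*} [NormedAddCommGroup X] [Fact (1 ≤ r)] (s : PieceLp 𝒰 r X)
    (i : Fin 𝒰.size) : eLpNorm (s i) r (volume.restrict (𝒰.piece i)) ≤ ‖s‖ₑ := by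
  rw [← Lp.enorm_def]
  refine enorm_le_iff_norm_le.2 ?_
  exact norm_le_pi_norm (f := (s : ∀ i, Lp X r (volume.restrict (𝒰.piece i)))) i

theorem HasLocalJets.eLpNorm_jetSize_le [Fact (1 ≤ r)] (h : HasLocalJets t u du ddu)
    (j : Fin 𝒰.size) :
    eLpNorm (jetSize I u du ddu (𝒰.center j)) r (volume.restrict (𝒰.piece j)) ≤ 3 * ‖t‖ₑ := by
  have hr : 1 ≤ r := Fact.out
  have hm : (volume.restrict (𝒰.piece j) : Measure E) ≤
      volume.restrict (extChartAt I (𝒰.center j)).target :=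
    Measure.restrict_mono (𝒰.piece_subset j) le_rfl
  have m1 := ((h.aestronglyMeasurable (𝒰.center j)).mono_measure hm).norm
  have m2 := ((h.aestronglyMeasurable_chartForm (𝒰.center j)).mono_measure hm).norm
  have m3 := ((h.aestronglyMeasurable_second (𝒰.center j)).mono_measure hm).norm
  refine (eLpNorm_add_le (m1.add m2) m3 hr).trans
    ((add_le_add_left (eLpNorm_add_le m1 m2 hr) _).trans ?_)
  simp only [eLpNorm_norm]
  rw [← eLpNorm_congr_ae (h.ae_eq j).1, ← eLpNorm_congr_ae (h.ae_eq j).2.1,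
    ← eLpNorm_congr_ae (h.ae_eq j).2.2]
  have e1 : ‖t.1‖ₑ ≤ ‖t‖ₑ := enorm_le_iff_norm_le.2 (norm_fst_le t)
  have e2 : ‖t.2.1‖ₑ ≤ ‖t‖ₑ :=
    enorm_le_iff_norm_le.2 ((norm_fst_le t.2).trans (norm_snd_le t))
  have e3 : ‖t.2.2‖ₑ ≤ ‖t‖ₑ :=
    enorm_le_iff_norm_le.2 ((norm_snd_le t.2).trans (norm_snd_le t))
  calc _ ≤ ‖t‖ₑ + ‖t‖ₑ + ‖t‖ₑ := add_le_add (add_le_add ((enorm_piece_le t.1 j).trans e1)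
        ((enorm_piece_le t.2.1 j).trans e2)) ((enorm_piece_le t.2.2 j).trans e3)
    _ = 3 * ‖t‖ₑ := by ring

variable [IsManifold I ∞ M]

theorem exists_jetSize_coordChange_le {A : Set E} (hA : IsCompact A) (hAo : A ⊆ overlap I c c') :
    ∃ D : ℝ, ∀ (u : M → F) (du : ∀ x : M, TangentSpace I x →L[ℝ] F)
      (ddu : M → E → E →L[ℝ] E →L[ℝ] F), HasWeakJet I u du ddu →
      ∀ᵐ y ∂(volume.restrict A), ‖jetSize I u du ddu c y‖ ≤
        D * ‖jetSize I u du ddu c' (coordChange I c c' y)‖ := by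
  obtain ⟨D₁, hD₁⟩ := hA.exists_bound_of_continuousOn ((continuousOn_coordDeriv c c').mono hAo)
  obtain ⟨D₂, hD₂⟩ := hA.exists_bound_of_continuousOn ((continuousOn_coordDeriv₂ c c').mono hAo)
  -- The value is unchanged (`1`), the first derivative is composed with `Dτ` (`|D₁|`), and the
  -- second derivative has a term with `D²τ` (`|D₂|`) and one with two factors `Dτ` (`|D₁| ^ 2`).
  refine ⟨1 + |D₁| + |D₂| + |D₁| ^ 2, fun u du ddu h => ?_⟩
  have h1 := ae_restrict_of_ae_restrict_of_subset hAo
    (weakFDeriv_chartForm_coordChange (h.hasWeakFDerivOn c) (h.hasWeakFDerivOn c'))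
  filter_upwards [h1, ae_restrict_mem hA.measurableSet] with y hy hyA
  have hn : ∀ c y, 0 ≤ jetSize I u du ddu c y := fun c y => by unfold jetSize; positivity
  rw [Real.norm_of_nonneg (hn _ _), Real.norm_of_nonneg (hn _ _)]
  have hd1 : ‖coordDeriv I c c' y‖ ≤ |D₁| := (hD₁ y hyA).trans (le_abs_self _)
  have hd2 : ‖coordDeriv₂ I c c' y‖ ≤ |D₂| := (hD₂ y hyA).trans (le_abs_self _)
  unfold jetSize
  rw [symm_coordChange (hAo hyA), hy, chartForm_coordChange du (hAo hyA)]
  set a := ‖u ((extChartAt I c).symm y)‖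
  set L := chartForm I du c' (coordChange I c c' y)
  set B := ddu c' (coordChange I c c' y)
  have i1 : ‖L.comp (coordDeriv I c c' y)‖ ≤ ‖L‖ * |D₁| :=
    (ContinuousLinearMap.opNorm_comp_le _ _).trans (by gcongr)
  have i2 : ‖pullbackDeriv L B (coordDeriv I c c' y) (coordDeriv₂ I c c' y)‖ ≤
      |D₂| * ‖L‖ + |D₁| ^ 2 * ‖B‖ :=
    (norm_pullbackDeriv_le _ _ _ _).trans (by gcongr)
  have p1 : 0 ≤ a := norm_nonneg _
  have p2 := norm_nonneg L
  have p3 := norm_nonneg B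
  have p4 := abs_nonneg D₁
  have p5 := abs_nonneg D₂
  have : (1 + |D₁| + |D₂| + |D₁| ^ 2) * (a + ‖L‖ + ‖B‖) - (a + ‖L‖ * |D₁| +
      (|D₂| * ‖L‖ + |D₁| ^ 2 * ‖B‖)) = (|D₁| + |D₂| + |D₁| ^ 2) * a + (1 + |D₁| ^ 2) * ‖L‖ +
      (1 + |D₁| + |D₂|) * ‖B‖ := by ring
  have : 0 ≤ (|D₁| + |D₂| + |D₁| ^ 2) * a + (1 + |D₁| ^ 2) * ‖L‖ +
      (1 + |D₁| + |D₂|) * ‖B‖ := by positivity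
  linarith

/-- The `L^r` norm of the 2-jet over a compact part of any chart is controlled by the norm
computed with the cover. -/
theorem exists_eLpNorm_jetSize_le [T2Space M] (𝒰 : ChartCover I M) (r : ℝ≥0∞) [Fact (1 ≤ r)]
    {K : Set E} (hK : IsCompact K) (hKc : K ⊆ (extChartAt I c).target) :
    ∃ C : ℝ≥0, ∀ (t : LocalJets 𝒰 r F) (u : M → F) (du : ∀ x : M, TangentSpace I x →L[ℝ] F)
      (ddu : M → E → E →L[ℝ] E →L[ℝ] F), HasLocalJets t u du ddu →
      eLpNorm (jetSize I u du ddu c) r (volume.restrict K) ≤ C * ‖t‖ₑ := by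
  have hr : 1 ≤ r := Fact.out
  have hAc := 𝒰.isCompact_trace (c := c) hK hKc
  have hAo := 𝒰.trace_subset_overlap (c := c) hKc
  choose C hC using fun j => exists_map_coordChange_le (hAc j) (hAo j) (𝒰.mapsTo_trace c K j)
  choose D hD using fun j => exists_jetSize_coordChange_le (F := F) (hAc j) (hAo j)
  -- For each piece: `D j` from the transformation of jets, `1 + C j` from the change of variables,
  -- and `3` for the three components of a jet.
  refine ⟨∑ j, (D j).toNNReal * ((1 + C j) * 3), fun t u du ddu h => ?_⟩
  have hm := h.aestronglyMeasurable_jetSize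
  refine (eLpNorm_restrict_le_sum (fun j => (hAc j).measurableSet) (𝒰.iUnion_trace c K).ge hr
    fun j => (hm c).mono_measure (Measure.restrict_mono ((hAo j).trans overlap_subset_target)
      le_rfl)).trans ?_
  push_cast
  rw [Finset.sum_mul]
  refine Finset.sum_le_sum fun j _ => ?_
  calc eLpNorm (jetSize I u du ddu c) r (volume.restrict (𝒰.trace c K j))
      ≤ ENNReal.ofReal (D j) * eLpNorm (fun y => jetSize I u du ddu (𝒰.center j)
          (coordChange I c (𝒰.center j) y)) r (volume.restrict (𝒰.trace c K j)) :=
        eLpNorm_le_mul_eLpNorm_of_ae_le_mul (hD j u du ddu h.toHasWeakJet) r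
    _ ≤ ENNReal.ofReal (D j) * ((1 + C j) * (3 * ‖t‖ₑ)) := by
        gcongr
        refine (eLpNorm_comp_le (g := jetSize I u du ddu (𝒰.center j))
          (aemeasurable_coordChange (hAc j).measurableSet (hAo j)) (hC j)
          ((hm _).mono_measure (Measure.restrict_mono (𝒰.piece_subset j) le_rfl)) hr).trans ?_
        gcongr
        exact h.eLpNorm_jetSize_le j
    _ = _ := by
        rw [ENNReal.ofReal]; ring

theorem norm_le_jetSize (c : M) (y : E) :
    ‖u ((extChartAt I c).symm y)‖ ≤ jetSize I u du ddu c y := by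
  unfold jetSize
  have := norm_nonneg (chartForm I du c y)
  have := norm_nonneg (ddu c y)
  linarith

theorem norm_chartForm_le_jetSize (c : M) (y : E) :
    ‖chartForm I du c y‖ ≤ jetSize I u du ddu c y := by
  unfold jetSize
  have := norm_nonneg (u ((extChartAt I c).symm y))
  have := norm_nonneg (ddu c y)
  linarith

theorem norm_second_le_jetSize (c : M) (y : E) :
    ‖ddu c y‖ ≤ jetSize I u du ddu c y := by
  unfold jetSize
  have := norm_nonneg (u ((extChartAt I c).symm y))
  have := norm_nonneg (chartForm I du c y)
  linarith

section MemLp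

variable [T2Space M] [Fact (1 ≤ r)] (h : HasLocalJets t u du ddu) {K : Set E} (hK : IsCompact K)
  (hKc : K ⊆ (extChartAt I c).target)
include h hK hKc

theorem HasLocalJets.eLpNorm_jetSize_lt_top :
    eLpNorm (jetSize I u du ddu c) r (volume.restrict K) < ⊤ := by
  obtain ⟨C, hC⟩ := exists_eLpNorm_jetSize_le (F := F) 𝒰 r hK hKc
  exact (hC t u du ddu h).trans_lt (ENNReal.mul_lt_top (by simp) (by simp))

theorem HasLocalJets.memLp : MemLp (fun y => u ((extChartAt I c).symm y)) r (volume.restrict K) :=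
  ⟨(h.aestronglyMeasurable c).mono_measure (Measure.restrict_mono hKc le_rfl),
    (eLpNorm_mono_real (norm_le_jetSize c)).trans_lt (h.eLpNorm_jetSize_lt_top hK hKc)⟩

theorem HasLocalJets.memLp_chartForm : MemLp (chartForm I du c) r (volume.restrict K) :=
  ⟨(h.aestronglyMeasurable_chartForm c).mono_measure (Measure.restrict_mono hKc le_rfl),
    (eLpNorm_mono_real (norm_chartForm_le_jetSize c)).trans_lt (h.eLpNorm_jetSize_lt_top hK hKc)⟩

theorem HasLocalJets.memLp_second : MemLp (ddu c) r (volume.restrict K) :=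
  ⟨(h.aestronglyMeasurable_second c).mono_measure (Measure.restrict_mono hKc le_rfl),
    (eLpNorm_mono_real (norm_second_le_jetSize c)).trans_lt (h.eLpNorm_jetSize_lt_top hK hKc)⟩

end MemLp

theorem HasLocalJets.chartAE_eq (h : HasLocalJets t u du ddu) (h' : HasLocalJets t u' du' ddu') :
    ChartAE I fun x => u x = u' x := by
  refine chartAE_of_piece 𝒰 fun i => ?_
  filter_upwards [(h.ae_eq i).1, (h'.ae_eq i).1] with y a b
  rw [← a, b]

end Jets

/-! ### Convex bodies inside charts. -/

section Bodies

variable {E : Type*} [NormedAddCommGroup E] [InnerProductSpace ℝ E]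
    [FiniteDimensional ℝ E] [MeasurableSpace E] [BorelSpace E]
    {G : Type*} [NormedAddCommGroup G] [NormedSpace ℝ G] {K : Set E}

theorem IsSolidConvex.exists_subset (hK : IsSolidConvex K) {z : E} (hz : z ∈ K) {V : Set E}
    (hV : V ∈ 𝓝[K] z) : ∃ L, IsSolidConvex L ∧ z ∈ L ∧ L ⊆ V ∧ L ⊆ K := by
  obtain ⟨ε, hε, h⟩ := Metric.mem_nhdsWithin_iff.1 hV
  refine ⟨Metric.closedBall z (ε / 2) ∩ K, ⟨(isCompact_closedBall _ _).inter_right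
    hK.isCompact.isClosed, (convex_closedBall _ _).inter hK.convex, ?_⟩,
    ⟨Metric.mem_closedBall_self (half_pos hε).le, hz⟩, ?_, inter_subset_right⟩
  · rw [interior_inter]
    have := mem_closure_iff.1 (hK.closure_interior.ge hz) (Metric.ball z (ε / 2))
      Metric.isOpen_ball (Metric.mem_ball_self (half_pos hε))
    exact this.mono (inter_subset_inter_left _ Metric.ball_subset_interior_closedBall)
  · exact fun w hw => h ⟨Metric.closedBall_subset_ball (half_lt_self hε) hw.1, hw.2⟩

theorem IsSolidConvex.eqOn_of_ae_eq (hK : IsSolidConvex K) {f g : E → G} (hf : ContinuousOn f K)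
    (hg : ContinuousOn g K) (h : f =ᵐ[volume.restrict K] g) : EqOn f g K := by
  intro y hy
  have h0 : (fun z => f z - g z) =ᵐ[volume.restrict K] fun _ => (0 : G) := by
    filter_upwards [h] with z hz
    rw [hz, sub_self]
  have := hK.enorm_le_eLpNorm_top (hf.sub hg) h0 hy
  rw [eLpNorm_zero', nonpos_iff_eq_zero, enorm_eq_zero] at this
  exact sub_eq_zero.1 this

/-- Sobolev inequalities are available on convex bodies only, while the pieces of a cover are
arbitrary compact sets. The bodies may stick out of `K`, which is harmless because jets are
controlled on every compact part of a chart. -/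
theorem exists_finite_cover_isSolidConvex {H : Type*} [TopologicalSpace H]
    {I : ModelWithCorners ℝ E H} {M : Type*} [TopologicalSpace M] [ChartedSpace H M]
    [IsManifold I ∞ M] {c : M} (hK : IsCompact K) (hKc : K ⊆ (extChartAt I c).target) :
    ∃ (n : ℕ) (B : Fin n → Set E), (∀ j, IsSolidConvex (B j)) ∧
      (∀ j, B j ⊆ (extChartAt I c).target) ∧ K ⊆ ⋃ j, B j := by
  have h : ∀ y : E, ∃ L : Set E, y ∈ K → IsSolidConvex L ∧ L ⊆ (extChartAt I c).target ∧
      L ∈ 𝓝[K] y := by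
    intro y
    by_cases hy : y ∈ K
    · have hyr := extChartAt_target_subset_range c (hKc hy)
      obtain ⟨L, h1, -, h2, -, h3⟩ := exists_isSolidConvex_subset
        (extChartAt_target_mem_nhdsWithin_of_mem (hKc hy)) hyr
      exact ⟨L, fun _ => ⟨h1, h2, nhdsWithin_mono _
        (hKc.trans (extChartAt_target_subset_range c)) h3⟩⟩
    · exact ⟨∅, fun h => absurd h hy⟩
  choose L hL using h
  obtain ⟨s, hs, hcov⟩ := hK.elim_nhdsWithin_subcover L fun y hy => (hL y hy).2.2
  refine ⟨s.card, fun j => L (s.equivFin.symm j), fun j => (hL _ (hs _ (s.equivFin.symm j).2)).1,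
    fun j => (hL _ (hs _ (s.equivFin.symm j).2)).2.1, fun y hy => ?_⟩
  obtain ⟨x, hx, hyx⟩ := mem_iUnion₂.1 (hcov hy)
  exact mem_iUnion.2 ⟨s.equivFin ⟨x, hx⟩, by simpa using hyx⟩

end Bodies

/-! ### The continuously differentiable representative for `p > n`. -/

section Representative

open scoped NNReal

variable {E : Type*} [NormedAddCommGroup E] [InnerProductSpace ℝ E]
    [FiniteDimensional ℝ E] [MeasurableSpace E] [BorelSpace E]
    {F : Type*} [NormedAddCommGroup F] [InnerProductSpace ℝ F] [FiniteDimensional ℝ F]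
    {H : Type*} [TopologicalSpace H] {I : ModelWithCorners ℝ E H}
    {M : Type*} [TopologicalSpace M] [ChartedSpace H M] [IsManifold I ∞ M] {c c' : M}
    {𝒰 : ChartCover I M} {p : ℝ≥0∞} {t : LocalJets 𝒰 p F} {u u' : M → F}
    {du du' : ∀ x : M, TangentSpace I x →L[ℝ] F} {ddu ddu' : M → E → E →L[ℝ] E →L[ℝ] F}

theorem coordChange_mem_nhdsWithin {y : E} (hy : y ∈ overlap I c c') {V : Set E}
    (hV : V ∈ 𝓝[range I] (coordChange I c c' y)) :
    overlap I c c' ∩ coordChange I c c' ⁻¹' V ∈ 𝓝[range I] y := by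
  rw [← nhdsWithin_overlap hy]
  refine inter_mem self_mem_nhdsWithin ?_
  have h1 := (contDiffOn_coordChange c c').continuousOn y hy
  have h2 : Tendsto (coordChange I c c') (𝓝[overlap I c c'] y)
      (𝓝[range I] (coordChange I c c' y)) := by
    refine tendsto_nhdsWithin_iff.2 ⟨h1, ?_⟩
    filter_upwards [self_mem_nhdsWithin] with z hz
    exact extChartAt_target_subset_range c' (mapsTo_coordChange c c' hz).1
  exact h2 hV

/-- A function of class `W^{2,p}`, with `p > n`, has a continuously differentiable representative. -/
theorem HasLocalJets.exists_contMDiff [T2Space M] [Fact (1 ≤ p)]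
    (hn : (Module.finrank ℝ E : ℝ≥0∞) < p) (h : HasLocalJets t u du ddu) :
    ∃ f : M → F, ContMDiff I 𝓘(ℝ, F) 1 f ∧ ChartAE I fun x => f x = u x := by
  have hp : 1 ≤ p := Fact.out
  have hloc : ∀ x : M, ∃ (K : Set E) (f : E → F) (g : E → E →L[ℝ] F), IsSolidConvex K ∧
      extChartAt I x x ∈ K ∧ K ⊆ (extChartAt I x).target ∧ K ∈ 𝓝[range I] (extChartAt I x x) ∧
      f =ᵐ[volume.restrict K] (fun y => u ((extChartAt I x).symm y)) ∧ ContinuousOn g K ∧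
      ∀ y ∈ K, HasFDerivWithinAt f (g y) K y := by
    intro x
    have hx := mem_extChartAt_target (I := I) x
    obtain ⟨K, hK, hxK, hKt, -, hKn⟩ := exists_isSolidConvex_subset
      (extChartAt_target_mem_nhdsWithin_of_mem hx) (extChartAt_target_subset_range x hx)
    obtain ⟨f, g, h1, -, h2, h3⟩ := hK.exists_hasFDerivWithinAt hp hn
      ((h.hasWeakDifferential x).mono (interior_mono hKt))
      ((h.hasWeakFDerivOn x).mono (interior_mono hKt)) (h.memLp hK.isCompact hKt)
      (h.memLp_chartForm hK.isCompact hKt) (h.memLp_second hK.isCompact hKt)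
    exact ⟨K, f, g, hK, hxK, hKt, hKn, h1, h2, h3⟩
  choose K f g hK hxK hKt hKn hfu hg hfg using hloc
  have hfc : ∀ x, ContinuousOn (f x) (K x) := fun x y hy => (hfg x y hy).continuousWithinAt
  -- The value at `x` is prescribed by the local representative in the chart around `x` itself.
  set f₀ : M → F := fun x => f x (extChartAt I x x) with hf₀
  have ae_trans : ∀ x x' : M, ∀ᵐ y ∂(volume.restrict (overlap I x x')),
      coordChange I x x' y ∈ K x' → f x' (coordChange I x x' y) = u ((extChartAt I x).symm y) := by
    intro x x'
    have h1 : ∀ᵐ z ∂(volume.restrict (overlap I x' x)), z ∈ K x' →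
        f x' z = u ((extChartAt I x').symm z) :=
      ae_restrict_of_ae ((ae_restrict_iff' (hK x').isCompact.measurableSet).1 (hfu x'))
    filter_upwards [ae_coordChange h1, ae_restrict_mem (measurableSet_overlap _ _)] with y hy hyo hk
    rw [hy hk, symm_coordChange hyo]
  -- The local representatives fit together: on a small convex body around `z` both are continuous
  -- and equal `u` almost everywhere, hence they coincide.
  have key : ∀ x, ∀ z ∈ K x, f₀ ((extChartAt I x).symm z) = f x z := by
    intro x z hz
    set x' := (extChartAt I x).symm z with hx'
    have hzo : z ∈ overlap I x x' := ⟨hKt x hz, mem_extChartAt_source x'⟩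
    have hV := coordChange_mem_nhdsWithin hzo (V := K x') (hKn x')
    obtain ⟨L, hL, hzL, hLV, hLK⟩ := (hK x).exists_subset hz
      (nhdsWithin_mono _ ((hKt x).trans (extChartAt_target_subset_range x)) hV)
    have hc1 : ContinuousOn (fun y => f x' (coordChange I x x' y)) L :=
      (hfc x').comp ((contDiffOn_coordChange x x').continuousOn.mono fun y hy => (hLV hy).1)
        fun y hy => (hLV hy).2
    refine hL.eqOn_of_ae_eq hc1 ((hfc x).mono hLK) ?_ hzL
    filter_upwards [ae_restrict_of_ae_restrict_of_subset (fun y hy => (hLV hy).1) (ae_trans x x'),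
      ae_restrict_of_ae_restrict_of_subset hLK (hfu x), ae_restrict_mem hL.isCompact.measurableSet]
      with y h1 h2 h3
    rw [h1 (hLV h3).2, h2]
  refine ⟨f₀, fun x => ?_, fun c => ?_⟩
  · rw [contMDiffAt_iff_source, contMDiffWithinAt_iff_contDiffWithinAt]
    have h1 : ContDiffWithinAt ℝ (0 + 1) (f x) (range I) (extChartAt I x x) := by
      rw [contDiffWithinAt_succ_iff_hasFDerivWithinAt (by simp)]
      refine ⟨K x, ?_, by simp, g x, hfg x, ?_⟩
      · rw [insert_eq_of_mem (extChartAt_target_subset_range x (mem_extChartAt_target x))]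
        exact hKn x
      · exact (contDiffOn_zero.2 (hg x)) _ (hxK x)
    rw [zero_add] at h1
    refine h1.congr_of_eventuallyEq ?_ (key x _ (hxK x))
    filter_upwards [hKn x] with z hz
    exact key x z hz
  -- The exceptional set is locally null: near each point of the chart the function is given by the
  -- representative on one body, where it equals `u` almost everywhere.
  · rw [ae_restrict_iff' (measurableSet_target c), ae_iff]
    refine measure_null_of_locally_null _ fun y hy => ?_
    simp only [mem_ofPred_eq, Classical.not_imp] at hy
    set x := (extChartAt I c).symm y with hx
    have hyo : y ∈ overlap I c x := ⟨hy.1, mem_extChartAt_source x⟩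
    have hV := coordChange_mem_nhdsWithin hyo (V := K x) (hKn x)
    refine ⟨_, inter_mem (nhdsWithin_mono _ (fun z hz => ?_) hV) self_mem_nhdsWithin, ?_⟩
    · simp only [mem_ofPred_eq, Classical.not_imp] at hz
      exact extChartAt_target_subset_range c hz.1
    have h1 := (ae_restrict_iff' (measurableSet_overlap _ _)).1 (ae_trans c x)
    refine measure_mono_null ?_ (ae_iff.1 h1)
    rintro z ⟨⟨hzo, hzK⟩, hz⟩
    simp only [mem_ofPred_eq, Classical.not_imp] at hz ⊢
    refine ⟨hzo, hzK, fun he => hz.2 ?_⟩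
    rw [← he, ← key x _ hzK, symm_coordChange hzo]

section Differential

/-- The differential of a differentiable function with values in a vector space. -/
noncomputable def diffForm (I : ModelWithCorners ℝ E H) (f : M → F) (x : M) :
    TangentSpace I x →L[ℝ] F :=
  mfderiv I 𝓘(ℝ, F) f x

variable {f : M → F} (hf : ContMDiff I 𝓘(ℝ, F) 1 f)
include hf

theorem contDiffOn_comp_symm (c : M) :
    ContDiffOn ℝ 1 (fun y => f ((extChartAt I c).symm y)) (extChartAt I c).target := by
  rw [← contMDiffOn_iff_contDiffOn]
  exact hf.comp_contMDiffOn (contMDiffOn_extChartAt_symm c)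

theorem chartForm_diffForm {y : E} (hy : y ∈ (extChartAt I c).target) :
    chartForm I (diffForm I f) c y =
      fderivWithin ℝ (fun y => f ((extChartAt I c).symm y)) (extChartAt I c).target y := by
  have h1 : HasMFDerivWithinAt 𝓘(ℝ, E) I (extChartAt I c).symm (extChartAt I c).target y
      (chartFrame I c y) :=
    (mdifferentiableWithinAt_extChartAt_symm hy).hasMFDerivWithinAt.mono
      (extChartAt_target_subset_range c)
  have h2 : HasMFDerivAt I 𝓘(ℝ, F) f ((extChartAt I c).symm y)
      (diffForm I f ((extChartAt I c).symm y)) :=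
    (hf.mdifferentiableAt one_ne_zero).hasMFDerivAt
  have h3 := h2.comp_hasMFDerivWithinAt y h1
  have h4 : HasFDerivWithinAt (fun y => f ((extChartAt I c).symm y))
      (chartForm I (diffForm I f) c y) (extChartAt I c).target y := h3.hasFDerivWithinAt
  exact (h4.fderivWithin (uniqueDiffOn_target c y hy)).symm

theorem continuousOn_chartForm_diffForm (c : M) :
    ContinuousOn (chartForm I (diffForm I f) c) (extChartAt I c).target :=
  ((contDiffOn_comp_symm hf c).continuousOn_fderivWithin (uniqueDiffOn_target c) le_rfl).congr
    fun _ hy => chartForm_diffForm hf hy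

theorem hasWeakDifferential_diffForm : HasWeakDifferential I f (diffForm I f) := by
  intro c
  refine (HasWeakFDerivOn.of_contDiffOn isOpen_interior
    ((contDiffOn_comp_symm hf c).mono interior_subset)).congr isOpen_interior.measurableSet
    (EventuallyEq.refl _ _) ?_
  filter_upwards [ae_restrict_mem isOpen_interior.measurableSet] with y hy
  rw [chartForm_diffForm hf (interior_subset hy),
    fderivWithin_of_mem_nhds (mem_interior_iff_mem_nhds.1 hy)]

theorem HasLocalJets.of_contMDiff (h : HasLocalJets t u du ddu)
    (hfu : ChartAE I fun x => f x = u x) : HasLocalJets t f (diffForm I f) ddu := by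
  have hd : ChartAE I fun x => diffForm I f x = du x :=
    (hasWeakDifferential_diffForm hf).chartAE_eq h.hasWeakDifferential hfu
  have hform : ∀ c, chartForm I du c =ᵐ[volume.restrict (extChartAt I c).target]
      chartForm I (diffForm I f) c := fun c => by
    filter_upwards [hd c] with y hy
    simp only [chartForm, hy]
  refine ⟨⟨hasWeakDifferential_diffForm hf, fun c => ?_⟩, fun i => ⟨?_, ?_, (h.ae_eq i).2.2⟩⟩
  · refine (h.hasWeakFDerivOn c).congr isOpen_interior.measurableSet ?_ (EventuallyEq.refl _ _)
    rw [restrict_interior_target]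
    exact hform c
  · filter_upwards [(h.ae_eq i).1, ae_restrict_of_ae_restrict_of_subset (𝒰.piece_subset i)
      (hfu (𝒰.center i))] with y a b
    rw [a, b]
  · exact (h.ae_eq i).2.1.trans (ae_restrict_of_ae_restrict_of_subset (𝒰.piece_subset i)
      (hform (𝒰.center i)))

end Differential

theorem eq_of_chartAE_eq {f f' : M → F} (hf : Continuous f) (hf' : Continuous f')
    (h : ChartAE I fun x => f x = f' x) : f = f' := by
  funext x
  have hx := mem_extChartAt_target (I := I) x
  obtain ⟨K, hK, hxK, hKt, -, -⟩ := exists_isSolidConvex_subset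
    (extChartAt_target_mem_nhdsWithin_of_mem hx) (extChartAt_target_subset_range x hx)
  have hc := (continuousOn_extChartAt_symm (I := I) x).mono hKt
  have := hK.eqOn_of_ae_eq (hf.comp_continuousOn hc) (hf'.comp_continuousOn hc)
    (ae_restrict_of_ae_restrict_of_subset hKt (h x)) hxK
  simpa using this

/-- The supremum of the differential over a compact part of a chart is controlled by the norm in
`W^{2,p}`, if `p > n`. -/
theorem exists_norm_chartForm_le [T2Space M] (𝒰 : ChartCover I M) [Fact (1 ≤ p)]
    (hn : (Module.finrank ℝ E : ℝ≥0∞) < p) {K : Set E} (hK : IsCompact K)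
    (hKc : K ⊆ (extChartAt I c).target) :
    ∃ C : ℝ≥0, ∀ (t : LocalJets 𝒰 p F) (f : M → F) (ddf : M → E → E →L[ℝ] E →L[ℝ] F),
      ContMDiff I 𝓘(ℝ, F) 1 f → HasLocalJets t f (diffForm I f) ddf → ∀ y ∈ K,
      ‖chartForm I (diffForm I f) c y‖ₑ ≤ C * ‖t‖ₑ := by
  have hp : 1 ≤ p := Fact.out
  obtain ⟨n, B, hB, hBc, hcov⟩ := exists_finite_cover_isSolidConvex hK hKc
  choose C hC using fun j => (hB j).exists_ae_norm_le (G := E →L[ℝ] F) hp hn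
  choose D hD using fun j => exists_eLpNorm_jetSize_le (F := F) 𝒰 p (hB j).isCompact (hBc j)
  refine ⟨∑ j, C j * (2 * D j), fun t f ddf hf h y hy => ?_⟩
  obtain ⟨j, hj⟩ := mem_iUnion.1 (hcov hy)
  have e1 := (hB j).enorm_le_eLpNorm_top
    ((continuousOn_chartForm_diffForm hf c).mono (hBc j)) (EventuallyEq.refl _ _) hj
  have e2 := hC j _ _ ((h.hasWeakFDerivOn c).mono (interior_mono (hBc j)))
    (h.memLp_chartForm (hB j).isCompact (hBc j)) (h.memLp_second (hB j).isCompact (hBc j))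
  have e3 := hD j t f _ ddf h
  have e4 : eLpNorm (chartForm I (diffForm I f) c) p (volume.restrict (B j)) ≤ D j * ‖t‖ₑ :=
    (eLpNorm_mono_real (norm_chartForm_le_jetSize c)).trans e3
  have e5 : eLpNorm (ddf c) p (volume.restrict (B j)) ≤ D j * ‖t‖ₑ :=
    (eLpNorm_mono_real (norm_second_le_jetSize c)).trans e3
  calc _ ≤ _ := e1
    _ ≤ _ := e2
    _ ≤ C j * (D j * ‖t‖ₑ + D j * ‖t‖ₑ) := by gcongr
    _ = ((C j * (2 * D j) : ℝ≥0) : ℝ≥0∞) * ‖t‖ₑ := by push_cast; ring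
    _ ≤ _ := by
      gcongr
      exact Finset.single_le_sum (f := fun j => C j * (2 * D j)) (fun _ _ => zero_le)
        (Finset.mem_univ j)

end Representative

/-! ### The Moore–Penrose pseudoinverse of injective operators. -/

section Pseudoinverse

variable {E : Type*} [NormedAddCommGroup E] [InnerProductSpace ℝ E] [FiniteDimensional ℝ E]
    {F : Type*} [NormedAddCommGroup F] [InnerProductSpace ℝ F] [FiniteDimensional ℝ F]

/-- Taking adjoints of operators between real Euclidean spaces, as a continuous linear map. -/
noncomputable def adjointCLM : (E →L[ℝ] F) →L[ℝ] (F →L[ℝ] E) :=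
  LinearMap.mkContinuous
    { toFun := fun L => ContinuousLinearMap.adjoint L
      map_add' := fun L L' => map_add _ L L'
      map_smul' := fun a L => by simp } 1 fun L => by simp

theorem adjointCLM_apply (L : E →L[ℝ] F) : adjointCLM L = ContinuousLinearMap.adjoint L := rfl

/-- The Moore–Penrose pseudoinverse `(L* L)⁻¹ L*` of an injective operator `L`. -/
noncomputable def pseudoinverse (L : E →L[ℝ] F) : F →L[ℝ] E :=
  (Ring.inverse ((adjointCLM L).comp L)).comp (adjointCLM L)

variable {L : E →L[ℝ] F} {P Q : F →L[ℝ] E}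

/-- If `L* L v = 0`, then `⟪L v, L v⟫ = 0`; in finite dimension injectivity suffices. -/
theorem isUnit_adjoint_comp (hL : Function.Injective L) : IsUnit ((adjointCLM L).comp L) := by
  have hinj : Function.Injective ((adjointCLM L).comp L) := by
    rw [injective_iff_map_eq_zero]
    intro v hv
    refine (injective_iff_map_eq_zero L).1 hL v ?_
    have h : inner ℝ (L v) (L v) = 0 := by
      rw [← ContinuousLinearMap.adjoint_inner_right, ← adjointCLM_apply]
      change inner ℝ v (((adjointCLM L).comp L) v) = 0
      rw [hv, inner_zero_right]
    exact inner_self_eq_zero.1 h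
  exact ContinuousLinearMap.isUnit_iff_bijective.2
    ⟨hinj, LinearMap.surjective_of_injective (f := (((adjointCLM L).comp L : E →L[ℝ] E) : E →ₗ[ℝ] E)) hinj⟩

theorem pseudoinverse_comp (hL : Function.Injective L) : (pseudoinverse L).comp L = .id ℝ E := by
  have := Ring.inverse_mul_cancel _ (isUnit_adjoint_comp hL)
  rw [pseudoinverse, ContinuousLinearMap.comp_assoc]
  exact this

theorem pseudoinverse_apply_apply (hL : Function.Injective L) (v : E) :
    pseudoinverse L (L v) = v := DFunLike.congr_fun (pseudoinverse_comp hL) v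

/-- `L* L` is self-adjoint, therefore its inverse is, and so is `L (L* L)⁻¹ L*`. -/
theorem inner_comp_pseudoinverse (hL : Function.Injective L) (z z' : F) :
    inner ℝ (L (pseudoinverse L z)) z' = inner ℝ z (L (pseudoinverse L z')) := by
  have hB := Ring.mul_inverse_cancel _ (isUnit_adjoint_comp hL)
  set B := Ring.inverse ((adjointCLM L).comp L) with hBdef
  have hB' : ∀ x, adjointCLM L (L (B x)) = x := fun x => DFunLike.congr_fun hB x
  have hsymm : ∀ x y, inner ℝ (B x) y = inner ℝ x (B y) := by
    intro x y
    conv_lhs => rw [← hB' y]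
    conv_rhs => rw [← hB' x]
    rw [adjointCLM_apply, ContinuousLinearMap.adjoint_inner_right,
      ContinuousLinearMap.adjoint_inner_left]
  have hP : ∀ z, pseudoinverse L z = B (adjointCLM L z) := fun _ => rfl
  rw [hP, hP]
  calc _ = inner ℝ (B (adjointCLM L z)) (adjointCLM L z') :=
        (ContinuousLinearMap.adjoint_inner_right L _ _).symm
    _ = inner ℝ (adjointCLM L z) (B (adjointCLM L z')) := hsymm _ _
    _ = _ := ContinuousLinearMap.adjoint_inner_left L _ _

/-- For injective `L` the first Penrose equation says that `P` is a left inverse. By the third, `L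
P` and `L (L* L)⁻¹ L*` are both orthogonal projections onto the range of `L`, hence equal, and `L`
can be cancelled. -/
theorem isMoorePenroseInverse_iff (hL : Function.Injective L) :
    IsMoorePenroseInverse L P ↔ P = pseudoinverse L := by
  constructor
  · rintro ⟨h1, -, h3, -⟩
    have hPL : ∀ v, P (L v) = v := fun v => hL (h1 v)
    ext z
    refine hL ?_
    refine ext_inner_right ℝ fun z' => ?_
    calc inner ℝ (L (P z)) z' = inner ℝ z (L (P z')) := h3 z z'
      _ = inner ℝ z (L (pseudoinverse L (L (P z')))) := by rw [pseudoinverse_apply_apply hL]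
      _ = inner ℝ (L (pseudoinverse L z)) (L (P z')) := (inner_comp_pseudoinverse hL _ _).symm
      _ = inner ℝ (L (P (L (pseudoinverse L z)))) z' := (h3 _ _).symm
      _ = inner ℝ (L (pseudoinverse L z)) z' := by rw [hPL]
  · rintro rfl
    exact ⟨fun v => by rw [pseudoinverse_apply_apply hL], fun z => pseudoinverse_apply_apply hL _,
      inner_comp_pseudoinverse hL, fun v v' => by
        rw [pseudoinverse_apply_apply hL, pseudoinverse_apply_apply hL]⟩

/-- The inner product of the source plays no role when `L` is injective: `P L = id` makes the fourth
Penrose equation trivial, and the third concerns only the target. -/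
theorem comp_pseudoinverse_comp_equiv (hL : Function.Injective L) (e : E ≃L[ℝ] E) :
    (e : E →L[ℝ] E).comp (pseudoinverse (L.comp (e : E →L[ℝ] E))) = pseudoinverse L := by
  have hLe : Function.Injective (L.comp (e : E →L[ℝ] E)) := hL.comp e.injective
  have h : ∀ v, e (pseudoinverse (L.comp (e : E →L[ℝ] E)) (L v)) = v := fun v => by
    have := pseudoinverse_apply_apply hLe (e.symm v)
    simp only [ContinuousLinearMap.comp_apply, ContinuousLinearEquiv.coe_coe,
      e.apply_symm_apply] at this
    rw [this, e.apply_symm_apply]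
  refine (isMoorePenroseInverse_iff hL).1 ⟨fun v => ?_, fun z => ?_, fun z z' => ?_, fun v v' => ?_⟩
  · exact congrArg L (h v)
  · exact h _
  · exact inner_comp_pseudoinverse hLe z z'
  · exact (congrArg (fun w => inner ℝ w v') (h v)).trans (congrArg (fun w => inner ℝ v w) (h v')).symm

theorem contDiffAt_pseudoinverse (hL : Function.Injective L) :
    ContDiffAt ℝ ∞ (pseudoinverse : (E →L[ℝ] F) → F →L[ℝ] E) L := by
  have h0 : ContDiffAt ℝ ∞ (adjointCLM : (E →L[ℝ] F) → F →L[ℝ] E) L :=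
    ContinuousLinearMap.contDiff (E := E →L[ℝ] F) (F := F →L[ℝ] E) adjointCLM |>.contDiffAt
  have h1 : ContDiffAt ℝ ∞ (fun L : E →L[ℝ] F => (adjointCLM L).comp L) L :=
    h0.clm_comp contDiffAt_id
  obtain ⟨x, hx⟩ := isUnit_adjoint_comp hL
  have h2 : ContDiffAt ℝ ∞ (Ring.inverse : (E →L[ℝ] E) → E →L[ℝ] E) ((adjointCLM L).comp L) := by
    rw [← hx]; exact contDiffAt_ringInverse ℝ x
  exact (ContDiffAt.comp (f := fun L : E →L[ℝ] F => (adjointCLM L).comp L) L h2 h1).clm_comp h0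

theorem contDiffOn_pseudoinverse :
    ContDiffOn ℝ 1 (pseudoinverse : (E →L[ℝ] F) → F →L[ℝ] E) {L | Function.Injective L} :=
  fun _ hL => ((contDiffAt_pseudoinverse hL).of_le (by simp)).contDiffWithinAt

/-- Differentiation of `P(L) L = id`, an identity valid near `L` because injectivity is an open
condition. -/
theorem fderiv_pseudoinverse_comp (hL : Function.Injective L) (N : E →L[ℝ] F) :
    (fderiv ℝ pseudoinverse L N).comp L = -(pseudoinverse L).comp N := by
  have hd : HasFDerivAt (pseudoinverse : (E →L[ℝ] F) → F →L[ℝ] E) (fderiv ℝ pseudoinverse L) L :=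
    ((contDiffAt_pseudoinverse hL).differentiableAt (by simp)).hasFDerivAt
  have h1 := hd.clm_comp (hasFDerivAt_id L)
  have hc : HasFDerivAt (fun _ : E →L[ℝ] F => ContinuousLinearMap.id ℝ E)
      (0 : (E →L[ℝ] F) →L[ℝ] (E →L[ℝ] E)) L := hasFDerivAt_const _ _
  have h2 : HasFDerivAt (fun L : E →L[ℝ] F => (pseudoinverse L).comp L)
      (0 : (E →L[ℝ] F) →L[ℝ] (E →L[ℝ] E)) L := by
    refine hc.congr_of_eventuallyEq ?_
    filter_upwards [ContinuousLinearMap.isOpen_injective.mem_nhds hL] with L' hL'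
    exact pseudoinverse_comp hL'
  have h3 := DFunLike.congr_fun (h1.unique h2) N
  have h4 : (pseudoinverse L).comp N + (fderiv ℝ pseudoinverse L N).comp L = 0 := by
    simpa using h3
  exact eq_neg_of_add_eq_zero_right h4

end Pseudoinverse

/-! ### The differential as a bounded operator into continuous maps; openness of the immersions. -/

section DifferentialOperator

open scoped NNReal

variable {E : Type*} [NormedAddCommGroup E] [InnerProductSpace ℝ E]
    [FiniteDimensional ℝ E] [MeasurableSpace E] [BorelSpace E]
    {F : Type*} [NormedAddCommGroup F] [InnerProductSpace ℝ F] [FiniteDimensional ℝ F]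
    {H : Type*} [TopologicalSpace H] {I : ModelWithCorners ℝ E H}
    {M : Type*} [TopologicalSpace M] [ChartedSpace H M] [IsManifold I ∞ M] [T2Space M]
    {𝒰 : ChartCover I M} {p : ℝ≥0∞} [Fact (1 ≤ p)]

instance ChartCover.instCompactSpacePiece (𝒰 : ChartCover I M) (i : Fin 𝒰.size) :
    CompactSpace (𝒰.piece i) := isCompact_iff_compactSpace.1 (𝒰.isCompact_piece i)

theorem SobolevTwo.exists_rep (hn : (Module.finrank ℝ E : ℝ≥0∞) < p) (f : SobolevTwo 𝒰 p F) :
    ∃ f₀ : M → F, ContMDiff I 𝓘(ℝ, F) 1 f₀ ∧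
      ∃ ddf, HasLocalJets f.1 f₀ (diffForm I f₀) ddf := by
  obtain ⟨u, hu⟩ := f.2
  obtain ⟨du, ddu, h⟩ := isWeakJetOf_iff.1 hu
  obtain ⟨f₀, hf, hfu⟩ := h.exists_contMDiff hn
  exact ⟨f₀, hf, ddu, h.of_contMDiff hf hfu⟩

/-- The continuously differentiable representative of a function of class `W^{2,p}`, `p > n`. -/
noncomputable def SobolevTwo.rep (hn : (Module.finrank ℝ E : ℝ≥0∞) < p) (f : SobolevTwo 𝒰 p F) :
    M → F := (SobolevTwo.exists_rep hn f).choose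

variable (hn : (Module.finrank ℝ E : ℝ≥0∞) < p) (f g : SobolevTwo 𝒰 p F)

theorem SobolevTwo.contMDiff_rep : ContMDiff I 𝓘(ℝ, F) 1 (f.rep hn) :=
  (SobolevTwo.exists_rep hn f).choose_spec.1

theorem SobolevTwo.exists_hasLocalJets :
    ∃ ddf, HasLocalJets f.1 (f.rep hn) (diffForm I (f.rep hn)) ddf :=
  (SobolevTwo.exists_rep hn f).choose_spec.2

theorem SobolevTwo.ae_eq_rep (i : Fin 𝒰.size) : f.1.1 i =ᵐ[volume.restrict (𝒰.piece i)]
    (fun y => f.rep hn ((extChartAt I (𝒰.center i)).symm y)) := by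
  obtain ⟨ddf, h⟩ := f.exists_hasLocalJets hn
  exact (h.ae_eq i).1

variable {f} in
-- Continuous functions that agree almost everywhere are equal. This makes the chosen representative
-- depend linearly on the class.
theorem SobolevTwo.eq_rep {f₀ : M → F} (hf₀ : Continuous f₀)
    (h : ∀ i, f.1.1 i =ᵐ[volume.restrict (𝒰.piece i)]
      (fun y => f₀ ((extChartAt I (𝒰.center i)).symm y))) : f₀ = f.rep hn := by
  refine eq_of_chartAE_eq hf₀ (f.contMDiff_rep hn).continuous (chartAE_of_piece 𝒰 fun i => ?_)
  filter_upwards [h i, f.ae_eq_rep hn i] with y a b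
  rw [← a, b]

theorem SobolevTwo.rep_add : (f + g).rep hn = f.rep hn + g.rep hn := by
  symm
  refine SobolevTwo.eq_rep hn ((f.contMDiff_rep hn).continuous.add
    (g.contMDiff_rep hn).continuous) fun i => ?_
  filter_upwards [PieceLp.coeFn_add f.1.1 g.1.1 i, f.ae_eq_rep hn i, g.ae_eq_rep hn i] with y a b c
  refine a.trans ?_
  rw [b, c, Pi.add_apply]

theorem SobolevTwo.rep_smul (a : ℝ) : (a • f).rep hn = a • f.rep hn := by
  symm
  refine SobolevTwo.eq_rep hn ((f.contMDiff_rep hn).continuous.const_smul a) fun i => ?_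
  filter_upwards [PieceLp.coeFn_smul a f.1.1 i, f.ae_eq_rep hn i] with y b c
  refine b.trans ?_
  rw [c, Pi.smul_apply]

theorem chartForm_diffForm_add {f g : M → F} (hf : ContMDiff I 𝓘(ℝ, F) 1 f)
    (hg : ContMDiff I 𝓘(ℝ, F) 1 g) {c : M} {y : E} (hy : y ∈ (extChartAt I c).target) :
    chartForm I (diffForm I (f + g)) c y =
      chartForm I (diffForm I f) c y + chartForm I (diffForm I g) c y := by
  have hfg : ContMDiff I 𝓘(ℝ, F) 1 (f + g) := hf.add hg
  rw [chartForm_diffForm hf hy, chartForm_diffForm hg hy, chartForm_diffForm hfg hy]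
  exact fderivWithin_add (uniqueDiffOn_target c y hy)
    ((contDiffOn_comp_symm hf c).differentiableOn one_ne_zero y hy)
    ((contDiffOn_comp_symm hg c).differentiableOn one_ne_zero y hy)

theorem chartForm_diffForm_smul {f : M → F} (hf : ContMDiff I 𝓘(ℝ, F) 1 f) (a : ℝ)
    {c : M} {y : E} (hy : y ∈ (extChartAt I c).target) :
    chartForm I (diffForm I (a • f)) c y = a • chartForm I (diffForm I f) c y := by
  have hfg : ContMDiff I 𝓘(ℝ, F) 1 (a • f) := (contDiff_const_smul a).contMDiff.comp hf
  rw [chartForm_diffForm hf hy, chartForm_diffForm hfg hy]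
  exact fderivWithin_const_smul (uniqueDiffOn_target c y hy)
    ((contDiffOn_comp_symm hf c).differentiableOn one_ne_zero y hy) a

/-- The differential of the continuously differentiable representative in the `i`-th chart of the
cover. -/
noncomputable def SobolevTwo.differential (i : Fin 𝒰.size) :
    SobolevTwo 𝒰 p F →L[ℝ] C(𝒰.piece i, E →L[ℝ] F) :=
  LinearMap.mkContinuousOfExistsBound
    { toFun := fun f => ⟨fun y => chartForm I (diffForm I (f.rep hn)) (𝒰.center i) y,
        ((continuousOn_chartForm_diffForm (f.contMDiff_rep hn) _).mono
          (𝒰.piece_subset i)).domRestrict⟩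
      map_add' := fun f g => by
        ext1 y
        simp only [SobolevTwo.rep_add, ContinuousMap.coe_mk, ContinuousMap.add_apply]
        exact chartForm_diffForm_add (f.contMDiff_rep hn) (g.contMDiff_rep hn)
          (𝒰.piece_subset i y.2)
      map_smul' := fun a f => by
        ext1 y
        simp only [SobolevTwo.rep_smul, ContinuousMap.coe_mk, ContinuousMap.smul_apply]
        exact chartForm_diffForm_smul (f.contMDiff_rep hn) a (𝒰.piece_subset i y.2) } (by
    obtain ⟨C, hC⟩ := exists_norm_chartForm_le (F := F) 𝒰 hn (𝒰.isCompact_piece i)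
      (𝒰.piece_subset i)
    refine ⟨C, fun f => ?_⟩
    obtain ⟨ddf, h⟩ := f.exists_hasLocalJets hn
    refine (ContinuousMap.norm_le _ (by positivity)).2 fun y => ?_
    have := hC f.1 (f.rep hn) ddf (f.contMDiff_rep hn) h y y.2
    have h2 : ‖chartForm I (diffForm I (f.rep hn)) (𝒰.center i) y‖₊ ≤ C * ‖f.1‖₊ := by
      rw [enorm_eq_nnnorm, enorm_eq_nnnorm] at this
      exact_mod_cast this
    exact_mod_cast h2)

theorem SobolevTwo.differential_apply (i : Fin 𝒰.size) (y : 𝒰.piece i) :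
    SobolevTwo.differential hn i f y = chartForm I (diffForm I (f.rep hn)) (𝒰.center i) y := rfl

theorem injective_chartForm_iff {σ : ∀ x : M, TangentSpace I x →L[ℝ] F} {c : M} {y : E}
    (hy : y ∈ (extChartAt I c).target) : Function.Injective (chartForm I σ c y) ↔
      Function.Injective (σ ((extChartAt I c).symm y)) := by
  obtain ⟨e, he⟩ := isInvertible_chartFrame hy
  have h : (chartForm I σ c y : E → F) = σ ((extChartAt I c).symm y) ∘ e := by
    funext w
    simp only [chartForm, ← he]
    rfl
  rw [h]
  exact EquivLike.injective_comp e _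

/-- The frames are invertible and the pieces cover `M`, so being an immersion becomes a condition on
finitely many continuous maps on compact spaces. -/
theorem SobolevTwo.mem_sobolevImm_iff : f ∈ SobolevImm 𝒰 p F ↔
    ∀ i y, Function.Injective (SobolevTwo.differential hn i f y) := by
  have key : (∀ x, Function.Injective (diffForm I (f.rep hn) x)) ↔
      ∀ i y, Function.Injective (SobolevTwo.differential hn i f y) := by
    constructor
    · intro h i y
      rw [SobolevTwo.differential_apply, injective_chartForm_iff (𝒰.piece_subset i y.2)]
      exact h _
    · intro h x
      obtain ⟨i, hi, hy⟩ := 𝒰.covers x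
      have := h i ⟨_, hy⟩
      rw [SobolevTwo.differential_apply, injective_chartForm_iff (𝒰.piece_subset i hy)] at this
      have h' : ∀ x', x' = x → Function.Injective (diffForm I (f.rep hn) x') →
          Function.Injective (diffForm I (f.rep hn) x) := by
        rintro _ rfl h; exact h
      exact h' _ ((extChartAt I (𝒰.center i)).left_inv hi) this
  rw [← key]
  constructor
  · rintro ⟨f₀, hw, hf₀, hinj⟩
    obtain ⟨du, ddu, h⟩ := isWeakJetOf_iff.1 hw
    rw [← SobolevTwo.eq_rep hn hf₀.continuous fun i => (h.ae_eq i).1]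
    exact hinj
  · intro h
    obtain ⟨ddf, hd⟩ := f.exists_hasLocalJets hn
    exact ⟨_, isWeakJetOf_iff.2 ⟨_, _, hd⟩, f.contMDiff_rep hn, h⟩

/-- Injective operators form an open set, and sending a compact space into an open set is an open
condition on continuous maps. The rest is continuity of the differential, where `p > n` enters. -/
theorem isOpen_sobolevImm (𝒰 : ChartCover I M) (hn : (Module.finrank ℝ E : ℝ≥0∞) < p) :
    IsOpen (SobolevImm 𝒰 p F) := by
  have h : SobolevImm 𝒰 p F = ⋂ i, SobolevTwo.differential hn i ⁻¹'
      {φ : C(𝒰.piece i, E →L[ℝ] F) | MapsTo φ univ {L | Function.Injective L}} := by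
    ext f
    rw [SobolevTwo.mem_sobolevImm_iff hn, mem_iInter]
    exact forall_congr' fun i => ⟨fun h y _ => h y, fun h y => h (mem_univ y)⟩
  rw [h]
  exact isOpen_iInter_of_finite fun i => (ContinuousMap.isOpen_setOfPred_mapsTo isCompact_univ
    ContinuousLinearMap.isOpen_injective).preimage (SobolevTwo.differential hn i).continuous

end DifferentialOperator

/-! ### The coordinate formula for the Hessian. -/

section HessianFormula

variable {E : Type*} [NormedAddCommGroup E] [InnerProductSpace ℝ E] [FiniteDimensional ℝ E]
    {F : Type*} [NormedAddCommGroup F] [InnerProductSpace ℝ F] [FiniteDimensional ℝ F]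

/-- The coordinate expression `D²u - Du ∘ P ∘ D²f` of the Hessian. -/
noncomputable def hessCoord (a : E →L[ℝ] F) (d : E →L[ℝ] E →L[ℝ] F) (P : F →L[ℝ] E)
    (e : E →L[ℝ] E →L[ℝ] F) : E →L[ℝ] E →L[ℝ] F :=
  d - (ContinuousLinearMap.compL ℝ E F F (a.comp P)).comp e

theorem hessCoord_apply (a : E →L[ℝ] F) (d : E →L[ℝ] E →L[ℝ] F) (P : F →L[ℝ] E)
    (e : E →L[ℝ] E →L[ℝ] F) (w w' : E) : hessCoord a d P e w w' = d w w' - a (P (e w w')) := by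
  simp [hessCoord]

/-- The derivative of `Du ∘ (Df)†`, expressed by the values `a`, `L` of `Du`, `Df` and the second
derivatives `d`, `e` of `u`, `f`. -/
noncomputable def compPseudoinverseDeriv (a : E →L[ℝ] F) (d : E →L[ℝ] E →L[ℝ] F) (L : E →L[ℝ] F)
    (e : E →L[ℝ] E →L[ℝ] F) : E →L[ℝ] F →L[ℝ] F :=
  (ContinuousLinearMap.compL ℝ F E F).precompR E a ((fderiv ℝ pseudoinverse L).comp e) +
    (ContinuousLinearMap.compL ℝ F E F).precompL E d (pseudoinverse L)

/-- On the range of `L` the derivative of the pseudoinverse reduces to `-P e`, by differentiating `P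
L = id`, and `P L w' = w'` simplifies the other term. -/
theorem compPseudoinverseDeriv_apply (a : E →L[ℝ] F) (d : E →L[ℝ] E →L[ℝ] F) {L : E →L[ℝ] F}
    (hL : Function.Injective L) (e : E →L[ℝ] E →L[ℝ] F) (w w' : E) :
    compPseudoinverseDeriv a d L e w (L w') = hessCoord a d (pseudoinverse L) e w w' := by
  have h := DFunLike.congr_fun (fderiv_pseudoinverse_comp hL (e w)) w'
  have h' : fderiv ℝ pseudoinverse L (e w) (L w') = -pseudoinverse L (e w w') := h
  rw [hessCoord_apply]
  have : compPseudoinverseDeriv a d L e w (L w') =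
      a (fderiv ℝ pseudoinverse L (e w) (L w')) + d w (pseudoinverse L (L w')) := by
    simp [compPseudoinverseDeriv]
  rw [this, h', pseudoinverse_apply_apply hL, map_neg]
  abel

/-- The frame `φ` cancels against its inverse in the pseudoinverse, so `du df†` has the expression
`Du (Df)†` in every chart. -/
theorem comp_pseudoinverse_eq (a : E →L[ℝ] F) {L : E →L[ℝ] F} (hL : Function.Injective L)
    {φ : E →L[ℝ] E} (hφ : φ.IsInvertible) :
    a.comp (pseudoinverse L) = (a.comp φ).comp (pseudoinverse (L.comp φ)) := by
  obtain ⟨e, rfl⟩ := hφ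
  rw [ContinuousLinearMap.comp_assoc, comp_pseudoinverse_comp_equiv hL e]

end HessianFormula

/-! ### Existence, symmetry and uniqueness of the Hessian. -/

section Hessian

variable {E : Type*} [NormedAddCommGroup E] [InnerProductSpace ℝ E]
    [FiniteDimensional ℝ E] [MeasurableSpace E] [BorelSpace E]
    {F : Type*} [NormedAddCommGroup F] [InnerProductSpace ℝ F] [FiniteDimensional ℝ F]
    {H : Type*} [TopologicalSpace H] {I : ModelWithCorners ℝ E H}
    {M : Type*} [TopologicalSpace M] [ChartedSpace H M] [IsManifold I ∞ M] [T2Space M]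
    {𝒰 : ChartCover I M} {p r : ℝ≥0∞} [Fact (1 ≤ p)] [Fact (1 ≤ r)]

/-- The pseudoinverse of a section of injective homomorphisms `TM → F`. -/
noncomputable def formInverse (σ : ∀ x : M, TangentSpace I x →L[ℝ] F) (x : M) :
    F →L[ℝ] TangentSpace I x :=
  pseudoinverse (E := E) (σ x)

theorem comp_formInverse {σ ρ : ∀ x : M, TangentSpace I x →L[ℝ] F} {c : M} {y : E}
    (hy : y ∈ (extChartAt I c).target)
    (hinj : Function.Injective (σ ((extChartAt I c).symm y))) :
    (ρ ((extChartAt I c).symm y)).comp (formInverse σ ((extChartAt I c).symm y)) =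
      (chartForm I ρ c y).comp (pseudoinverse (chartForm I σ c y)) := by
  exact comp_pseudoinverse_eq (E := E) (ρ ((extChartAt I c).symm y)) hinj
    (isInvertible_chartFrame hy)

variable {tf : LocalJets 𝒰 p F} {tu : LocalJets 𝒰 r F} {f u : M → F}
    {du : ∀ x : M, TangentSpace I x →L[ℝ] F} {ddf ddu : M → E → E →L[ℝ] E →L[ℝ] F}

section Fixed

variable (hn : (Module.finrank ℝ E : ℝ≥0∞) < p) (hf : ContMDiff I 𝓘(ℝ, F) 1 f)
    (hinj : ∀ x, Function.Injective (diffForm I f x)) (hjf : HasLocalJets tf f (diffForm I f) ddf)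
    (hju : HasLocalJets tu u du ddu)
include hn hf hinj hjf hju

/-- The chain rule shows that `P ∘ Df` is of class `W^{1,p}`; the product rule is then applied to it
and `Du`, which is of class `W^{1,1}`. By locality, balls in the interior of the chart are enough.
-/
theorem hasWeakFDerivOn_comp_formInverse (c : M) :
    HasWeakFDerivOn (interior (extChartAt I c).target)
      (fun y => (du ((extChartAt I c).symm y)).comp
        (formInverse (diffForm I f) ((extChartAt I c).symm y)))
      (fun y => compPseudoinverseDeriv (chartForm I du c y) (ddu c y)
        (chartForm I (diffForm I f) c y) (ddf c y)) := by
  have hp : 1 ≤ p := Fact.out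
  have hr : 1 ≤ r := Fact.out
  refine HasWeakFDerivOn.of_forall_exists fun y hy => ?_
  obtain ⟨ε, hε, hK⟩ := Metric.nhds_basis_closedBall.mem_iff.1 (isOpen_interior.mem_nhds hy)
  set K := Metric.closedBall y ε
  have hKs : IsSolidConvex K := isSolidConvex_closedBall y hε
  have hfin := hKs.isFiniteMeasure
  have hKt : K ⊆ (extChartAt I c).target := hK.trans interior_subset
  have hKi : interior K ⊆ interior (extChartAt I c).target := interior_mono hKt
  refine ⟨interior K, isOpen_interior,
    Metric.ball_subset_interior_closedBall (Metric.mem_ball_self hε), ?_⟩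
  have hmaps : MapsTo (chartForm I (diffForm I f) c) K {L | Function.Injective L} := fun z hz =>
    (injective_chartForm_iff (hKt hz)).2 (hinj _)
  have hcont := (continuousOn_chartForm_diffForm hf c).mono hKt
  have hwf := (hjf.hasWeakFDerivOn c).mono hKi
  have hddf := hjf.memLp_second hKs.isCompact hKt
  have h1 := hKs.hasWeakFDerivOn_comp hp hn ContinuousLinearMap.isOpen_injective
    contDiffOn_pseudoinverse hcont hmaps hwf hddf
  have hPc : ContinuousOn (fun z => pseudoinverse (chartForm I (diffForm I f) c z)) K :=
    contDiffOn_pseudoinverse.continuousOn.comp hcont hmaps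
  have hDPc : ContinuousOn (fun z => fderiv ℝ pseudoinverse (chartForm I (diffForm I f) c z)) K :=
    (contDiffOn_pseudoinverse.continuousOn_fderiv_of_isOpen ContinuousLinearMap.isOpen_injective
      le_rfl).comp hcont hmaps
  have h2 : MemLp (fun z => (fderiv ℝ pseudoinverse (chartForm I (diffForm I f) c z)).comp
      (ddf c z)) p (volume.restrict K) := by
    obtain ⟨D, hD⟩ := hKs.isCompact.exists_bound_of_continuousOn hDPc
    refine hddf.of_le_mul (c := D) ((ContinuousLinearMap.compL ℝ E (E →L[ℝ] F)
      (F →L[ℝ] E)).aestronglyMeasurable_comp₂ (hDPc.aestronglyMeasurable_of_isCompact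
        hKs.isCompact hKs.isCompact.measurableSet) hddf.1) ?_
    filter_upwards [ae_restrict_mem hKs.isCompact.measurableSet] with z hz
    exact (ContinuousLinearMap.opNorm_comp_le _ _).trans
      (mul_le_mul_of_nonneg_right (hD z hz) (norm_nonneg _))
  have h3 := hKs.hasWeakFDerivOn_bilin (ContinuousLinearMap.compL ℝ F E F) hp hn
    ((hju.hasWeakFDerivOn c).mono hKi) h1
    ((hju.memLp_chartForm hKs.isCompact hKt).mono_exponent hr)
    ((hju.memLp_second hKs.isCompact hKt).mono_exponent hr)
    (memLp_restrict_of_continuousOn hKs.isCompact hPc p) h2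
  refine h3.congr isOpen_interior.measurableSet ?_ (EventuallyEq.refl _ _)
  filter_upwards [ae_restrict_mem isOpen_interior.measurableSet] with z hz
  exact (comp_formInverse (hKt (interior_subset hz)) (hinj _)).symm

theorem exists_hasWeakDifferential_comp_formInverse :
    ∃ dA : ∀ x : M, TangentSpace I x →L[ℝ] (F →L[ℝ] F),
      HasWeakDifferential I (fun x => (du x).comp (formInverse (diffForm I f) x)) dA ∧
      ∀ c, ∀ᵐ y ∂(volume.restrict (extChartAt I c).target), ∀ w w',
        chartForm I dA c y w (chartForm I (diffForm I f) c y w') =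
          hessCoord (chartForm I du c y) (ddu c y)
            (pseudoinverse (chartForm I (diffForm I f) c y)) (ddf c y) w w' := by
  obtain ⟨dA, h1, h2⟩ := exists_hasWeakDifferential 𝒰
    (u := fun x => (du x).comp (formInverse (diffForm I f) x))
    (v := fun c y => compPseudoinverseDeriv (chartForm I du c y) (ddu c y)
        (chartForm I (diffForm I f) c y) (ddf c y))
    (hasWeakFDerivOn_comp_formInverse hn hf hinj hjf hju)
  refine ⟨dA, h1, fun c => ?_⟩
  filter_upwards [h2 c, ae_restrict_mem (measurableSet_target c)] with y hy hyc w w'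
  rw [hy, compPseudoinverseDeriv_apply _ _ ((injective_chartForm_iff hyc).2 (hinj _))]

/-- The Hessian exists, is symmetric, and is given by the coordinate formula. -/
theorem exists_isHessian :
    ∃ S : ∀ x : M, TangentSpace I x →L[ℝ] TangentSpace I x →L[ℝ] F,
      (∀ x X Y, S x X Y = S x Y X) ∧ IsHessian I f u S := by
  obtain ⟨dA, h1, h2⟩ := exists_hasWeakDifferential_comp_formInverse hn hf hinj hjf hju
  let β : ∀ x : M, E →L[ℝ] E →L[ℝ] F := fun x =>
    ((ContinuousLinearMap.compL ℝ E F F).flip (diffForm I f x : E →L[ℝ] F)).comp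
      (dA x : E →L[ℝ] F →L[ℝ] F)
  have hβ : ∀ x (X Y : E), β x X Y = (dA x : E →L[ℝ] F →L[ℝ] F) X
    ((diffForm I f x : E →L[ℝ] F) Y) := fun x X Y => rfl
  have hsymm : ChartAE I fun x => ∀ X Y : E, β x X Y = β x Y X := by
    intro c
    -- In the formula `D²u - Du P D²f` symmetry of the second weak derivatives of both `u` and `f`
    -- is used.
    have s1 := (hju.hasWeakDifferential c).ae_symm isOpen_interior (hju.hasWeakFDerivOn c)
    have s2 := (hjf.hasWeakDifferential c).ae_symm isOpen_interior (hjf.hasWeakFDerivOn c)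
    rw [restrict_interior_target] at s1 s2
    filter_upwards [h2 c, s1, s2, ae_restrict_mem (measurableSet_target c)] with y hy a b hyc X Y
    obtain ⟨e, he⟩ := isInvertible_chartFrame hyc
    have h3 : ∀ w w', β ((extChartAt I c).symm y) (e w) (e w') =
        hessCoord (chartForm I du c y) (ddu c y)
            (pseudoinverse (chartForm I (diffForm I f) c y)) (ddf c y) w w' := by
      intro w w'
      rw [← hy w w']
      simp only [chartForm, ← he]
      rfl
    obtain ⟨w, rfl⟩ := e.surjective X
    obtain ⟨w', rfl⟩ := e.surjective Y
    rw [h3, h3, hessCoord_apply, hessCoord_apply, a w w', b w w']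
  -- `β` is symmetric only almost everywhere, while a section of the bundle of symmetric forms has
  -- to be symmetric at each point; symmetrization changes `β` on a null set only.
  let S : ∀ x : M, TangentSpace I x →L[ℝ] TangentSpace I x →L[ℝ] F := fun x =>
    (2⁻¹ : ℝ) • (β x + (β x).flip)
  have hS : ∀ x (X Y : E), (S x : E →L[ℝ] E →L[ℝ] F) X Y = (2⁻¹ : ℝ) • (β x X Y + β x Y X) :=
    fun _ _ _ => rfl
  refine ⟨S, fun x X Y => ?_, diffForm I f, du, formInverse (diffForm I f), dA,
    hasWeakDifferential_diffForm hf, hju.hasWeakDifferential, fun c => ?_, h1, ?_⟩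
  · exact (hS x X Y).trans ((congrArg _ (add_comm _ _)).trans (hS x Y X).symm)
  · exact Eventually.of_forall fun y => (isMoorePenroseInverse_iff (E := E) (F := F) (hinj _)).2 rfl
  · refine hsymm.mono fun x hx X Y => ?_
    refine (hS x X Y).trans ?_
    rw [← hx X Y, ← two_smul ℝ (β x X Y), smul_smul, inv_mul_cancel₀ two_ne_zero, one_smul]
    rfl

/-- The coordinate expression of a Hessian. -/
theorem IsHessian.chartBilin_ae_eq {f' u' : M → F}
    {S : ∀ x : M, TangentSpace I x →L[ℝ] TangentSpace I x →L[ℝ] F} (h : IsHessian I f' u' S)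
    (hf' : ChartAE I fun x => f' x = f x) (hu' : ChartAE I fun x => u' x = u x) (c : M) :
    chartBilin I S c =ᵐ[volume.restrict (extChartAt I c).target] fun y =>
      hessCoord (chartForm I du c y) (ddu c y)
        (pseudoinverse (chartForm I (diffForm I f) c y)) (ddf c y) := by
  obtain ⟨dA, h1, h2⟩ := exists_hasWeakDifferential_comp_formInverse hn hf hinj hjf hju
  obtain ⟨df', du', Q, dA', hdf, hdu, hQ, hA, hS⟩ := h
  have e1 := hdf.chartAE_eq (hasWeakDifferential_diffForm hf) hf'
  have e2 := hdu.chartAE_eq hju.hasWeakDifferential hu'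
  have e3 : ChartAE I fun x => (du' x).comp (Q x) =
      (du x).comp (formInverse (diffForm I f) x) := by
    refine ((e1.and e2).and hQ).mono ?_
    rintro x ⟨⟨a, b⟩, hq⟩
    rw [a] at hq
    have hq' := (isMoorePenroseInverse_iff (E := E) (F := F) (hinj x)).1 hq
    rw [b]
    exact congrArg (du x : E →L[ℝ] F).comp hq'
  have e4 := hA.chartAE_eq h1 e3
  filter_upwards [e1 c, e4 c, hS c, h2 c] with y a b hs hy
  ext w w'
  rw [← hy w w']
  refine (hs _ _).trans ?_
  rw [a, b]
  rfl

end Fixed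

end Hessian

/-! ### Symmetrized pullback of bilinear forms. -/

section SymPull

variable {E : Type*} [NormedAddCommGroup E] [NormedSpace ℝ E]
    {F : Type*} [NormedAddCommGroup F] [NormedSpace ℝ F]

/-- The symmetrized pullback of a bilinear form. -/
noncomputable def symPull (B : E →L[ℝ] E →L[ℝ] F) (ψ : E →L[ℝ] E) : E →L[ℝ] E →L[ℝ] F :=
  (2⁻¹ : ℝ) • (((B.comp ψ).flip.comp ψ).flip + (B.comp ψ).flip.comp ψ)

theorem symPull_apply (B : E →L[ℝ] E →L[ℝ] F) (ψ : E →L[ℝ] E) (X Y : E) :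
    symPull B ψ X Y = (2⁻¹ : ℝ) • (B (ψ X) (ψ Y) + B (ψ Y) (ψ X)) := rfl

theorem symPull_add (B B' : E →L[ℝ] E →L[ℝ] F) (ψ : E →L[ℝ] E) :
    symPull (B + B') ψ = symPull B ψ + symPull B' ψ := by
  ext X Y
  simp only [symPull_apply, add_apply, ← smul_add]
  congr 1
  abel

theorem symPull_smul (a : ℝ) (B : E →L[ℝ] E →L[ℝ] F) (ψ : E →L[ℝ] E) :
    symPull (a • B) ψ = a • symPull B ψ := by
  ext X Y
  simp only [symPull_apply, smul_apply, ← smul_add]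
  rw [smul_comm]

theorem norm_symPull_le (B : E →L[ℝ] E →L[ℝ] F) (ψ : E →L[ℝ] E) :
    ‖symPull B ψ‖ ≤ ‖ψ‖ ^ 2 * ‖B‖ := by
  refine ContinuousLinearMap.opNorm_le_bound₂ _ (by positivity) fun X Y => ?_
  have h : ∀ X Y, ‖B (ψ X) (ψ Y)‖ ≤ ‖ψ‖ ^ 2 * ‖B‖ * (‖X‖ * ‖Y‖) := fun X Y => by
    calc ‖B (ψ X) (ψ Y)‖ ≤ ‖B‖ * (‖ψ‖ * ‖X‖) * (‖ψ‖ * ‖Y‖) := by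
          refine (B.le_opNorm₂ _ _).trans ?_
          gcongr <;> exact ψ.le_opNorm _
      _ = _ := by ring
  rw [symPull_apply, norm_smul, Real.norm_of_nonneg (by norm_num)]
  have h1 := h X Y
  have h2 := h Y X
  have h3 := norm_add_le (B (ψ X) (ψ Y)) (B (ψ Y) (ψ X))
  rw [mul_comm ‖Y‖] at h2
  linarith

theorem continuous_symPull :
    Continuous fun x : (E →L[ℝ] E →L[ℝ] F) × (E →L[ℝ] E) => symPull x.1 x.2 := by
  have h1 : Continuous fun x : (E →L[ℝ] E →L[ℝ] F) × (E →L[ℝ] E) => x.1.comp x.2 :=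
    continuous_fst.clm_comp continuous_snd
  have hfl : Continuous (ContinuousLinearMap.flip : (E →L[ℝ] E →L[ℝ] F) → _) :=
    (ContinuousLinearMap.flipₗᵢ ℝ E E F).continuous
  have h2 : Continuous fun x : (E →L[ℝ] E →L[ℝ] F) × (E →L[ℝ] E) =>
      (x.1.comp x.2).flip.comp x.2 := (hfl.comp h1).clm_comp continuous_snd
  exact ((hfl.comp h2).add h2).const_smul (2⁻¹ : ℝ)

end SymPull

/-! ### A bounded projection onto the sections of `Sym²(TM; F)`. -/

section Retraction

open scoped NNReal

variable {E : Type*} [NormedAddCommGroup E] [InnerProductSpace ℝ E]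
    [FiniteDimensional ℝ E] [MeasurableSpace E] [BorelSpace E]
    {F : Type*} [NormedAddCommGroup F] [InnerProductSpace ℝ F]
    {H : Type*} [TopologicalSpace H] {I : ModelWithCorners ℝ E H}
    {M : Type*} [TopologicalSpace M] [ChartedSpace H M] [IsManifold I ∞ M]
    {q : ℝ≥0∞} {c : M} {y : E}

/-- The section of `Sym²(TM; F)` obtained from coordinate expressions on the pieces of a cover,
where at each point the first piece which contains it is used. -/
noncomputable def glueSym (𝒰 : ChartCover I M) (w : Fin 𝒰.size → E → E →L[ℝ] E →L[ℝ] F) (x : M) :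
    TangentSpace I x →L[ℝ] TangentSpace I x →L[ℝ] F :=
  symPull (E := E) (w (𝒰.index x) (extChartAt I (𝒰.center (𝒰.index x)) x))
    (chartFrame I (𝒰.center (𝒰.index x)) (extChartAt I (𝒰.center (𝒰.index x)) x) :
      E →L[ℝ] E).inverse

theorem glueSym_symm (𝒰 : ChartCover I M) (w : Fin 𝒰.size → E → E →L[ℝ] E →L[ℝ] F) (x : M)
    (X Y : TangentSpace I x) : glueSym 𝒰 w x X Y = glueSym 𝒰 w x Y X := by
  have h : ∀ (B : E →L[ℝ] E →L[ℝ] F) (ψ : E →L[ℝ] E) (X Y : E),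
      symPull B ψ X Y = symPull B ψ Y X := fun B ψ X Y => by
    rw [symPull_apply, symPull_apply, add_comm]
  exact h _ _ X Y

theorem glueSym_add (𝒰 : ChartCover I M) (w w' : Fin 𝒰.size → E → E →L[ℝ] E →L[ℝ] F) (x : M) :
    glueSym 𝒰 (fun i y => w i y + w' i y) x = glueSym 𝒰 w x + glueSym 𝒰 w' x :=
  symPull_add (E := E) _ _ _

theorem glueSym_smul (𝒰 : ChartCover I M) (a : ℝ) (w : Fin 𝒰.size → E → E →L[ℝ] E →L[ℝ] F)
    (x : M) : glueSym 𝒰 (fun i y => a • w i y) x = a • glueSym 𝒰 w x :=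
  symPull_smul (E := E) _ _ _

theorem inverse_chartFrame_apply {c c' : M} (hy : y ∈ overlap I c c') (w : E) :
    (chartFrame I c' (coordChange I c c' y) : E →L[ℝ] E).inverse
      ((chartFrame I c y : E →L[ℝ] E) w) = coordDeriv I c c' y w := by
  rw [DFunLike.congr_fun (chartFrame_coordChange hy) w]
  exact (ContinuousLinearMap.IsInvertible.inverse_apply_eq
    (isInvertible_chartFrame (mapsTo_coordChange _ _ hy).1)).2 rfl

theorem ChartCover.mem_overlap_index (𝒰 : ChartCover I M) (hy : y ∈ (extChartAt I c).target) :
    y ∈ overlap I c (𝒰.center (𝒰.index ((extChartAt I c).symm y))) :=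
  ⟨hy, (𝒰.index_spec _).1⟩

/-- The inverse frame of one chart composed with the frame of the other is the derivative of the
coordinate change. -/
theorem chartBilin_glueSym (𝒰 : ChartCover I M) (w : Fin 𝒰.size → E → E →L[ℝ] E →L[ℝ] F)
    (hy : y ∈ (extChartAt I c).target) {j : Fin 𝒰.size}
    (hj : 𝒰.index ((extChartAt I c).symm y) = j) :
    chartBilin I (glueSym 𝒰 w) c y = symPull (w j (coordChange I c (𝒰.center j) y))
      (coordDeriv I c (𝒰.center j) y) := by
  subst hj
  have h := inverse_chartFrame_apply (𝒰.mem_overlap_index hy)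
  ext X Y
  rw [symPull_apply, ← h X, ← h Y]
  rfl

theorem chartBilin_glueSym_congr (𝒰 : ChartCover I M)
    {w w' : Fin 𝒰.size → E → E →L[ℝ] E →L[ℝ] F}
    (h : ∀ i, w i =ᵐ[volume.restrict (𝒰.piece i)] w' i) (c : M) :
    chartBilin I (glueSym 𝒰 w) c =ᵐ[volume.restrict (extChartAt I c).target]
      chartBilin I (glueSym 𝒰 w') c := by
  have h1 : ∀ i, ∀ᵐ y ∂(volume.restrict (extChartAt I c).target), y ∈ overlap I c (𝒰.center i) →
      coordChange I c (𝒰.center i) y ∈ 𝒰.piece i → w i (coordChange I c (𝒰.center i) y) =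
        w' i (coordChange I c (𝒰.center i) y) := by
    intro i
    have h2 : ∀ᵐ z ∂(volume.restrict (overlap I (𝒰.center i) c)), z ∈ 𝒰.piece i → w i z = w' i z :=
      ae_restrict_of_ae ((ae_restrict_iff' (𝒰.isCompact_piece i).measurableSet).1 (h i))
    have h3 := ae_coordChange h2
    rw [ae_restrict_iff' (measurableSet_overlap _ _)] at h3
    exact ae_restrict_of_ae h3
  filter_upwards [ae_all_iff.2 h1, ae_restrict_mem (measurableSet_target c)] with y hy hyc
  rw [chartBilin_glueSym 𝒰 w hyc rfl, chartBilin_glueSym 𝒰 w' hyc rfl,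
    hy _ (𝒰.mem_overlap_index hyc) (𝒰.index_spec _).2]

/-- Coordinate expressions of a section are compatible, so the choice of piece does not matter, and
symmetrization does nothing to a symmetric form. Hence gluing is a projection. -/
theorem chartBilin_glueSym_chartBilin (𝒰 : ChartCover I M)
    {S : ∀ x : M, TangentSpace I x →L[ℝ] TangentSpace I x →L[ℝ] F}
    (hS : ∀ x X Y, S x X Y = S x Y X) (hy : y ∈ (extChartAt I c).target) :
    chartBilin I (glueSym 𝒰 fun i => chartBilin I S (𝒰.center i)) c y = chartBilin I S c y := by
  rw [chartBilin_glueSym 𝒰 _ hy rfl]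
  ext X Y
  rw [symPull_apply, ← chartBilin_coordChange S (𝒰.mem_overlap_index hy),
    ← chartBilin_coordChange S (𝒰.mem_overlap_index hy)]
  have h : chartBilin I S c y Y X = chartBilin I S c y X Y := hS _ _ _
  rw [h, ← two_smul ℝ, smul_smul, inv_mul_cancel₀ two_ne_zero, one_smul]

/-- Since the first suitable piece is used, the set is one compact trace minus the traces of the
earlier pieces. -/
theorem ChartCover.measurableSet_index [T2Space M] (𝒰 : ChartCover I M) {K : Set E}
    (hK : IsCompact K) (hKc : K ⊆ (extChartAt I c).target) (j : Fin 𝒰.size) :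
    MeasurableSet {y ∈ K | 𝒰.index ((extChartAt I c).symm y) = j} := by
  have h : {y ∈ K | 𝒰.index ((extChartAt I c).symm y) = j} =
      𝒰.trace c K j \ ⋃ k, ⋃ _ : k < j, 𝒰.trace c K k := by
    ext y
    simp only [mem_ofPred_eq, 𝒰.index_eq_iff, ChartCover.trace, Set.mem_sdiff, mem_iUnion, not_exists,
      coordChange]
    constructor
    · rintro ⟨hy, h1, h2⟩
      exact ⟨⟨hy, h1⟩, fun k hk h => h2 k hk h.2⟩
    · rintro ⟨⟨hy, h1⟩, h2⟩
      exact ⟨hy, h1, fun k hk h => h2 k hk ⟨hy, h⟩⟩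
  rw [h]
  exact (𝒰.isCompact_trace hK hKc j).measurableSet.diff (MeasurableSet.iUnion fun k =>
    MeasurableSet.iUnion fun _ => (𝒰.isCompact_trace hK hKc k).measurableSet)

theorem exists_eLpNorm_glueSym_le [T2Space M] (𝒰 : ChartCover I M) (q : ℝ≥0∞) [Fact (1 ≤ q)]
    {K : Set E} (hK : IsCompact K) (hKc : K ⊆ (extChartAt I c).target) :
    ∃ C : ℝ≥0, ∀ t : PieceLp 𝒰 q (E →L[ℝ] E →L[ℝ] F),
      AEStronglyMeasurable (chartBilin I (glueSym 𝒰 fun i => t i) c) (volume.restrict K) ∧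
      eLpNorm (chartBilin I (glueSym 𝒰 fun i => t i) c) q (volume.restrict K) ≤ C * ‖t‖ₑ := by
  have hq : 1 ≤ q := Fact.out
  set A : Fin 𝒰.size → Set E := fun j => {y ∈ K | 𝒰.index ((extChartAt I c).symm y) = j} with hAdef
  have hAm : ∀ j, MeasurableSet (A j) := 𝒰.measurableSet_index hK hKc
  have hAt : ∀ j, A j ⊆ 𝒰.trace c K j := fun j y hy => by
    have := 𝒰.mem_trace_index (c := c) hy.1
    rwa [hy.2] at this
  have hAK : K ⊆ ⋃ j, A j := fun y hy => mem_iUnion.2 ⟨_, hy, rfl⟩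
  have hTc := 𝒰.isCompact_trace (c := c) hK hKc
  have hTo := 𝒰.trace_subset_overlap (c := c) hKc
  choose C hC using fun j => exists_map_coordChange_le (hTc j) (hTo j) (𝒰.mapsTo_trace c K j)
  choose D hD using fun j => (hTc j).exists_bound_of_continuousOn
    ((continuousOn_coordDeriv c (𝒰.center j)).mono (hTo j))
  have hτm : ∀ j, AEMeasurable (coordChange I c (𝒰.center j)) (volume.restrict (𝒰.trace c K j)) :=
    fun j => aemeasurable_coordChange (hTc j).measurableSet (hTo j)
  have hmono : ∀ j, (volume.restrict (A j) : Measure E) ≤ volume.restrict (𝒰.trace c K j) :=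
    fun j => Measure.restrict_mono (hAt j) le_rfl
  -- The pullback of a bilinear form is quadratic in the derivative of the coordinate change, whence
  -- `D j ^ 2`; the factor `1 + C j` is that of the change of variables.
  refine ⟨∑ j, (D j ^ 2).toNNReal * (1 + C j), fun t => ?_⟩
  have htm : ∀ j, AEStronglyMeasurable (fun y => t j (coordChange I c (𝒰.center j) y))
      (volume.restrict (𝒰.trace c K j)) := fun j =>
    aestronglyMeasurable_comp_of_map_le (hτm j) (hC j) (Lp.aestronglyMeasurable (t j))
  have hform : ∀ j, chartBilin I (glueSym 𝒰 fun i => t i) c =ᵐ[volume.restrict (A j)] fun y =>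
      symPull (t j (coordChange I c (𝒰.center j) y)) (coordDeriv I c (𝒰.center j) y) := fun j => by
    filter_upwards [ae_restrict_mem (hAm j)] with y hy
    exact chartBilin_glueSym 𝒰 _ (hKc hy.1) hy.2
  have hmeas : ∀ j, AEStronglyMeasurable (chartBilin I (glueSym 𝒰 fun i => t i) c)
      (volume.restrict (A j)) := fun j => by
    refine AEStronglyMeasurable.congr ?_ (hform j).symm
    have hd := ((continuousOn_coordDeriv (I := I) c (𝒰.center j)).mono
      (hTo j)).aestronglyMeasurable_of_isCompact (μ := volume) (hTc j) (hTc j).measurableSet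
    exact (continuous_symPull.comp_aestronglyMeasurable ((htm j).prodMk hd)).mono_measure (hmono j)
  refine ⟨(aestronglyMeasurable_iUnion_iff.2 hmeas).mono_measure (Measure.restrict_mono hAK le_rfl),
    (eLpNorm_restrict_le_sum hAm hAK hq hmeas).trans ?_⟩
  push_cast
  rw [Finset.sum_mul]
  refine Finset.sum_le_sum fun j _ => ?_
  calc eLpNorm (chartBilin I (glueSym 𝒰 fun i => t i) c) q (volume.restrict (A j))
      ≤ ENNReal.ofReal (D j ^ 2) * eLpNorm (fun y => t j (coordChange I c (𝒰.center j) y)) q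
          (volume.restrict (A j)) := by
        refine eLpNorm_le_mul_eLpNorm_of_ae_le_mul ?_ q
        filter_upwards [hform j, ae_restrict_mem (hAm j)] with y hy hyA
        rw [hy]
        refine (norm_symPull_le _ _).trans ?_
        have := hD j y (hAt j hyA)
        gcongr
    _ ≤ ENNReal.ofReal (D j ^ 2) * ((1 + C j) * ‖t‖ₑ) := by
        gcongr
        refine (eLpNorm_mono_measure _ (hmono j)).trans ((eLpNorm_comp_le (hτm j) (hC j)
          (Lp.aestronglyMeasurable (t j)) hq).trans ?_)
        gcongr
        exact enorm_piece_le t j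
    _ = _ := by
        rw [ENNReal.ofReal]; ring

/-- A continuous linear projection of the coordinate expressions of class `L^q` onto those of
sections of `Sym²(TM; F)`. -/
theorem exists_symForms_retraction [T2Space M] (𝒰 : ChartCover I M) (q : ℝ≥0∞) [Fact (1 ≤ q)] :
    ∃ R : PieceLp 𝒰 q (E →L[ℝ] E →L[ℝ] F) →L[ℝ] LebesgueSym 𝒰 q F, ∀ s : LebesgueSym 𝒰 q F,
      R s.1 = s := by
  choose C hC using fun i => exists_eLpNorm_glueSym_le (F := F) 𝒰 q (𝒰.isCompact_piece i)
    (𝒰.piece_subset i)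
  have hmem : ∀ (t : PieceLp 𝒰 q (E →L[ℝ] E →L[ℝ] F)) i,
      MemLp (chartBilin I (glueSym 𝒰 fun i => t i) (𝒰.center i)) q
        (volume.restrict (𝒰.piece i)) := fun t i =>
    ⟨(hC i t).1, (hC i t).2.trans_lt (ENNReal.mul_lt_top (by simp) (by simp))⟩
  let R₀ : PieceLp 𝒰 q (E →L[ℝ] E →L[ℝ] F) → PieceLp 𝒰 q (E →L[ℝ] E →L[ℝ] F) :=
    fun t i => (hmem t i).toLp _
  have hR₀ : ∀ t i, R₀ t i =ᵐ[volume.restrict (𝒰.piece i)]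
      chartBilin I (glueSym 𝒰 fun i => t i) (𝒰.center i) := fun t i => MemLp.coeFn_toLp _
  have hsym : ∀ t, R₀ t ∈ symForms 𝒰 q F := fun t => ⟨_, glueSym_symm 𝒰 _, hR₀ t⟩
  have hcongr : ∀ {w w' : Fin 𝒰.size → E → E →L[ℝ] E →L[ℝ] F},
      (∀ i, w i =ᵐ[volume.restrict (𝒰.piece i)] w' i) → ∀ i,
      chartBilin I (glueSym 𝒰 w) (𝒰.center i) =ᵐ[volume.restrict (𝒰.piece i)]
        chartBilin I (glueSym 𝒰 w') (𝒰.center i) := fun h i =>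
    ae_restrict_of_ae_restrict_of_subset (𝒰.piece_subset i) (chartBilin_glueSym_congr 𝒰 h _)
  have hadd : ∀ t t', R₀ (t + t') = R₀ t + R₀ t' := by
    intro t t'
    funext i
    refine Lp.ext ?_
    filter_upwards [hR₀ (t + t') i, hR₀ t i, hR₀ t' i, PieceLp.coeFn_add (R₀ t) (R₀ t') i,
      hcongr (fun j => PieceLp.coeFn_add t t' j) i] with y a b b' d e
    rw [a, e]
    refine Eq.trans ?_ d.symm
    rw [b, b']
    ext X Y
    simp only [chartBilin, glueSym_add]
    rfl
  have hsmul : ∀ (a : ℝ) t, R₀ (a • t) = a • R₀ t := by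
    intro a t
    funext i
    refine Lp.ext ?_
    filter_upwards [hR₀ (a • t) i, hR₀ t i, PieceLp.coeFn_smul a (R₀ t) i,
      hcongr (fun j => PieceLp.coeFn_smul a t j) i] with y a b d e
    rw [a, e]
    refine Eq.trans ?_ d.symm
    rw [b]
    ext X Y
    simp only [chartBilin, glueSym_smul]
    rfl
  have hbound : ∀ t, ‖R₀ t‖ ≤ (∑ i, C i : ℝ≥0) * ‖t‖ := by
    intro t
    refine (pi_norm_le_iff_of_nonneg (x := (R₀ t : ∀ i, Lp (E →L[ℝ] E →L[ℝ] F) q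
      (volume.restrict (𝒰.piece i)))) (by positivity)).2 fun i => ?_
    have h1 : ‖R₀ t i‖ₑ ≤ C i * ‖t‖ₑ := by
      rw [Lp.enorm_def, eLpNorm_congr_ae (hR₀ t i)]
      exact (hC i t).2
    have h2 : ‖R₀ t i‖₊ ≤ C i * ‖t‖₊ := by
      rw [enorm_eq_nnnorm, enorm_eq_nnnorm] at h1
      exact_mod_cast h1
    have h3 : ‖R₀ t i‖ ≤ C i * ‖t‖ := by exact_mod_cast h2
    refine h3.trans (mul_le_mul_of_nonneg_right ?_ (norm_nonneg t))
    exact_mod_cast Finset.single_le_sum (f := C) (fun _ _ => zero_le) (Finset.mem_univ i)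
  let R₁ : PieceLp 𝒰 q (E →L[ℝ] E →L[ℝ] F) →ₗ[ℝ] LebesgueSym 𝒰 q F :=
    { toFun := fun t => ⟨R₀ t, hsym t⟩
      map_add' := fun t t' => Subtype.ext (hadd t t')
      map_smul' := fun a t => Subtype.ext (hsmul a t) }
  refine ⟨R₁.mkContinuous _ hbound, fun s => ?_⟩
  obtain ⟨S, hS, hs⟩ := s.2
  refine Subtype.ext ?_
  change R₀ s.1 = s.1
  funext i
  refine Lp.ext ?_
  filter_upwards [hR₀ s.1 i, hs i, hcongr hs i,
    ae_restrict_mem (𝒰.isCompact_piece i).measurableSet] with y a b d hy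
  rw [a, b, d]
  exact chartBilin_glueSym_chartBilin 𝒰 hS (𝒰.piece_subset i hy)

end Retraction

/-! ### Trilinear operators from joint bounds. -/

section Trilinear

variable {A B D Z : Type*} [NormedAddCommGroup A] [NormedSpace ℝ A] [NormedAddCommGroup B]
  [NormedSpace ℝ B] [NormedAddCommGroup D] [NormedSpace ℝ D] [NormedAddCommGroup Z]
  [NormedSpace ℝ Z]

theorem exists_trilinear (T : A → B → D → Z) {C : ℝ} (hC : 0 ≤ C)
    (add₁ : ∀ a a' b d, T (a + a') b d = T a b d + T a' b d)
    (smul₁ : ∀ (k : ℝ) a b d, T (k • a) b d = k • T a b d)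
    (add₂ : ∀ a b b' d, T a (b + b') d = T a b d + T a b' d)
    (smul₂ : ∀ (k : ℝ) a b d, T a (k • b) d = k • T a b d)
    (add₃ : ∀ a b d d', T a b (d + d') = T a b d + T a b d')
    (smul₃ : ∀ (k : ℝ) a b d, T a b (k • d) = k • T a b d)
    (bound : ∀ a b d, ‖T a b d‖ ≤ C * ‖a‖ * ‖b‖ * ‖d‖) :
    ∃ N : A →L[ℝ] B →L[ℝ] D →L[ℝ] Z, ∀ a b d, N a b d = T a b d := by
  let T₂ : A → B →L[ℝ] D →L[ℝ] Z := fun a =>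
    (LinearMap.mk₂ ℝ (T a) (add₂ a) (fun k => smul₂ k a) (add₃ a) (fun k => smul₃ k a)).mkContinuous₂
      (C * ‖a‖) (bound a)
  let T₃ : A →ₗ[ℝ] B →L[ℝ] D →L[ℝ] Z :=
    { toFun := T₂
      map_add' := fun a a' => by ext b d; exact add₁ a a' b d
      map_smul' := fun k a => by ext b d; exact smul₁ k a b d }
  refine ⟨T₃.mkContinuous C fun a => ?_, fun a b d => rfl⟩
  exact LinearMap.mkContinuous₂_norm_le _ (by positivity) (bound a)

end Trilinear

/-! ### Smooth dependence of the pseudoinverse in spaces of continuous maps. -/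

section ContinuousMapPseudoinverse

variable {K : Type*} [TopologicalSpace K] [CompactSpace K]

/-- Pointwise composition of continuous families of operators. -/
noncomputable def ContinuousMap.clmComp {X Y Z : Type*} [NormedAddCommGroup X] [NormedSpace ℝ X]
    [NormedAddCommGroup Y] [NormedSpace ℝ Y] [NormedAddCommGroup Z] [NormedSpace ℝ Z] :
    C(K, Y →L[ℝ] Z) →L[ℝ] C(K, X →L[ℝ] Y) →L[ℝ] C(K, X →L[ℝ] Z) :=
  LinearMap.mkContinuous₂ (LinearMap.mk₂ ℝ
    (fun (f : C(K, Y →L[ℝ] Z)) (g : C(K, X →L[ℝ] Y)) =>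
      (⟨fun y => (f y).comp (g y), f.continuous.clm_comp g.continuous⟩ : C(K, X →L[ℝ] Z)))
    (fun f f' g => by ext; simp) (fun a f g => by ext; simp) (fun f g g' => by ext; simp)
    (fun a f g => by ext; simp)) 1 fun f g => by
      refine (ContinuousMap.norm_le _ (by positivity)).2 fun y => ?_
      rw [one_mul]
      exact (ContinuousLinearMap.opNorm_comp_le _ _).trans
        (mul_le_mul (f.norm_coe_le_norm y) (g.norm_coe_le_norm y) (norm_nonneg _) (norm_nonneg _))

variable {E : Type*} [NormedAddCommGroup E] [InnerProductSpace ℝ E] [FiniteDimensional ℝ E]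
    {F : Type*} [NormedAddCommGroup F] [InnerProductSpace ℝ F] [FiniteDimensional ℝ F]

/-- Pointwise adjoints of continuous families of operators. -/
noncomputable def ContinuousMap.adjoint : C(K, E →L[ℝ] F) →L[ℝ] C(K, F →L[ℝ] E) :=
  ContinuousLinearMap.compLeftContinuous ℝ K adjointCLM

/-- The pseudoinverses of a continuous family of injective operators. -/
noncomputable def ContinuousMap.pseudoinverse (f : C(K, E →L[ℝ] F)) : C(K, F →L[ℝ] E) :=
  ContinuousMap.clmComp (Ring.inverse (ContinuousMap.clmComp (ContinuousMap.adjoint f) f))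
    (ContinuousMap.adjoint f)

variable {f : C(K, E →L[ℝ] F)}

/-- A continuous family of endomorphisms is a unit of the Banach algebra of such families if and
only if it is invertible at each point. -/
theorem ContinuousMap.isUnit_adjoint_comp (hf : ∀ y, Function.Injective (f y)) :
    IsUnit (ContinuousMap.clmComp (ContinuousMap.adjoint f) f) :=
  (ContinuousMap.isUnit_iff_forall_isUnit _).2 fun y => _root_.isUnit_adjoint_comp (hf y)

theorem ContinuousMap.pseudoinverse_apply (hf : ∀ y, Function.Injective (f y)) (y : K) :
    ContinuousMap.pseudoinverse f y = _root_.pseudoinverse (f y) := by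
  have h1 := Ring.mul_inverse_cancel _ (ContinuousMap.isUnit_adjoint_comp hf)
  have h2 := Ring.inverse_mul_cancel _ (_root_.isUnit_adjoint_comp (hf y))
  have h3 := DFunLike.congr_fun h1 y
  set R := Ring.inverse (ContinuousMap.clmComp (ContinuousMap.adjoint f) f) with hR
  have h4 : ((adjointCLM (f y)).comp (f y)) * R y = 1 := h3
  have h5 : R y = Ring.inverse ((adjointCLM (f y)).comp (f y)) := by
    rw [← one_mul (R y), ← h2, mul_assoc, h4, mul_one]
  change (R y).comp (adjointCLM (f y)) = _
  rw [h5]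
  rfl

/-- Adjoints are continuous linear, compositions continuous bilinear, and inversion is smooth at
units of a Banach algebra. Working in the algebra of families makes the dependence on the whole
family smooth, beyond smoothness at each point. -/
theorem ContinuousMap.contDiffAt_pseudoinverse (hf : ∀ y, Function.Injective (f y)) :
    ContDiffAt ℝ ∞ (ContinuousMap.pseudoinverse : C(K, E →L[ℝ] F) → C(K, F →L[ℝ] E)) f := by
  have h0 : ContDiffAt ℝ ∞ (fun f : C(K, E →L[ℝ] F) => ContinuousMap.adjoint f) f :=
    (ContinuousMap.adjoint (K := K) (E := E) (F := F)).contDiff.contDiffAt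
  have h1 : ContDiffAt ℝ ∞ (fun f : C(K, E →L[ℝ] F) =>
      ContinuousMap.clmComp (ContinuousMap.adjoint f) f) f :=
    ((ContinuousMap.clmComp (K := K) (X := E) (Y := F) (Z := E)).contDiff.contDiffAt.comp f
      h0).clm_apply contDiffAt_id
  obtain ⟨x, hx⟩ := ContinuousMap.isUnit_adjoint_comp hf
  have h2 : ContDiffAt ℝ ∞ (Ring.inverse : C(K, E →L[ℝ] E) → C(K, E →L[ℝ] E))
      (ContinuousMap.clmComp (ContinuousMap.adjoint f) f) := by
    rw [← hx]; exact contDiffAt_ringInverse ℝ x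
  have h3 := ContDiffAt.comp (f := fun f : C(K, E →L[ℝ] F) =>
      ContinuousMap.clmComp (ContinuousMap.adjoint f) f) f h2 h1
  exact ((ContinuousMap.clmComp (K := K) (X := F) (Y := E) (Z := E)).contDiff.contDiffAt.comp f
      h3).clm_apply h0

end ContinuousMapPseudoinverse

/-! ### The two terms of the Hessian as bounded multilinear operators. -/

section HessianOperator

open scoped NNReal

variable {E : Type*} [NormedAddCommGroup E] [InnerProductSpace ℝ E]
    [FiniteDimensional ℝ E] [MeasurableSpace E] [BorelSpace E]
    {F : Type*} [NormedAddCommGroup F] [InnerProductSpace ℝ F] [FiniteDimensional ℝ F]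

/-- The extension by zero of a continuous function on a subset. -/
noncomputable def extendZero {X : Type*} [NormedAddCommGroup X] {S : Set E} (b : C(S, X)) :
    E → X := Function.extend Subtype.val b 0

theorem extendZero_coe {X : Type*} [NormedAddCommGroup X] {S : Set E} (b : C(S, X)) (y : S) :
    extendZero b y = b y := Subtype.val_injective.extend_apply _ _ _

theorem continuousOn_extendZero {X : Type*} [NormedAddCommGroup X] {S : Set E} (b : C(S, X)) :
    ContinuousOn (extendZero b) S := by
  rw [continuousOn_iff_continuous_domRestrict]
  exact b.continuous.congr fun y => (extendZero_coe b y).symm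

variable {H : Type*} [TopologicalSpace H] {I : ModelWithCorners ℝ E H}
    {M : Type*} [TopologicalSpace M] [ChartedSpace H M] [IsManifold I ∞ M] [T2Space M]
    {p r : ℝ≥0∞} [Fact (1 ≤ p)] [Fact (1 ≤ r)]

/-- The product of a first derivative of class `W^{1,r}` and a second derivative of class `L^p`. -/
theorem exists_eLpNorm_mul_jets_le (𝒰 : ChartCover I M) (r : ℝ≥0∞) [Fact (1 ≤ r)]
    (hn : (Module.finrank ℝ E : ℝ≥0∞) < p) (i : Fin 𝒰.size) :
    ∃ C : ℝ≥0, ∀ (f : SobolevTwo 𝒰 p F) (u : SobolevTwo 𝒰 r F),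
      eLpNorm (fun y => ‖u.1.2.1 i y‖ * ‖f.1.2.2 i y‖) (min p r) (volume.restrict (𝒰.piece i)) ≤
        C * ‖f‖ₑ * ‖u‖ₑ := by
  have hp : 1 ≤ p := Fact.out
  have hr : 1 ≤ r := Fact.out
  obtain ⟨n, B, hB, hBc, hcov⟩ := exists_finite_cover_isSolidConvex (𝒰.isCompact_piece i)
    (𝒰.piece_subset i)
  -- The multiplication inequality is applied on each convex body to `Du`, whose weak derivative is
  -- `D²u`, and to the norm of `D²f`.
  choose C hC using fun j => (hB j).exists_eLpNorm_mul_le (G := E →L[ℝ] F) hr hp hn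
  choose D hD using fun j => exists_eLpNorm_jetSize_le (F := F) 𝒰 p (hB j).isCompact (hBc j)
  choose D' hD' using fun j => exists_eLpNorm_jetSize_le (F := F) 𝒰 r (hB j).isCompact (hBc j)
  refine ⟨∑ j, C j * D j * (2 * D' j), fun f u => ?_⟩
  obtain ⟨f₀, hf₀⟩ := f.2
  obtain ⟨df, ddf, hf⟩ := isWeakJetOf_iff.1 hf₀
  obtain ⟨u₀, hu₀⟩ := u.2
  obtain ⟨du, ddu, hu⟩ := isWeakJetOf_iff.1 hu₀
  set c := 𝒰.center i
  have hcongr : (fun y => ‖u.1.2.1 i y‖ * ‖f.1.2.2 i y‖) =ᵐ[volume.restrict (𝒰.piece i)]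
      fun y => ‖chartForm I du c y‖ * ‖ddf c y‖ := by
    filter_upwards [(hu.ae_eq i).2.1, (hf.ae_eq i).2.2] with y a b
    rw [a, b]
  rw [eLpNorm_congr_ae hcongr]
  refine (eLpNorm_restrict_le_sum (fun j => (hB j).isCompact.measurableSet) hcov
    (le_min hp hr) fun j => ?_).trans ?_
  · exact ((hu.memLp_chartForm (hB j).isCompact (hBc j)).1.norm).mul
      ((hf.memLp_second (hB j).isCompact (hBc j)).1.norm)
  push_cast
  rw [Finset.sum_mul, Finset.sum_mul]
  refine Finset.sum_le_sum fun j _ => ?_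
  have e1 := hD j _ _ _ _ hf
  have e2 := hD' j _ _ _ _ hu
  have e3 := (eLpNorm_mono_real (p := p) (μ := volume.restrict (B j))
    (norm_second_le_jetSize (u := f₀) (du := df) (ddu := ddf) c)).trans e1
  have e4 := (eLpNorm_mono_real (p := r) (μ := volume.restrict (B j))
    (norm_chartForm_le_jetSize (u := u₀) (du := du) (ddu := ddu) c)).trans e2
  have e5 := (eLpNorm_mono_real (p := r) (μ := volume.restrict (B j))
    (norm_second_le_jetSize (u := u₀) (du := du) (ddu := ddu) c)).trans e2
  have e6 := hC j (chartForm I du c) (ddu c) (fun y => ‖ddf c y‖)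
    ((hu.hasWeakFDerivOn c).mono (interior_mono (hBc j)))
    (hu.memLp_chartForm (hB j).isCompact (hBc j)) (hu.memLp_second (hB j).isCompact (hBc j))
    (hf.memLp_second (hB j).isCompact (hBc j)).norm
  rw [eLpNorm_norm] at e6
  calc _ ≤ _ := e6
    _ ≤ C j * (D j * ‖f.1‖ₑ) * (D' j * ‖u.1‖ₑ + D' j * ‖u.1‖ₑ) := by gcongr
    _ = C j * D j * (2 * D' j) * ‖f.1‖ₑ * ‖u.1‖ₑ := by ring
    _ = _ := rfl

theorem norm_correction_le (a : E →L[ℝ] F) (P : F →L[ℝ] E) (e : E →L[ℝ] E →L[ℝ] F) :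
    ‖(ContinuousLinearMap.compL ℝ E F F (a.comp P)).comp e‖ ≤ ‖P‖ * (‖a‖ * ‖e‖) := by
  refine ContinuousLinearMap.opNorm_le_bound₂ _ (by positivity) fun w w' => ?_
  calc ‖a (P (e w w'))‖ ≤ ‖a‖ * (‖P‖ * (‖e‖ * ‖w‖ * ‖w'‖)) :=
        a.le_opNorm_of_le (P.le_opNorm_of_le (e.le_opNorm₂ w w'))
    _ = _ := by ring

/-- The trilinear operator `(P, f, u) ↦ Du ∘ P ∘ D²f`. -/
theorem exists_correction (𝒰 : ChartCover I M) (r : ℝ≥0∞) [Fact (1 ≤ r)]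
    (hn : (Module.finrank ℝ E : ℝ≥0∞) < p) :
    ∃ N : (∀ i, C(𝒰.piece i, F →L[ℝ] E)) →L[ℝ] SobolevTwo 𝒰 p F →L[ℝ] SobolevTwo 𝒰 r F →L[ℝ]
        PieceLp 𝒰 (min p r) (E →L[ℝ] E →L[ℝ] F),
      ∀ b f u i, N b f u i =ᵐ[volume.restrict (𝒰.piece i)] fun y =>
        (ContinuousLinearMap.compL ℝ E F F ((u.1.2.1 i y).comp (extendZero (b i) y))).comp
          (f.1.2.2 i y) := by
  choose C hC using exists_eLpNorm_mul_jets_le (F := F) 𝒰 r hn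
  let g : (∀ i, C(𝒰.piece i, F →L[ℝ] E)) → SobolevTwo 𝒰 p F → SobolevTwo 𝒰 r F →
      Fin 𝒰.size → E → E →L[ℝ] E →L[ℝ] F := fun b f u i y =>
    (ContinuousLinearMap.compL ℝ E F F ((u.1.2.1 i y).comp (extendZero (b i) y))).comp (f.1.2.2 i y)
  have hgm : ∀ b f u i, AEStronglyMeasurable (g b f u i) (volume.restrict (𝒰.piece i)) := by
    intro b f u i
    have hb := (continuousOn_extendZero (b i)).aestronglyMeasurable_of_isCompact (μ := volume)
      (𝒰.isCompact_piece i) (𝒰.isCompact_piece i).measurableSet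
    have h1 := (ContinuousLinearMap.compL ℝ F E F).aestronglyMeasurable_comp₂
      (Lp.aestronglyMeasurable (u.1.2.1 i)) hb
    have h2 := (ContinuousLinearMap.compL ℝ E F F).continuous.comp_aestronglyMeasurable h1
    exact (ContinuousLinearMap.compL ℝ E (E →L[ℝ] F) (E →L[ℝ] F)).aestronglyMeasurable_comp₂ h2
      (Lp.aestronglyMeasurable (f.1.2.2 i))
  have hgb : ∀ b f u i, eLpNorm (g b f u i) (min p r) (volume.restrict (𝒰.piece i)) ≤
      ENNReal.ofReal ‖b‖ * (C i * ‖f‖ₑ * ‖u‖ₑ) := by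
    intro b f u i
    refine (eLpNorm_le_mul_eLpNorm_of_ae_le_mul (c := ‖b‖)
      (g := fun y => ‖u.1.2.1 i y‖ * ‖f.1.2.2 i y‖) ?_ _).trans (by gcongr; exact hC i f u)
    filter_upwards [ae_restrict_mem (𝒰.isCompact_piece i).measurableSet] with y hy
    refine (norm_correction_le _ _ _).trans ?_
    rw [norm_mul, norm_norm, norm_norm]
    refine mul_le_mul_of_nonneg_right ?_ (by positivity)
    rw [extendZero_coe (b i) ⟨y, hy⟩]
    exact ((b i).norm_coe_le_norm _).trans (norm_le_pi_norm b i)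
  have hgL : ∀ b f u i, MemLp (g b f u i) (min p r) (volume.restrict (𝒰.piece i)) :=
    fun b f u i => ⟨hgm b f u i, (hgb b f u i).trans_lt
      (ENNReal.mul_lt_top (by simp) (ENNReal.mul_lt_top (ENNReal.mul_lt_top (by simp) (by simp))
        (by simp)))⟩
  let T : (∀ i, C(𝒰.piece i, F →L[ℝ] E)) → SobolevTwo 𝒰 p F → SobolevTwo 𝒰 r F →
      PieceLp 𝒰 (min p r) (E →L[ℝ] E →L[ℝ] F) := fun b f u i => (hgL b f u i).toLp _
  have hT : ∀ b f u i, T b f u i =ᵐ[volume.restrict (𝒰.piece i)] g b f u i :=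
    fun b f u i => MemLp.coeFn_toLp _
  have hmem : ∀ i, ∀ᵐ y ∂(volume.restrict (𝒰.piece i)), y ∈ 𝒰.piece i :=
    fun i => ae_restrict_mem (𝒰.isCompact_piece i).measurableSet
  -- One statement for all three arguments: additivity in any slot follows from an almost everywhere
  -- identity of the coordinate expressions.
  have hadd : ∀ {b b' b'' f f' f'' u u' u''}, (∀ i, g b f u i =ᵐ[volume.restrict (𝒰.piece i)]
      fun y => g b' f' u' i y + g b'' f'' u'' i y) → T b f u = T b' f' u' + T b'' f'' u'' := by
    intro b b' b'' f f' f'' u u' u'' h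
    funext i
    refine Lp.ext ?_
    filter_upwards [hT b f u i, hT b' f' u' i, hT b'' f'' u'' i, h i,
      PieceLp.coeFn_add (T b' f' u') (T b'' f'' u'') i] with y h1 h2 h3 h4 h5
    rw [h1, h4, ← h2, ← h3]
    exact h5.symm
  have hsmul : ∀ {k : ℝ} {b b' f f' u u'}, (∀ i, g b f u i =ᵐ[volume.restrict (𝒰.piece i)]
      fun y => k • g b' f' u' i y) → T b f u = k • T b' f' u' := by
    intro k b b' f f' u u' h
    funext i
    refine Lp.ext ?_
    filter_upwards [hT b f u i, hT b' f' u' i, h i,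
      PieceLp.coeFn_smul k (T b' f' u') i] with y h1 h2 h4 h5
    rw [h1, h4, ← h2]
    exact h5.symm
  have hbound : ∀ b f u, ‖T b f u‖ ≤ ((∑ i, C i : ℝ≥0) : ℝ) * ‖b‖ * ‖f‖ * ‖u‖ := by
    intro b f u
    refine (pi_norm_le_iff_of_nonneg (x := (T b f u : ∀ i, Lp (E →L[ℝ] E →L[ℝ] F) (min p r)
      (volume.restrict (𝒰.piece i)))) (by positivity)).2 fun i => ?_
    have h1 : ‖T b f u i‖ₑ ≤ ENNReal.ofReal ‖b‖ * (C i * ‖f‖ₑ * ‖u‖ₑ) := by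
      rw [Lp.enorm_def, eLpNorm_congr_ae (hT b f u i)]
      exact hgb b f u i
    have h2 : ‖T b f u i‖₊ ≤ ‖b‖₊ * (C i * ‖f‖₊ * ‖u‖₊) := by
      rw [ofReal_norm, enorm_eq_nnnorm, enorm_eq_nnnorm, enorm_eq_nnnorm, enorm_eq_nnnorm] at h1
      exact_mod_cast h1
    have h3 : ‖T b f u i‖ ≤ ‖b‖ * (C i * ‖f‖ * ‖u‖) := by exact_mod_cast h2
    refine h3.trans ?_
    have h4 : (C i : ℝ) ≤ (∑ i, C i : ℝ≥0) := by
      exact_mod_cast Finset.single_le_sum (f := C) (fun _ _ => zero_le) (Finset.mem_univ i)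
    calc ‖b‖ * (C i * ‖f‖ * ‖u‖) ≤ ‖b‖ * ((∑ i, C i : ℝ≥0) * ‖f‖ * ‖u‖) := by gcongr
      _ = _ := by ring
  obtain ⟨N, hN⟩ := exists_trilinear T (C := ((∑ i, C i : ℝ≥0) : ℝ)) (by positivity)
    (fun b b' f u => hadd fun i => by
      filter_upwards [hmem i] with y hy
      simp only [g]
      rw [extendZero_coe _ ⟨y, hy⟩, extendZero_coe _ ⟨y, hy⟩, extendZero_coe _ ⟨y, hy⟩]
      simp)
    (fun k b f u => hsmul fun i => by
      filter_upwards [hmem i] with y hy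
      simp only [g]
      rw [extendZero_coe _ ⟨y, hy⟩, extendZero_coe _ ⟨y, hy⟩]
      simp)
    (fun b f f' u => hadd fun i => by
      filter_upwards [PieceLp.coeFn_add f.1.2.2 f'.1.2.2 i] with y hy
      have hy' : (f + f').1.2.2 i y = f.1.2.2 i y + f'.1.2.2 i y := hy
      simp only [g, hy']
      simp)
    (fun k b f u => hsmul fun i => by
      filter_upwards [PieceLp.coeFn_smul k f.1.2.2 i] with y hy
      have hy' : (k • f).1.2.2 i y = k • f.1.2.2 i y := hy
      simp only [g, hy']
      simp)
    (fun b f u u' => hadd fun i => by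
      filter_upwards [PieceLp.coeFn_add u.1.2.1 u'.1.2.1 i] with y hy
      have hy' : (u + u').1.2.1 i y = u.1.2.1 i y + u'.1.2.1 i y := hy
      simp only [g, hy']
      simp)
    (fun k b f u => hsmul fun i => by
      filter_upwards [PieceLp.coeFn_smul k u.1.2.1 i] with y hy
      have hy' : (k • u).1.2.1 i y = k • u.1.2.1 i y := hy
      simp only [g, hy']
      simp)
    hbound
  exact ⟨N, fun b f u i => by rw [hN]; exact hT b f u i⟩

/-- The second derivatives of functions of class `W^{2,r}`, as functions of class `L^q`, `q ≤ r`. -/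
theorem exists_secondDeriv (𝒰 : ChartCover I M) {q : ℝ≥0∞} [Fact (1 ≤ q)] (hq : q ≤ r) :
    ∃ J : SobolevTwo 𝒰 r F →L[ℝ] PieceLp 𝒰 q (E →L[ℝ] E →L[ℝ] F),
      ∀ u i, J u i =ᵐ[volume.restrict (𝒰.piece i)] u.1.2.2 i := by
  have hfin : ∀ i, IsFiniteMeasure (volume.restrict (𝒰.piece i) : Measure E) := fun i =>
    ⟨by simpa using (𝒰.isCompact_piece i).measure_lt_top⟩
  -- The constant of the inclusion of `L^r` into `L^q` on a set of finite measure.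
  set C : Fin 𝒰.size → ℝ≥0∞ := fun i =>
    (volume.restrict (𝒰.piece i)) univ ^ (1 / q.toReal - 1 / r.toReal) with hCdef
  have hC : ∀ i, C i ≠ ⊤ := fun i => by
    refine ENNReal.rpow_ne_top_of_nonneg ?_ (measure_ne_top _ _)
    rw [sub_nonneg]
    by_cases hr : r = ⊤
    · simp [hr]
    · have hq0 : 0 < q.toReal := ENNReal.toReal_pos (zero_lt_one.trans_le (Fact.out : 1 ≤ q)).ne'
        (ne_top_of_le_ne_top hr hq)
      exact one_div_le_one_div_of_le hq0 (ENNReal.toReal_mono hr hq)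
  have hb : ∀ (u : SobolevTwo 𝒰 r F) i, eLpNorm (u.1.2.2 i) q (volume.restrict (𝒰.piece i)) ≤
      C i * ‖u‖ₑ := by
    intro u i
    refine (eLpNorm_le_eLpNorm_mul_rpow_measure_univ hq (Lp.aestronglyMeasurable _)).trans ?_
    rw [mul_comm]
    gcongr
    exact (enorm_piece_le u.1.2.2 i).trans
      (enorm_le_iff_norm_le.2 ((norm_snd_le u.1.2).trans (norm_snd_le u.1)))
  have hL : ∀ (u : SobolevTwo 𝒰 r F) i, MemLp (u.1.2.2 i) q (volume.restrict (𝒰.piece i)) :=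
    fun u i => ⟨Lp.aestronglyMeasurable _, (hb u i).trans_lt
      (ENNReal.mul_lt_top (hC i).lt_top (by simp))⟩
  let J₀ : SobolevTwo 𝒰 r F → PieceLp 𝒰 q (E →L[ℝ] E →L[ℝ] F) := fun u i => (hL u i).toLp _
  have hJ₀ : ∀ u i, J₀ u i =ᵐ[volume.restrict (𝒰.piece i)] u.1.2.2 i :=
    fun u i => MemLp.coeFn_toLp _
  have hbound : ∀ u, ‖J₀ u‖ ≤ ((∑ i, (C i).toNNReal : ℝ≥0) : ℝ) * ‖u‖ := by
    intro u
    refine (pi_norm_le_iff_of_nonneg (x := (J₀ u : ∀ i, Lp (E →L[ℝ] E →L[ℝ] F) q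
      (volume.restrict (𝒰.piece i)))) (by positivity)).2 fun i => ?_
    have h1 : ‖J₀ u i‖ₑ ≤ ((C i).toNNReal : ℝ≥0∞) * ‖u‖ₑ := by
      rw [Lp.enorm_def, eLpNorm_congr_ae (hJ₀ u i), ENNReal.coe_toNNReal (hC i)]
      exact hb u i
    have h2 : ‖J₀ u i‖₊ ≤ (C i).toNNReal * ‖u‖₊ := by
      rw [enorm_eq_nnnorm, enorm_eq_nnnorm] at h1
      exact_mod_cast h1
    have h3 : ‖J₀ u i‖ ≤ (C i).toNNReal * ‖u‖ := by exact_mod_cast h2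
    refine h3.trans (mul_le_mul_of_nonneg_right ?_ (norm_nonneg u))
    exact_mod_cast Finset.single_le_sum (f := fun i => (C i).toNNReal) (fun _ _ => zero_le)
      (Finset.mem_univ i)
  let J₁ : SobolevTwo 𝒰 r F →ₗ[ℝ] PieceLp 𝒰 q (E →L[ℝ] E →L[ℝ] F) :=
    { toFun := J₀
      map_add' := fun u u' => by
        funext i
        refine Lp.ext ?_
        filter_upwards [hJ₀ (u + u') i, hJ₀ u i, hJ₀ u' i, PieceLp.coeFn_add (J₀ u) (J₀ u') i,
          PieceLp.coeFn_add u.1.2.2 u'.1.2.2 i] with y h1 h2 h3 h4 h5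
        have h5' : (u + u').1.2.2 i y = u.1.2.2 i y + u'.1.2.2 i y := h5
        rw [h1, h5', ← h2, ← h3]
        exact h4.symm
      map_smul' := fun a u => by
        funext i
        refine Lp.ext ?_
        filter_upwards [hJ₀ (a • u) i, hJ₀ u i, PieceLp.coeFn_smul a (J₀ u) i,
          PieceLp.coeFn_smul a u.1.2.2 i] with y h1 h2 h4 h5
        have h5' : (a • u).1.2.2 i y = a • u.1.2.2 i y := h5
        rw [h1, h5', ← h2]
        exact h4.symm }
  exact ⟨J₁.mkContinuous _ hbound, hJ₀⟩

end HessianOperator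

/-! ### The Hessian as a well-defined class. -/

section HessianClass

variable {E : Type*} [NormedAddCommGroup E] [InnerProductSpace ℝ E]
    [FiniteDimensional ℝ E] [MeasurableSpace E] [BorelSpace E]
    {F : Type*} [NormedAddCommGroup F] [InnerProductSpace ℝ F] [FiniteDimensional ℝ F]
    {H : Type*} [TopologicalSpace H] {I : ModelWithCorners ℝ E H}
    {M : Type*} [TopologicalSpace M] [ChartedSpace H M] [IsManifold I ∞ M] [T2Space M]
    {𝒰 : ChartCover I M} {p r q : ℝ≥0∞} [Fact (1 ≤ p)] [Fact (1 ≤ r)] [Fact (1 ≤ q)]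

/-- `t` is given by the coordinate formula for the Hessian of `u` with respect to `f`. -/
def IsHessianFormula (hn : (Module.finrank ℝ E : ℝ≥0∞) < p) (f : SobolevTwo 𝒰 p F)
    (u : SobolevTwo 𝒰 r F) (t : PieceLp 𝒰 q (E →L[ℝ] E →L[ℝ] F)) : Prop :=
  ∀ i, t i =ᵐ[volume.restrict (𝒰.piece i)] fun y =>
    hessCoord (u.1.2.1 i y) (u.1.2.2 i y)
      (pseudoinverse (chartForm I (diffForm I (f.rep hn)) (𝒰.center i) y)) (f.1.2.2 i y)

variable {hn : (Module.finrank ℝ E : ℝ≥0∞) < p} {f : SobolevTwo 𝒰 p F} {u : SobolevTwo 𝒰 r F}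

theorem injective_diffForm_rep (hf : f ∈ SobolevImm 𝒰 p F) (x : M) :
    Function.Injective (diffForm I (f.rep hn) x) := by
  obtain ⟨f₀, hw, hf₀, hinj⟩ := hf
  obtain ⟨du, ddu, h⟩ := isWeakJetOf_iff.1 hw
  rw [← SobolevTwo.eq_rep hn hf₀.continuous fun i => (h.ae_eq i).1]
  exact hinj x

/-- Gives uniqueness: whatever representatives and weak differentials are chosen, the coordinate
expressions depend on the jets of `f` and `u` alone. -/
theorem IsHessian.ae_eq_hessCoord (hn : (Module.finrank ℝ E : ℝ≥0∞) < p)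
    (hf : f ∈ SobolevImm 𝒰 p F) {f₀ u₀ : M → F}
    {S : ∀ x : M, TangentSpace I x →L[ℝ] TangentSpace I x →L[ℝ] F} (hS : IsHessian I f₀ u₀ S)
    (hf₀ : IsWeakJetOf f.1 f₀) (hu₀ : IsWeakJetOf u.1 u₀) (i : Fin 𝒰.size) :
    chartBilin I S (𝒰.center i) =ᵐ[volume.restrict (𝒰.piece i)] fun y =>
      hessCoord (u.1.2.1 i y) (u.1.2.2 i y)
        (pseudoinverse (chartForm I (diffForm I (f.rep hn)) (𝒰.center i) y)) (f.1.2.2 i y) := by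
  obtain ⟨du, ddu, hu⟩ := isWeakJetOf_iff.1 hu₀
  obtain ⟨df', ddf', hf'⟩ := isWeakJetOf_iff.1 hf₀
  obtain ⟨ddf, hrep⟩ := f.exists_hasLocalJets hn
  have h := hS.chartBilin_ae_eq hn (f.contMDiff_rep hn) (injective_diffForm_rep hf) hrep hu
    (hf'.chartAE_eq hrep) (hu.chartAE_eq hu) (𝒰.center i)
  filter_upwards [ae_restrict_of_ae_restrict_of_subset (𝒰.piece_subset i) h, (hu.ae_eq i).2.1,
    (hu.ae_eq i).2.2, (hrep.ae_eq i).2.2] with y h1 h2 h3 h4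
  rw [h1, h2, h3, h4]

/-- A Hessian section exists by calculus alone; its integrability is inherited from `t`, which has
the same coordinate expressions. These expressions also force any other Hessian class to be the
same. -/
theorem IsHessianFormula.isHessianClass_iff {t : PieceLp 𝒰 q (E →L[ℝ] E →L[ℝ] F)}
    (ht : IsHessianFormula hn f u t) (hf : f ∈ SobolevImm 𝒰 p F) :
    ∃ s₀ : LebesgueSym 𝒰 q F, s₀.1 = t ∧ ∀ s : LebesgueSym 𝒰 q F, IsHessianClass f u s ↔ s = s₀ := by
  obtain ⟨u₀, hu₀⟩ := u.2
  obtain ⟨du, ddu, hu⟩ := isWeakJetOf_iff.1 hu₀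
  obtain ⟨ddf, hrep⟩ := f.exists_hasLocalJets hn
  have hf₀ : IsWeakJetOf f.1 (f.rep hn) := isWeakJetOf_iff.2 ⟨_, _, hrep⟩
  obtain ⟨S, hsymm, hS⟩ := exists_isHessian hn (f.contMDiff_rep hn) (injective_diffForm_rep hf)
    hrep hu
  have htS : IsSymFormOf t S :=
    ⟨hsymm, fun i => (ht i).trans (hS.ae_eq_hessCoord hn hf hf₀ hu₀ i).symm⟩
  refine ⟨⟨t, S, htS⟩, rfl, fun s => ⟨?_, ?_⟩⟩
  · rintro ⟨f₁, u₁, S₁, hf₁, hu₁, hs, hS₁⟩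
    refine Subtype.ext ?_
    funext i
    exact Lp.ext ((hs.2 i).trans ((hS₁.ae_eq_hessCoord hn hf hf₁ hu₁ i).trans (ht i).symm))
  · rintro rfl
    exact ⟨_, _, S, hf₀, hu₀, htS, hS⟩

end HessianClass

/-! ### The theorem. -/

theorem mainTheorem12 {E : Type*} [NormedAddCommGroup E] [InnerProductSpace ℝ E]
    [FiniteDimensional ℝ E] [MeasurableSpace E] [BorelSpace E]
    {F : Type*} [NormedAddCommGroup F] [InnerProductSpace ℝ F] [FiniteDimensional ℝ F]
    {H : Type*} [TopologicalSpace H] (I : ModelWithCorners ℝ E H)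
    (M : Type*) [TopologicalSpace M] [ChartedSpace H M] [IsManifold I ∞ M]
    [CompactSpace M] [T2Space M] (𝒰 : ChartCover I M)
    (p r : ℝ≥0∞) [Fact (1 ≤ p)] [Fact (1 ≤ r)] (hp : (Module.finrank ℝ E : ℝ≥0∞) < p) :
    IsOpen (SobolevImm 𝒰 p F) ∧
    ∃ Hess : SobolevTwo 𝒰 p F → (SobolevTwo 𝒰 r F →L[ℝ] LebesgueSym 𝒰 (min p r) F),
      (∀ f ∈ SobolevImm 𝒰 p F, ∀ u : SobolevTwo 𝒰 r F, ∀ s : LebesgueSym 𝒰 (min p r) F,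
        IsHessianClass f u s ↔ s = Hess f u) ∧
      ContDiffOn ℝ ∞ Hess (SobolevImm 𝒰 p F) := by
  obtain ⟨R, hR⟩ := exists_symForms_retraction (F := F) 𝒰 (min p r)
  obtain ⟨N, hN⟩ := exists_correction (F := F) 𝒰 r hp
  obtain ⟨J, hJ⟩ := exists_secondDeriv (F := F) 𝒰 (min_le_right p r)
  -- `Ring.inverse` is zero at non-units, so `P f` is defined for every `f` but is meaningful only
  -- for immersions; nothing is claimed about the other values.
  let P : SobolevTwo 𝒰 p F → ∀ i, C(𝒰.piece i, F →L[ℝ] E) := fun f i =>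
    ContinuousMap.pseudoinverse (SobolevTwo.differential hp i f)
  refine ⟨isOpen_sobolevImm 𝒰 hp, fun f => R.comp (J - N (P f) f), fun f hf u s => ?_,
    fun f hf => ?_⟩
  · have hinj := (SobolevTwo.mem_sobolevImm_iff hp f).1 hf
    have ht : IsHessianFormula hp f u (J u - N (P f) f u) := fun i => by
      have hsub : (J u - N (P f) f u) i =ᵐ[volume.restrict (𝒰.piece i)]
          fun y => J u i y - N (P f) f u i y := Lp.coeFn_sub (J u i) (N (P f) f u i)
      filter_upwards [hsub, hJ u i, hN (P f) f u i,
        ae_restrict_mem (𝒰.isCompact_piece i).measurableSet] with y h1 h2 h3 hy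
      rw [h1, h2, h3, extendZero_coe _ ⟨y, hy⟩]
      simp only [P]
      rw [ContinuousMap.pseudoinverse_apply (hinj i)]
      rfl
    obtain ⟨s₀, hs₀, h⟩ := ht.isHessianClass_iff hf
    rw [h s]
    -- `J u - N (P f) f u` already comes from the symmetric section `s₀`, so the projection `R`
    -- returns `s₀`. It is there to make the operator take values in the right space for all `f`.
    have : R.comp (J - N (P f) f) u = s₀ := by
      rw [← hR s₀, hs₀]
      rfl
    rw [this]
  · have hinj := (SobolevTwo.mem_sobolevImm_iff hp f).1 hf
    have hD : ∀ i, ContDiff ℝ ∞ (SobolevTwo.differential (𝒰 := 𝒰) (F := F) hp i) := fun i =>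
      ContinuousLinearMap.contDiff _
    -- The only nonlinear ingredient is the pseudoinverse of the differential; everything else is a
    -- composition of continuous multilinear maps.
    have hP : ContDiffAt ℝ ∞ P f := contDiffAt_pi.2 fun i =>
      (ContinuousMap.contDiffAt_pseudoinverse (hinj i)).comp f (hD i).contDiffAt
    have hNP : ContDiffAt ℝ ∞ (fun f => N (P f) f) f :=
      (N.contDiff.contDiffAt.comp f hP).clm_apply contDiffAt_id
    have hfin : ContDiffAt ℝ ∞ (fun f => R.comp (J - N (P f) f)) f :=
      contDiffAt_const.clm_comp (contDiffAt_const.sub hNP)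
    exact hfin.contDiffWithinAt
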